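/- Let $n\ge 0$, $\mu<0$ and $\kappa>0$ be given, let $P=\mathbb C^{n+1}\setminus\{0\}$, write $z\bar z=\sum_{i=1}^{n+1}|z^i|^2$, and let $E=\sum_i z^i\partial_{z^i}$, $\bar E=\sum_i\bar z^i\partial_{\bar z^i}$. Equip $P$ with the symplectic form $\omega=\frac{i}{\kappa}\sum_j dz^j\wedge d\bar z^j$, with Poisson bracket $\{f,g\}=\frac{\kappa}{i}\sum_j(\partial_{z^j}f\,\partial_{\bar z^j}g-\partial_{\bar z^j}f\,\partial_{z^j}g)$, and $C^\infty(P)[[\lambda]]$ with the corresponding Wick product $$f*g=\sum_{r\ge0}\lambda^rM_r(f,g),\qquad M_r(f,g)=\frac{\kappa^r}{r!}\sum_{i_1,\dots,i_r=1}^{n+1}\frac{\partial^rf}{\partial z^{i_1}\cdots\partial z^{i_r}}\frac{\partial^rg}{\partial\bar z^{i_1}\cdots\partial\bar z^{i_r}},$$ so that $M_1(f,g)-M_1(g,f)=i\{f,g\}$. Let $J(z)=-\frac12z\bar z-\mu$, $\mathcal C=J^{-1}(0)$, $\mathsf p(z)=\sqrt{-2\mu/z\bar z}\;z$ and $\mathrm{prol}(f)=f\circ\mathsf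 p$. For smooth $f$ let $\pi_J(f)=(f-\mathrm{prol} f)/J$ off $\mathcal C$ and $\pi_J(f)=\frac1{2\mu}(E+\bar E)f$ on $\mathcal C$. Put - $I=\{f: f|_{\mathcal C}=0\}$, $B=\{f:\{f,f'\}\in I\ \forall f'\in I\}$, $F=\{f:f=\mathrm{prol}(f)\}$, $I^*=\{g*J\}$, $B^*=\{f:f*g-g*f\in I^*\ \forall g\in I^*\}$ (all inside $C^\infty(P)[[\lambda]]$); - $T=\sum\lambda^mT_m$ with $T_0=\mathrm{Id}$, $T_m(f)=-\sum_{k=1}^mT_{m-k}(M_k(\pi_J(f),J))$, and $K=\frac\kappa2E\circ\pi_J$; - $S=\sum\lambda^mS_m$ on $B\cap F$: near every point of $P$ it is given, with some smooth local transversal section of the foliation of $\mathcal C$ by orbits of the Hamiltonian flow $\Phi_t$ of $J$, projection $\mathfrak p$ onto the section along the leaves and $p=\Phi_{t(p)}(\mathfrak p(p))$, by $S_0=\mathrm{Id}$ and, for $m\ge1$, $(S_mf)(p)=-i\int_0^{t(p)}F_{m+1}(f)(\Phi_t(\mathfrak p(p)))\,dt$ for $p\in\mathcal C$, prolonged radially,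 where $F_m(f)=\sum_{k=2}^mM_k^-(J,S_{m-k}f)+\sum_{i=1}^{m-1}\sum_{k=1}^{m-i}T_i(M_k^-(J,S_{m-k-i}f))$ and $M_k^-(f,g)=M_k(f,g)-M_k(g,f)$; - for $f,g\in B\cap F$, the reduced product $f\star g=S^{-1}(\mathrm{prol}(T(Sf*Sg)))\in B\cap F$. A series $h$ is called homogeneous if $h(cz)=h(z)$ for all $c\in\mathbb C\setminus\{0\}$, $z\in P$; homogeneous series are the series of smooth functions on $\mathbb{CP}^n$. Then: 1. For smooth $f$, $\pi_J(f)$ is the unique smooth $h$ on $P$ with $f=\mathrm{prol}(f)+hJ$, and the Hamiltonian flow of $J$ is $\Phi_t(z)=e^{i\kappa t/2}z$. 2. $T=\sum_r\lambda^rK^r=\frac1{1-\lambda K}$. 3. $B\cap F=B^*\cap F$ is the space of homogeneous series. An operator $S$ as described exists, and every such $S$ is the identity on $B\cap F$. 4. For homogeneous $f,g$ the reduced product exists, is unique, and is $$f\star g=\mathrm{prol}\Big(\tfrac1{1-\lambda K}(f*g)\Big)=\sum_{k,l\ge0}\Big(\frac{\lambda}{-2\mu}\Big)^{k+l}\kappa^{l}A^{(k)}_l\,(z\bar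 z)^kM_k(f,g),\qquad A^{(k)}_l=(-1)^l\sum_{i_1=1}^k\sum_{i_2=1}^{i_1}\cdots\sum_{i_l=1}^{i_{l-1}}i_1i_2\cdots i_l$$ (for $\kappa=1$ the factor $\kappa^l$ is absent and $K=\frac12E\circ\pi_J$). It is a star product on $\mathbb{CP}^n$: homogeneous series form an associative algebra with unit $1$ under $\star$, $(f\star g)_0=f_0g_0$, $(f\star g-g\star f)_1=i\,\mathrm{prol}\{f_0,g_0\}$, and $\star$ is local. 5. For $k\ge1$: $A^{(k)}_l=\frac1{(k-1)!}\sum_{j=1}^k\binom{k-1}{j-1}(-1)^{k+l-j}j^{k+l-1}$. 6. $\star$ coincides with the star product of Bordemann, Brischle, Emmrich and Waldmann: for homogeneous $f,g$, $$f\star g=fg+\sum_{r\ge1}\Big(\frac{\kappa\lambda}{-2\mu}\Big)^r\sum_{s=1}^r\sum_{k=1}^s\frac{(-1)^{r-k}k^{r-1}}{s!\,(s-k)!\,(k-1)!}(z\bar z)^s\sum_{i_1,\dots,i_s}\frac{\partial^sf}{\partial z^{i_1}\cdots\partial z^{i_s}}\frac{\partial^sg}{\partial\bar z^{i_1}\cdots\partial\bar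 z^{i_s}},$$ and $f\star g$ is the unique homogeneous series such that $f*g-f\star g=a*J$ for some $U(1)$-invariant $a\in C^\infty(P)[[\lambda]]$ (quantum Marsden–Weinstein reduction). -/

import Mathlib

open scoped ContDiff

noncomputable section

namespace WickCPn

/-! ### The phase space and formal power series of functions on it

The phase space is `ℂⁿ⁺¹ ∖ {0}`.  Functions on it are represented by functions on `ℂⁿ⁺¹` whose value
at the origin is irrelevant: smoothness, and equality of series, only refer to `phase n`.
A formal power series `∑ λᵐ fₘ` is the sequence of its coefficients. -/

/-- The coordinate space `ℂⁿ⁺¹`. -/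
abbrev Coord (n : ℕ) : Type := Fin (n + 1) → ℂ

/-- Complex valued functions. -/
abbrev Fn (n : ℕ) : Type := Coord n → ℂ

/-- Formal power series in `λ` with coefficients in functions. -/
abbrev Series (n : ℕ) : Type := ℕ → Fn n

/-- The phase space `ℂⁿ⁺¹ ∖ {0}`. -/
def phase (n : ℕ) : Set (Coord n) := {z | z ≠ 0}

/-- Smooth functions on the phase space (smooth in the real sense). -/
def SmoothFn {n : ℕ} (f : Fn n) : Prop := ContDiffOn ℝ ∞ f (phase n)

/-- Formal power series of smooth functions on the phase space. -/
def smoothSeries (n : ℕ) : Set (Series n) := {f | ∀ m, SmoothFn (f m)}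

/-- Equality of formal power series of functions on the phase space. -/
def SEq {n : ℕ} (f g : Series n) : Prop := ∀ m, Set.EqOn (f m) (g m) (phase n)

/-- A function, regarded as a series concentrated in order `0`. -/
def constS {n : ℕ} (f : Fn n) : Series n
  | 0 => f
  | _ + 1 => 0

/-- The `λ`-linear extension of a formal series `∑ λᵃ Dₐ` of operators on functions. -/
def ext {n : ℕ} (D : ℕ → Fn n → Fn n) (f : Series n) : Series n :=
  fun m z => ∑ p ∈ Finset.HasAntidiagonal.antidiagonal m, D p.1 (f p.2) z

/-- The `λ`-bilinear extension of a formal series `∑ λʳ Dᵣ` of bilinear operators on functions. -/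
def ext₂ {n : ℕ} (D : ℕ → Fn n → Fn n → Fn n) (f g : Series n) : Series n :=
  fun m z => ∑ p ∈ Finset.HasAntidiagonal.antidiagonal m, ∑ q ∈ Finset.HasAntidiagonal.antidiagonal p.2,
    D p.1 (f q.1) (g q.2) z

/-! ### Wirtinger derivatives, Euler operators, Poisson bracket, Wick product -/

/-- `∂f/∂zⁱ`. -/
def dz {n : ℕ} (i : Fin (n + 1)) (f : Fn n) : Fn n := fun z =>
  (1 / 2) * (fderiv ℝ f z (Pi.single i 1) - Complex.I * fderiv ℝ f z (Pi.single i Complex.I))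

/-- `∂f/∂z̄ⁱ`. -/
def dzbar {n : ℕ} (i : Fin (n + 1)) (f : Fn n) : Fn n := fun z =>
  (1 / 2) * (fderiv ℝ f z (Pi.single i 1) + Complex.I * fderiv ℝ f z (Pi.single i Complex.I))

/-- `∂ʳf / ∂z^{i₁} ⋯ ∂z^{iᵣ}`. -/
def dzIter {n : ℕ} : (r : ℕ) → (Fin r → Fin (n + 1)) → Fn n → Fn n
  | 0, _, f => f
  | r + 1, i, f => dz (i 0) (dzIter r (fun j => i j.succ) f)

/-- `∂ʳf / ∂z̄^{i₁} ⋯ ∂z̄^{iᵣ}`. -/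
def dzbarIter {n : ℕ} : (r : ℕ) → (Fin r → Fin (n + 1)) → Fn n → Fn n
  | 0, _, f => f
  | r + 1, i, f => dzbar (i 0) (dzbarIter r (fun j => i j.succ) f)

/-- The Euler operator `E = ∑ zᵏ ∂/∂zᵏ`. -/
def euler {n : ℕ} (f : Fn n) : Fn n := fun z => ∑ i, z i * dz i f z

/-- The conjugate Euler operator `Ē = ∑ z̄ᵏ ∂/∂z̄ᵏ`. -/
def eulerBar {n : ℕ} (f : Fn n) : Fn n :=
  fun z => ∑ i, (starRingEnd ℂ) (z i) * dzbar i f z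

/-- The Poisson bracket of the symplectic form `ω = (i/κ) ∑ dzʲ ∧ dz̄ʲ`, namely
`{f, g} = (κ/i) ∑ (∂f/∂zʲ ∂g/∂z̄ʲ - ∂f/∂z̄ʲ ∂g/∂zʲ)`.  For `κ = 2` this is the standard bracket of
`ω = (i/2) ∑ dzʲ ∧ dz̄ʲ = ∑ dxʲ ∧ dyʲ`. -/
def poisson {n : ℕ} (κ : ℝ) (f g : Fn n) : Fn n := fun z =>
  ((κ : ℂ) / Complex.I) * ∑ i, (dz i f z * dzbar i g z - dzbar i f z * dz i g z)

/-- The Poisson bracket of two series. -/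
def poissonS {n : ℕ} (κ : ℝ) (f g : Series n) : Series n := fun m z =>
  ∑ p ∈ Finset.HasAntidiagonal.antidiagonal m, poisson κ (f p.1) (g p.2) z

/-- The contraction `∑_{i₁, …, iᵣ} ∂ʳf/∂z^{i₁}⋯∂z^{iᵣ} · ∂ʳg/∂z̄^{i₁}⋯∂z̄^{iᵣ}`. -/
def contraction {n : ℕ} (r : ℕ) (f g : Fn n) : Fn n := fun z =>
  ∑ i : Fin r → Fin (n + 1), dzIter r i f z * dzbarIter r i g z

/-- The bidifferential operators of the Wick product attached to `ω = (i/κ) ∑ dzʲ ∧ dz̄ʲ`: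
`Mᵣ(f, g) = (κʳ / r!) ∑ ∂ʳf/∂z^{i₁}⋯∂z^{iᵣ} ∂ʳg/∂z̄^{i₁}⋯∂z̄^{iᵣ}`.
In particular `M₁(f, g) - M₁(g, f) = i {f, g}`. -/
def wickM {n : ℕ} (κ : ℝ) (r : ℕ) (f g : Fn n) : Fn n := fun z =>
  ((κ : ℂ) ^ r / (r.factorial : ℂ)) * contraction r f g z

/-- `Mᵣ(f, g) - Mᵣ(g, f)`. -/
def wickAnti {n : ℕ} (κ : ℝ) (r : ℕ) (f g : Fn n) : Fn n := fun z =>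
  wickM κ r f g z - wickM κ r g f z

/-- The Wick product `f ∗ g = ∑ λʳ Mᵣ(f, g)` of two series. -/
def wick {n : ℕ} (κ : ℝ) (f g : Series n) : Series n := ext₂ (wickM κ) f g

/-! ### Constraint function, radial prolongation, component along the constraint -/

/-- `z z̄ = ∑ |zⁱ|²`. -/
def zz {n : ℕ} (z : Coord n) : ℝ := ∑ i, Complex.normSq (z i)

/-- The constraint function `J(z) = -½ z z̄ - μ`. -/
def J {n : ℕ} (μ : ℝ) : Fn n := fun z => ((-(1 / 2) * zz z - μ : ℝ) : ℂ)

/-- The constraint surface `J⁻¹(0)`, a sphere. -/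
def surface (n : ℕ) (μ : ℝ) : Set (Coord n) := {z | J μ z = 0}

/-- The radial projection `p(z) = √(-2μ / z z̄) z` onto the constraint surface. -/
def proj {n : ℕ} (μ : ℝ) (z : Coord n) : Coord n := (Real.sqrt (-2 * μ / zz z) : ℂ) • z

/-- The radial prolongation `prol f = f ∘ p`. -/
def prol {n : ℕ} (μ : ℝ) (f : Fn n) : Fn n := fun z => f (proj μ z)

/-- The prolongation of series. -/
def prolS {n : ℕ} (μ : ℝ) (f : Series n) : Series n := fun m => prol μ (f m)

open Classical in
/-- The component of `f` along `J`: the quotient `(f - prol f) / J` off the constraint surface,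
continued to the constraint surface by `(1/2μ) (E + Ē) f`. -/
def compJ {n : ℕ} (μ : ℝ) (f : Fn n) : Fn n := fun z =>
  if J μ z = 0 then (1 / (2 * (μ : ℂ))) * (euler f z + eulerBar f z)
  else (f z - prol μ f z) / J μ z

/-! ### Classical and deformed algebras -/

/-- The classical vanishing ideal `I` (series vanishing on the constraint surface). -/
def idealI (n : ℕ) (μ : ℝ) : Set (Series n) :=
  {f | f ∈ smoothSeries n ∧ ∀ m, ∀ z ∈ surface n μ, f m z = 0}

/-- `B = {f | {f, f'} ∈ I for all f' ∈ I}`. -/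
def algB (n : ℕ) (κ μ : ℝ) : Set (Series n) :=
  {f | f ∈ smoothSeries n ∧ ∀ f' ∈ idealI n μ, poissonS κ f f' ∈ idealI n μ}

/-- Pure prolongations `F`. -/
def spaceF (n : ℕ) (μ : ℝ) : Set (Series n) :=
  {f | f ∈ smoothSeries n ∧ SEq f (prolS μ f)}

/-- The star-left-ideal `I* = {g ∗ J}`. -/
def starI (n : ℕ) (κ μ : ℝ) : Set (Series n) :=
  {f | f ∈ smoothSeries n ∧ ∃ g ∈ smoothSeries n, SEq f (wick κ g (constS (J μ)))}

/-- `B* = {f | f ∗ g - g ∗ f ∈ I* for all g ∈ I*}`. -/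
def starB (n : ℕ) (κ μ : ℝ) : Set (Series n) :=
  {f | f ∈ smoothSeries n ∧ ∀ g ∈ starI n κ μ, wick κ f g - wick κ g f ∈ starI n κ μ}

/-- Homogeneous series: `h(c z) = h(z)` for all `c ∈ ℂ ∖ {0}`, that is, series of smooth functions
on `ℂℙⁿ` pulled back to `ℂⁿ⁺¹ ∖ {0}`. -/
def homog (n : ℕ) : Set (Series n) :=
  {f | f ∈ smoothSeries n ∧ ∀ m, ∀ c : ℂ, c ≠ 0 → ∀ z ∈ phase n, f m (c • z) = f m z}

/-! ### The operator `T` -/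

/-- `T₀ = Id`, `Tₘ f = - ∑_{k=1}^{m} T_{m-k}(Mₖ(π_J f, J))` for `m ≥ 1`
(in the sum below, `k` is replaced by `k + 1`). -/
def opT {n : ℕ} (κ μ : ℝ) : ℕ → Fn n → Fn n
  | 0, f => f
  | m + 1, f => fun z =>
      -∑ k : Fin (m + 1), opT κ μ (m - k) (wickM κ (k + 1) (compJ μ f) (J μ)) z
termination_by m => m
decreasing_by omega

/-- `K = (κ/2) E ∘ π_J`. -/
def opK {n : ℕ} (κ μ : ℝ) (f : Fn n) : Fn n := fun z => ((κ : ℂ) / 2) * euler (compJ μ f) z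

/-- The operator `1 - λ K` on series. -/
def oneSubLambdaK {n : ℕ} (κ μ : ℝ) (f : Series n) : Series n
  | 0 => f 0
  | m + 1 => f (m + 1) - opK κ μ (f m)

/-! ### The operator `S` -/

/-- The Hamiltonian flow of `J` for `ω = (i/κ) ∑ dzʲ ∧ dz̄ʲ`. -/
def flow {n : ℕ} (κ t : ℝ) (z : Coord n) : Coord n :=
  Complex.exp (Complex.I * ((κ / 2 * t : ℝ) : ℂ)) • z

/-- A (local) transversal section of the foliation of the constraint surface by the orbits of the
Hamiltonian flow of `J`, on a radially saturated open subset `dom` of the phase space, given by the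
projection `base` on the section along the leaves and the flow parameter `time`:
`p = Φ_{time p} (base p)` for `p ∈ dom` on the constraint surface. -/
structure FlowSection (n : ℕ) (κ μ : ℝ) where
  dom : Set (Coord n)
  base : Coord n → Coord n
  time : Coord n → ℝ
  isOpen_dom : IsOpen dom
  dom_subset : dom ⊆ phase n
  radial : ∀ z ∈ phase n, proj μ z ∈ dom ↔ z ∈ dom
  smooth_base : ContDiffOn ℝ ∞ base dom
  smooth_time : ContDiffOn ℝ ∞ time dom
  base_mem : ∀ z ∈ dom ∩ surface n μ, base z ∈ dom ∩ surface n μ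
  time_base : ∀ z ∈ dom ∩ surface n μ, time (base z) = 0
  flow_time : ∀ z ∈ dom ∩ surface n μ, flow κ (time z) (base z) = z
  path_mem : ∀ z ∈ dom ∩ surface n μ, ∀ s ∈ Set.uIcc 0 (time z), flow κ s (base z) ∈ dom
  base_flow : ∀ z ∈ dom ∩ surface n μ, ∀ s : ℝ, (∀ r ∈ Set.uIcc 0 s, flow κ r z ∈ dom) →
    base (flow κ s z) = base z

/-- The expression `Fₘ[S₀, …, S_{m-2}; T₀, …, T_{m-1}](f) = ∑_{k=2}^{m} Mₖ⁻(J, S_{m-k} f)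
+ ∑_{i=1}^{m-1} ∑_{k=1}^{m-i} Tᵢ(Mₖ⁻(J, S_{m-k-i} f))`, where `s j` stands for `S_j f`
and `Mₖ⁻(f, g) = Mₖ(f, g) - Mₖ(g, f)`. -/
def exprF {n : ℕ} (κ μ : ℝ) (m : ℕ) (s : ℕ → Fn n) : Fn n := fun z =>
  (∑ k ∈ Finset.Icc 2 m, wickAnti κ k (J μ) (s (m - k)) z) +
    ∑ i ∈ Finset.Icc 1 (m - 1), ∑ k ∈ Finset.Icc 1 (m - i),
      opT κ μ i (wickAnti κ k (J μ) (s (m - k - i))) z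

/-- `s 0, s 1, …` are the functions `S₀ f, S₁ f, …` constructed with the help of the section `σ`, on
its domain: `S₀ f = f`, and for `m ≥ 1`, `Sₘ f` is the prolongation of
`(Sₘ f)(p) = -i ∫₀^{t(p)} F_{m+1}(f)(Φ_t(base p)) dt` (`p` on the constraint surface). -/
def IsLocalS {n : ℕ} {κ μ : ℝ} (σ : FlowSection n κ μ) (f : Fn n) (s : ℕ → Fn n) : Prop :=
  (∀ z ∈ σ.dom, s 0 z = f z) ∧
  ∀ m, 1 ≤ m → ∀ z ∈ σ.dom, s m z =
    -Complex.I * ∫ t in (0 : ℝ)..(σ.time (proj μ z)),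
      exprF κ μ (m + 1) s (flow κ t (σ.base (proj μ z)))

/-- A formal series of operators `S = ∑ λᵐ Sₘ` on `B ∩ F` that near every point comes from the
construction with some local transversal section. -/
def IsOpS {n : ℕ} (κ μ : ℝ) (S : ℕ → Fn n → Fn n) : Prop :=
  ∀ f : Fn n, constS f ∈ algB n κ μ ∩ spaceF n μ → ∀ z ∈ phase n,
    ∃ σ : FlowSection n κ μ, z ∈ σ.dom ∧ IsLocalS σ f (fun m => S m f)

/-! ### Reduced products -/

/-- `h` is the reduced product `S⁻¹(prol(T(S f ∗ S g)))`, an element of `B ∩ F`. -/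
def IsReducedProduct {n : ℕ} (κ μ : ℝ) (S : ℕ → Fn n → Fn n) (f g h : Series n) : Prop :=
  h ∈ algB n κ μ ∩ spaceF n μ ∧
    SEq (ext S h) (prolS μ (ext (opT κ μ) (wick κ (ext S f) (ext S g))))

/-- `∑_{i₁=1}^{k} ∑_{i₂=1}^{i₁} ⋯ ∑_{i_l=1}^{i_{l-1}} i₁ i₂ ⋯ i_l` (arguments `l`, `k`). -/
def nestedSum : ℕ → ℕ → ℤ
  | 0, _ => 1
  | l + 1, k => ∑ i ∈ Finset.Icc 1 k, (i : ℤ) * nestedSum l i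

/-- The coefficients `A^{(k)}_l`. -/
def coeffA (k l : ℕ) : ℤ := (-1) ^ l * nestedSum l k

/-- The explicit product `∑_{k,l} (λ / (-2μ))^{k+l} κ^l A^{(k)}_l (z z̄)^k Mₖ(f, g)`. -/
def starCP {n : ℕ} (κ μ : ℝ) (f g : Series n) : Series n :=
  ext₂ (fun r f g z => ∑ p ∈ Finset.HasAntidiagonal.antidiagonal r,
    (1 / (-2 * (μ : ℂ))) ^ r * (κ : ℂ) ^ p.2 * (coeffA p.1 p.2 : ℂ) * (zz z : ℂ) ^ p.1 *
      wickM κ p.1 f g z) f g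

/-- The closed formula of Bordemann, Brischle, Emmrich and Waldmann for a star product on `ℂℙⁿ`:
`f g + ∑_{r ≥ 1} (κ λ / (-2μ))^r ∑_{s=1}^{r} ∑_{k=1}^{s}
  (-1)^{r-k} k^{r-1} / (s! (s-k)! (k-1)!) (z z̄)^s ∑ ∂ˢf/∂z^{i₁}⋯∂z^{iₛ} ∂ˢg/∂z̄^{i₁}⋯∂z̄^{iₛ}`. -/
def starBBEW {n : ℕ} (κ μ : ℝ) (f g : Series n) : Series n :=
  ext₂ (fun r f g z => if r = 0 then f z * g z else
    ((κ : ℂ) / (-2 * (μ : ℂ))) ^ r * ∑ s ∈ Finset.Icc 1 r, ∑ k ∈ Finset.Icc 1 s,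
      ((-1 : ℂ) ^ (r - k) * (k : ℂ) ^ (r - 1) /
          ((s.factorial : ℂ) * ((s - k).factorial : ℂ) * ((k - 1).factorial : ℂ))) *
        (zz z : ℂ) ^ s * contraction s f g z) f g

/-- The `U(1)`-invariant series. -/
def invU1 (n : ℕ) : Set (Series n) :=
  {f | f ∈ smoothSeries n ∧ ∀ m, ∀ φ : ℝ, ∀ z ∈ phase n,
    f m (Complex.exp (Complex.I * (φ : ℂ)) • z) = f m z}

/-- `h` is the product of the homogeneous series `f` and `g` that results from the quantum
Marsden-Weinstein reduction with the momentum map `J` of the `U(1)`-action: it is the homogeneous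
representative of the class of `f ∗ g` in the algebra of `U(1)`-invariant series modulo
its star ideal generated by `J`. -/
def IsMarsdenWeinsteinProduct {n : ℕ} (κ μ : ℝ) (f g h : Series n) : Prop :=
  h ∈ homog n ∧ ∃ a ∈ invU1 n, SEq (wick κ f g - h) (wick κ a (constS (J μ)))

/-- `star` is a star product on the homogeneous series, that is, on series of functions on `ℂℙⁿ`:
it is associative with unit `1`, deforms the pointwise product in the direction of `i` times
the reduced Poisson bracket (the prolongation of the Poisson bracket), and is local. -/
structure IsStarProductCP {n : ℕ} (κ μ : ℝ) (star : Series n → Series n → Series n) : Prop where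
  mem : ∀ f ∈ homog n, ∀ g ∈ homog n, star f g ∈ homog n
  assoc : ∀ f ∈ homog n, ∀ g ∈ homog n, ∀ h ∈ homog n,
    SEq (star (star f g) h) (star f (star g h))
  mul_one : ∀ f ∈ homog n, SEq (star f (constS 1)) f
  one_mul : ∀ f ∈ homog n, SEq (star (constS 1) f) f
  order_zero : ∀ f ∈ homog n, ∀ g ∈ homog n, ∀ z ∈ phase n, star f g 0 z = f 0 z * g 0 z
  order_one : ∀ f ∈ homog n, ∀ g ∈ homog n, ∀ z ∈ phase n,
    star f g 1 z - star g f 1 z = Complex.I * prol μ (poisson κ (f 0) (g 0)) z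
  localL : ∀ f ∈ homog n, ∀ g ∈ homog n, ∀ U : Set (Coord n), IsOpen U → U ⊆ phase n →
    (∀ m, ∀ z ∈ U, f m z = 0) → ∀ m, ∀ z ∈ U, star f g m z = 0
  localR : ∀ f ∈ homog n, ∀ g ∈ homog n, ∀ U : Set (Coord n), IsOpen U → U ⊆ phase n →
    (∀ m, ∀ z ∈ U, g m z = 0) → ∀ m, ∀ z ∈ U, star f g m z = 0

end WickCPn

end

open WickCPn

/-! ### Smooth dependence of integrals on parameters. -/

section ParametricIntegral

open MeasureTheory intervalIntegral Set

variable {X : Type} [NormedAddCommGroup X] [NormedSpace ℝ X] [ProperSpace X]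

/-! Everything rests on division with remainder by `J` for the Wick product. The function `J` is
affine in `z` and affine in `z̄`, so `a * J` stops after first order: it is `a J - λ (κ/2) E a`, and
`J * a` is the same with `Ē` in place of `E`. Classically, each smooth `f` is uniquely `prol f +
(π_J f) J` with smooth quotient. Applying this order by order to `f = h + a * J` gives exactly one
solution with `h` a prolongation, namely `a = π_J(Tf)` and `h = prol(Tf)`, where `Tf = f + λ K T f`.
This is `T = 1/(1 - λK)`; existence is `eq_remS_add`, uniqueness `eq_zero_of_add_wickA_JS_eq_zero`.

A prolongation is homogeneous exactly when `E f = Ē f`, that is, when it commutes with `J`,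
classically or for the Wick product. This identifies both `B ∩ F` and `B* ∩ F`. For such `f` every
bracket entering `S` vanishes, so all integrands are zero and `S` is the identity. The reduced
product of homogeneous series is therefore the remainder of `f * g`. It is associative because
homogeneous series commute with `J`, so that both bracketings are remainders of the same triple Wick
product (`redS_assoc`). Remainder and quotient inherit `U(1)`-invariance, which gives the
Marsden-Weinstein description.

For the explicit formula, `M_k(f, g)` is `(z z̄)^{-k}` times a homogeneous function when `f` and `g`
are homogeneous. On powers of `1/(z z̄)` the quotient by `J` is a finite geometric sum
(`compJA_zzInvA_pow_mul`), so `K` acts by a triangular matrix whose iterates produce the nested sums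
`A^{(k)}_l` (`prolA_opKA_pow`). Up to sign these are Stirling numbers of the second kind, which
yields the closed alternating sum and the formula of Bordemann, Brischle, Emmrich and Waldmann.

Functions matter only off the origin, so the computations take place in the algebra `SmoothAlg` of
functions on the phase space, where the operators become linear maps and derivations; the results
are then carried back to series of functions. -/

theorem hasFDerivAt_parametric_integral {G : Type} [NormedAddCommGroup G] [NormedSpace ℝ G]
    {W : Set (X × ℝ)} (hW : IsOpen W) {F : X × ℝ → G} (hF : ContDiffOn ℝ ∞ F W) {U : Set X}
    (hU : IsOpen U) (hUW : U ×ˢ Icc (0 : ℝ) 1 ⊆ W) {x₀ : X} (hx₀ : x₀ ∈ U) :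
    HasFDerivAt (fun x => ∫ t in (0 : ℝ)..1, F (x, t))
      (∫ t in (0 : ℝ)..1, (fderiv ℝ F (x₀, t)).comp (ContinuousLinearMap.inl ℝ X ℝ)) x₀ := by
  obtain ⟨ε, hε, hball⟩ := Metric.nhds_basis_closedBall.mem_iff.1 (hU.mem_nhds hx₀)
  have hF' : ContinuousOn
      (fun p => (fderiv ℝ F p).comp (ContinuousLinearMap.inl ℝ X ℝ)) W :=
    (hF.continuousOn_fderiv_of_isOpen hW (by simp)).clm_comp continuousOn_const
  have hsub : Metric.closedBall x₀ ε ×ˢ Icc (0 : ℝ) 1 ⊆ W :=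
    (prod_mono hball subset_rfl).trans hUW
  -- Compactness of a closed ball times `[0, 1]` bounds the partial derivative uniformly; this
  -- constant is the dominating function.
  obtain ⟨C, hC⟩ := ((isCompact_closedBall x₀ ε).prod isCompact_Icc).exists_bound_of_continuousOn
    (hF'.mono hsub)
  have hslice : ∀ x ∈ U, MapsTo (fun t : ℝ => (x, t)) (Icc 0 1) W :=
    fun x hx t ht => hUW ⟨hx, ht⟩
  have hI : Set.uIoc (0 : ℝ) 1 ⊆ Icc 0 1 := by
    rw [uIoc_of_le zero_le_one]; exact Ioc_subset_Icc_self
  have hcont : ∀ x ∈ U, ContinuousOn (fun t => F (x, t)) (Icc (0 : ℝ) 1) := fun x hx =>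
    hF.continuousOn.comp (by fun_prop) (hslice x hx)
  refine (hasFDerivAt_integral_of_dominated_of_fderiv_le
    (s := Metric.ball x₀ ε) (bound := fun _ => C)
    (F' := fun x t => (fderiv ℝ F (x, t)).comp (ContinuousLinearMap.inl ℝ X ℝ))
    (Metric.ball_mem_nhds _ hε) ?_ ?_ ?_ ?_ ?_ ?_)
  · filter_upwards [hU.mem_nhds hx₀] with x hx
    exact ((hcont x hx).mono hI).aestronglyMeasurable measurableSet_uIoc
  · exact ContinuousOn.intervalIntegrable (by simpa using hcont x₀ hx₀)
  · exact ((hF'.comp (by fun_prop) (hslice x₀ hx₀)).mono hI).aestronglyMeasurable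
      measurableSet_uIoc
  · exact .of_forall fun t ht x hx => hC (x, t) ⟨Metric.ball_subset_closedBall hx, hI ht⟩
  · exact intervalIntegrable_const
  · refine .of_forall fun t ht x hx => ?_
    have hmem : (x, t) ∈ W := hsub ⟨Metric.ball_subset_closedBall hx, hI ht⟩
    have h1 : HasFDerivAt F (fderiv ℝ F (x, t)) (x, t) :=
      ((hF.contDiffAt (hW.mem_nhds hmem)).differentiableAt (by simp)).hasFDerivAt
    exact h1.comp x (hasFDerivAt_prodMk_left x t)

/-- A parametric integral of a smooth function is smooth. -/
theorem contDiffOn_parametric_integral {U : Set X} (hU : IsOpen U) {W : Set (X × ℝ)}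
    (hW : IsOpen W) (hUW : U ×ˢ Icc (0 : ℝ) 1 ⊆ W) {G : Type} [NormedAddCommGroup G]
    [NormedSpace ℝ G] {F : X × ℝ → G} (hF : ContDiffOn ℝ ∞ F W) :
    ContDiffOn ℝ ∞ (fun x => ∫ t in (0 : ℝ)..1, F (x, t)) U := by
  refine contDiffOn_infty.2 fun n => ?_
  -- The target space must vary: the derivative is again a parametric integral, but with values in
  -- continuous linear maps.
  induction n generalizing G with
  | zero =>
    exact contDiffOn_zero.2 fun x hx =>
      (hasFDerivAt_parametric_integral hW hF hU hUW hx).continuousAt.continuousWithinAt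
  | succ n ih =>
    rw [Nat.cast_succ]
    refine (contDiffOn_succ_iff_fderiv_of_isOpen hU).2 ⟨fun x hx =>
      (hasFDerivAt_parametric_integral hW hF hU hUW
        hx).differentiableAt.differentiableWithinAt, by simp, ?_⟩
    have hF' : ContDiffOn ℝ ∞
        (fun p => (fderiv ℝ F p).comp (ContinuousLinearMap.inl ℝ X ℝ)) W :=
      (hF.fderiv_of_isOpen hW (by simp)).clm_comp contDiffOn_const
    exact (ih hF').congr fun x hx =>
      (hasFDerivAt_parametric_integral hW hF hU hUW hx).fderiv

end ParametricIntegral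

namespace WickCPn

/-! ### Wirtinger calculus, Wick products with `J`, and the recursion for `T`. -/

section Basic

variable {n : ℕ}

theorem isOpen_phase (n : ℕ) : IsOpen (phase n) := isOpen_ne

theorem smul_mem_phase {c : ℂ} (hc : c ≠ 0) {z : Coord n} (hz : z ∈ phase n) :
    c • z ∈ phase n := smul_ne_zero hc hz

theorem SmoothFn.contDiffAt {f : Fn n} (hf : SmoothFn f) {z : Coord n} (hz : z ∈ phase n) :
    ContDiffAt ℝ ∞ f z := ContDiffOn.contDiffAt hf ((isOpen_phase n).mem_nhds hz)

theorem SmoothFn.differentiableAt {f : Fn n} (hf : SmoothFn f) {z : Coord n}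
    (hz : z ∈ phase n) : DifferentiableAt ℝ f z :=
  (hf.contDiffAt hz).differentiableAt (by simp)

theorem SmoothFn.congr {f g : Fn n} (hf : SmoothFn f) (h : Set.EqOn g f (phase n)) :
    SmoothFn g := ContDiffOn.congr hf h

theorem fderiv_eq_of_eqOn {U : Set (Coord n)} (hU : IsOpen U) {f g : Fn n}
    (h : Set.EqOn f g U) : Set.EqOn (fderiv ℝ f) (fderiv ℝ g) U := fun _ hz =>
  (h.eventuallyEq_of_mem (hU.mem_nhds hz)).fderiv_eq

theorem dz_eqOn {U : Set (Coord n)} (hU : IsOpen U) {f g : Fn n} (h : Set.EqOn f g U)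
    (i : Fin (n + 1)) : Set.EqOn (dz i f) (dz i g) U := fun z hz => by
  simp only [dz, fderiv_eq_of_eqOn hU h hz]

theorem dzbar_eqOn {U : Set (Coord n)} (hU : IsOpen U) {f g : Fn n} (h : Set.EqOn f g U)
    (i : Fin (n + 1)) : Set.EqOn (dzbar i f) (dzbar i g) U := fun z hz => by
  simp only [dzbar, fderiv_eq_of_eqOn hU h hz]

theorem SmoothFn.fderiv_apply {f : Fn n} (hf : SmoothFn f) (v : Coord n) :
    SmoothFn (fun z => fderiv ℝ f z v) :=
  (ContDiffOn.fderiv_of_isOpen hf (isOpen_phase n) (by simp)).clm_apply contDiffOn_const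

theorem SmoothFn.smooth_dz {f : Fn n} (hf : SmoothFn f) (i : Fin (n + 1)) : SmoothFn (dz i f) :=
  contDiffOn_const.mul ((hf.fderiv_apply _).sub (contDiffOn_const.mul (hf.fderiv_apply _)))

theorem SmoothFn.smooth_dzbar {f : Fn n} (hf : SmoothFn f) (i : Fin (n + 1)) : SmoothFn (dzbar i f) :=
  contDiffOn_const.mul ((hf.fderiv_apply _).add (contDiffOn_const.mul (hf.fderiv_apply _)))

/-- Expand `v` in the real basis of the vectors `eᵢ` and `I eᵢ`. This is the passage from real
derivatives to Wirtinger derivatives used for scalings, flows and Euler operators. -/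
theorem fderiv_apply_eq (f : Fn n) (z v : Coord n) :
    fderiv ℝ f z v = ∑ i, (v i * dz i f z + (starRingEnd ℂ) (v i) * dzbar i f z) := by
  have hv : v = ∑ i, ((v i).re • (Pi.single i 1 : Coord n) +
      (v i).im • (Pi.single i Complex.I : Coord n)) := by
    ext j
    simp [Finset.sum_apply, Pi.single_apply, Finset.sum_add_distrib, Complex.re_add_im]
  conv_lhs => rw [hv]
  simp only [map_sum, map_add, map_smul]
  refine Finset.sum_congr rfl fun i _ => ?_
  set a := fderiv ℝ f z (Pi.single i 1)
  set b := fderiv ℝ f z (Pi.single i Complex.I)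
  have h1 : (v i) = (v i).re + (v i).im * Complex.I := (Complex.re_add_im _).symm
  have h2 : (starRingEnd ℂ) (v i) = (v i).re - (v i).im * Complex.I := by
    apply Complex.ext <;> simp
  rw [h2]
  nth_rewrite 3 [h1]
  simp only [dz, dzbar, Complex.real_smul]
  linear_combination ((v i).im * b) * Complex.I_sq

/-- The case `c = 1` is the radial derivative `E + Ē`, the case `c = I` the derivative along the
circle action. -/
theorem fderiv_apply_smul (f : Fn n) (z : Coord n) (c : ℂ) :
    fderiv ℝ f z (c • z) = c * euler f z + (starRingEnd ℂ) c * eulerBar f z := by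
  simp only [fderiv_apply_eq, euler, eulerBar, Pi.smul_apply, smul_eq_mul, map_mul,
    Finset.sum_add_distrib, Finset.mul_sum, mul_assoc]

theorem dz_of_hasFDerivAt {f : Fn n} {L : Coord n →L[ℝ] ℂ} {z : Coord n}
    (h : HasFDerivAt f L z) (i : Fin (n + 1)) :
    dz i f z = (1 / 2) * (L (Pi.single i 1) - Complex.I * L (Pi.single i Complex.I)) := by
  rw [dz, h.fderiv]

theorem dzbar_of_hasFDerivAt {f : Fn n} {L : Coord n →L[ℝ] ℂ} {z : Coord n}
    (h : HasFDerivAt f L z) (i : Fin (n + 1)) :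
    dzbar i f z = (1 / 2) * (L (Pi.single i 1) + Complex.I * L (Pi.single i Complex.I)) := by
  rw [dzbar, h.fderiv]

theorem dz_const (c : ℂ) (i : Fin (n + 1)) : dz i (fun _ : Coord n => c) = 0 := by
  ext z; simp [dz]

theorem dzbar_const (c : ℂ) (i : Fin (n + 1)) : dzbar i (fun _ : Coord n => c) = 0 := by
  ext z; simp [dzbar]

theorem dz_mul {f g : Fn n} {z : Coord n} (hf : DifferentiableAt ℝ f z)
    (hg : DifferentiableAt ℝ g z) (i : Fin (n + 1)) :
    dz i (fun w => f w * g w) z = dz i f z * g z + f z * dz i g z := by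
  rw [dz_of_hasFDerivAt (hf.hasFDerivAt.fun_mul hg.hasFDerivAt)]
  simp [dz]; ring

theorem dzbar_mul {f g : Fn n} {z : Coord n} (hf : DifferentiableAt ℝ f z)
    (hg : DifferentiableAt ℝ g z) (i : Fin (n + 1)) :
    dzbar i (fun w => f w * g w) z = dzbar i f z * g z + f z * dzbar i g z := by
  rw [dzbar_of_hasFDerivAt (hf.hasFDerivAt.fun_mul hg.hasFDerivAt)]
  simp [dzbar]; ring

theorem dz_add {f g : Fn n} {z : Coord n} (hf : DifferentiableAt ℝ f z)
    (hg : DifferentiableAt ℝ g z) (i : Fin (n + 1)) :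
    dz i (fun w => f w + g w) z = dz i f z + dz i g z := by
  rw [dz_of_hasFDerivAt (hf.hasFDerivAt.fun_add hg.hasFDerivAt)]
  simp [dz]; ring

theorem dzbar_add {f g : Fn n} {z : Coord n} (hf : DifferentiableAt ℝ f z)
    (hg : DifferentiableAt ℝ g z) (i : Fin (n + 1)) :
    dzbar i (fun w => f w + g w) z = dzbar i f z + dzbar i g z := by
  rw [dzbar_of_hasFDerivAt (hf.hasFDerivAt.fun_add hg.hasFDerivAt)]
  simp [dzbar]; ring

/-- Second derivatives of smooth functions are symmetric. -/
theorem fderiv_fderiv_comm {f : Fn n} (hf : SmoothFn f) {z : Coord n} (hz : z ∈ phase n)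
    (v w : Coord n) :
    fderiv ℝ (fun x => fderiv ℝ f x v) z w = fderiv ℝ (fun x => fderiv ℝ f x w) z v := by
  have h := (hf.contDiffAt hz).isSymmSndFDerivAt (by simpa using WithTop.coe_le_coe.2 (le_top : (2 : ℕ∞) ≤ ⊤))
  have hd : DifferentiableAt ℝ (fderiv ℝ f) z :=
    ((hf.contDiffAt hz).fderiv_right (m := ∞) (by simp)).differentiableAt (by simp)
  have key : ∀ u : Coord n, fderiv ℝ (fun x => fderiv ℝ f x u) z =
      (fderiv ℝ (fderiv ℝ f) z).flip u := fun u => by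
    ext x
    rw [fderiv_clm_apply hd (differentiableAt_const u)]
    simp
  rw [key, key]
  simpa using h w v

theorem fderiv_dz {f : Fn n} (hf : SmoothFn f) {z : Coord n} (hz : z ∈ phase n)
    (i : Fin (n + 1)) (v : Coord n) :
    fderiv ℝ (dz i f) z v = (1 / 2) * (fderiv ℝ (fun x => fderiv ℝ f x (Pi.single i 1)) z v -
      Complex.I * fderiv ℝ (fun x => fderiv ℝ f x (Pi.single i Complex.I)) z v) := by
  have h1 := ((hf.fderiv_apply (Pi.single i 1)).differentiableAt hz).hasFDerivAt
  have h2 := ((hf.fderiv_apply (Pi.single i Complex.I)).differentiableAt hz).hasFDerivAt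
  have := ((h1.sub (h2.const_mul Complex.I)).const_mul (1 / 2 : ℂ)).fderiv
  exact (DFunLike.congr_fun this v).trans (by simp)

theorem fderiv_dzbar {f : Fn n} (hf : SmoothFn f) {z : Coord n} (hz : z ∈ phase n)
    (i : Fin (n + 1)) (v : Coord n) :
    fderiv ℝ (dzbar i f) z v =
      (1 / 2) * (fderiv ℝ (fun x => fderiv ℝ f x (Pi.single i 1)) z v +
      Complex.I * fderiv ℝ (fun x => fderiv ℝ f x (Pi.single i Complex.I)) z v) := by
  have h1 := ((hf.fderiv_apply (Pi.single i 1)).differentiableAt hz).hasFDerivAt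
  have h2 := ((hf.fderiv_apply (Pi.single i Complex.I)).differentiableAt hz).hasFDerivAt
  have := ((h1.add (h2.const_mul Complex.I)).const_mul (1 / 2 : ℂ)).fderiv
  exact (DFunLike.congr_fun this v).trans (by simp [mul_add])

theorem dz_dz_comm {f : Fn n} (hf : SmoothFn f) {z : Coord n} (hz : z ∈ phase n)
    (i j : Fin (n + 1)) : dz i (dz j f) z = dz j (dz i f) z := by
  rw [dz, dz, fderiv_dz hf hz, fderiv_dz hf hz, fderiv_dz hf hz, fderiv_dz hf hz]
  simp only [fderiv_fderiv_comm hf hz _ (Pi.single i _)]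
  ring

theorem dzbar_dzbar_comm {f : Fn n} (hf : SmoothFn f) {z : Coord n} (hz : z ∈ phase n)
    (i j : Fin (n + 1)) : dzbar i (dzbar j f) z = dzbar j (dzbar i f) z := by
  rw [dzbar, dzbar, fderiv_dzbar hf hz, fderiv_dzbar hf hz, fderiv_dzbar hf hz,
    fderiv_dzbar hf hz]
  simp only [fderiv_fderiv_comm hf hz _ (Pi.single i _)]
  ring

theorem dz_dzbar_comm {f : Fn n} (hf : SmoothFn f) {z : Coord n} (hz : z ∈ phase n)
    (i j : Fin (n + 1)) : dz i (dzbar j f) z = dzbar j (dz i f) z := by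
  rw [dz, dzbar, fderiv_dzbar hf hz, fderiv_dzbar hf hz, fderiv_dz hf hz, fderiv_dz hf hz]
  simp only [fderiv_fderiv_comm hf hz _ (Pi.single i _)]
  ring

/-! ### The norm square and the constraint function -/

theorem zz_eq (z : Coord n) : (zz z : ℂ) = ∑ i, z i * (starRingEnd ℂ) (z i) := by
  simp [zz, Complex.mul_conj]

theorem zz_pos {z : Coord n} (hz : z ∈ phase n) : 0 < zz z := by
  obtain ⟨i, hi⟩ := Function.ne_iff.1 hz
  exact Finset.sum_pos' (fun i _ => Complex.normSq_nonneg _)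
    ⟨i, Finset.mem_univ _, Complex.normSq_pos.2 hi⟩

theorem zz_smul (c : ℂ) (z : Coord n) : zz (c • z) = Complex.normSq c * zz z := by
  simp [zz, Finset.mul_sum]

theorem contDiff_zz : ContDiff ℝ ∞ (zz : Coord n → ℝ) := by
  unfold zz
  simp only [Complex.normSq_apply]
  refine ContDiff.sum fun i _ => ?_
  have h : ContDiff ℝ ∞ fun z : Coord n => z i := by fun_prop
  have h1 : ContDiff ℝ ∞ fun z : Coord n => (z i).re := Complex.reCLM.contDiff.comp h
  have h2 : ContDiff ℝ ∞ fun z : Coord n => (z i).im := Complex.imCLM.contDiff.comp h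
  exact (h1.mul h1).add (h2.mul h2)

theorem smoothFn_zz : SmoothFn (fun z : Coord n => (zz z : ℂ)) :=
  (Complex.ofRealCLM.contDiff.comp contDiff_zz).contDiffOn

theorem hasFDerivAt_coord (i : Fin (n + 1)) (z : Coord n) :
    HasFDerivAt (fun z : Coord n => z i)
      (ContinuousLinearMap.proj (R := ℝ) (φ := fun _ : Fin (n + 1) => ℂ) i) z :=
  (ContinuousLinearMap.proj (R := ℝ) (φ := fun _ : Fin (n + 1) => ℂ) i).hasFDerivAt

theorem hasFDerivAt_conj_coord (i : Fin (n + 1)) (z : Coord n) :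
    HasFDerivAt (fun z : Coord n => (starRingEnd ℂ) (z i))
      ((Complex.conjCLE : ℂ →L[ℝ] ℂ).comp
        (ContinuousLinearMap.proj (R := ℝ) (φ := fun _ : Fin (n + 1) => ℂ) i)) z :=
  ((Complex.conjCLE : ℂ →L[ℝ] ℂ).comp
    (ContinuousLinearMap.proj (R := ℝ) (φ := fun _ : Fin (n + 1) => ℂ) i)).hasFDerivAt

theorem hasFDerivAt_zz (z : Coord n) :
    HasFDerivAt (fun z : Coord n => (zz z : ℂ))
      (∑ i, (z i • (Complex.conjCLE : ℂ →L[ℝ] ℂ).comp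
        (ContinuousLinearMap.proj (R := ℝ) (φ := fun _ : Fin (n + 1) => ℂ) i) +
        (starRingEnd ℂ) (z i) •
          ContinuousLinearMap.proj (R := ℝ) (φ := fun _ : Fin (n + 1) => ℂ) i)) z := by
  simp only [zz_eq]
  exact HasFDerivAt.fun_sum fun i _ =>
    (hasFDerivAt_coord i z).mul (hasFDerivAt_conj_coord i z)

theorem dz_zz (i : Fin (n + 1)) (z : Coord n) :
    dz i (fun z : Coord n => (zz z : ℂ)) z = (starRingEnd ℂ) (z i) := by
  rw [dz_of_hasFDerivAt (hasFDerivAt_zz z)]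
  simp only [_root_.sum_apply, Pi.single_apply, Finset.sum_add_distrib,
    _root_.add_apply, _root_.smul_apply,
    ContinuousLinearMap.comp_apply, ContinuousLinearMap.proj_apply]
  simp [apply_ite]
  linear_combination ((z i - (starRingEnd ℂ) (z i)) / 2) * Complex.I_sq

theorem dzbar_zz (i : Fin (n + 1)) (z : Coord n) :
    dzbar i (fun z : Coord n => (zz z : ℂ)) z = z i := by
  rw [dzbar_of_hasFDerivAt (hasFDerivAt_zz z)]
  simp only [_root_.sum_apply, Pi.single_apply, Finset.sum_add_distrib,
    _root_.add_apply, _root_.smul_apply,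
    ContinuousLinearMap.comp_apply, ContinuousLinearMap.proj_apply]
  simp [apply_ite]
  linear_combination (-(z i - (starRingEnd ℂ) (z i)) / 2) * Complex.I_sq

theorem J_eq (μ : ℝ) (z : Coord n) : J μ z = -(1 / 2) * (zz z : ℂ) - μ := by
  simp [J]

theorem smoothFn_J (μ : ℝ) : SmoothFn (J μ : Fn n) := by
  have : SmoothFn (fun z : Coord n => -(1 / 2) * (zz z : ℂ) - μ) :=
    (contDiffOn_const.mul smoothFn_zz).sub contDiffOn_const
  exact this.congr fun z _ => J_eq μ z

theorem hasFDerivAt_J (μ : ℝ) (z : Coord n) :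
    HasFDerivAt (J μ : Fn n) ((-(1 / 2) : ℂ) • fderiv ℝ (fun z : Coord n => (zz z : ℂ)) z) z := by
  have h : (J μ : Fn n) = fun z => -(1 / 2) * (zz z : ℂ) - μ := funext (J_eq μ)
  rw [h, (hasFDerivAt_zz z).fderiv]
  exact ((hasFDerivAt_zz z).const_mul _).sub_const _

theorem dz_J (μ : ℝ) (i : Fin (n + 1)) :
    dz i (J μ : Fn n) = fun z => -(1 / 2) * (starRingEnd ℂ) (z i) := by
  ext z
  rw [dz_of_hasFDerivAt (hasFDerivAt_J μ z), ← dz_zz, dz]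
  simp; ring

theorem dzbar_J (μ : ℝ) (i : Fin (n + 1)) :
    dzbar i (J μ : Fn n) = fun z => -(1 / 2) * z i := by
  ext z
  rw [dzbar_of_hasFDerivAt (hasFDerivAt_J μ z)]
  conv_rhs => rw [← dzbar_zz i z, dzbar]
  simp; ring

theorem dz_dz_J (μ : ℝ) (i j : Fin (n + 1)) : dz i (dz j (J μ : Fn n)) = 0 := by
  ext z
  rw [dz_J, dz_of_hasFDerivAt ((hasFDerivAt_conj_coord j z).const_mul _)]
  rcases eq_or_ne i j with rfl | h
  · simp
    linear_combination (-(1 / 2) : ℂ) * Complex.I_sq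
  · simp [h.symm]

theorem dzbar_dzbar_J (μ : ℝ) (i j : Fin (n + 1)) : dzbar i (dzbar j (J μ : Fn n)) = 0 := by
  ext z
  rw [dzbar_J, dzbar_of_hasFDerivAt ((hasFDerivAt_coord j z).const_mul _)]
  rcases eq_or_ne i j with rfl | h
  · simp
    linear_combination (-(1 / 2) : ℂ) * Complex.I_sq
  · simp [h.symm]

/-- `J` is affine in `z` for fixed `z̄`. Together with the conjugate statement this makes Wick
products with `J` stop after first order. -/
theorem dzIter_J (μ : ℝ) (r : ℕ) (i : Fin (r + 2) → Fin (n + 1)) :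
    dzIter (r + 2) i (J μ : Fn n) = 0 := by
  induction r with
  | zero => simp [dzIter, dz_dz_J]
  | succ r ih => rw [dzIter, ih]; exact dz_const 0 _

theorem dzbarIter_J (μ : ℝ) (r : ℕ) (i : Fin (r + 2) → Fin (n + 1)) :
    dzbarIter (r + 2) i (J μ : Fn n) = 0 := by
  induction r with
  | zero => simp [dzbarIter, dzbar_dzbar_J]
  | succ r ih => rw [dzbarIter, ih]; exact dzbar_const 0 _

theorem wickM_J_right_eq_zero (κ μ : ℝ) {r : ℕ} (hr : 2 ≤ r) (f : Fn n) :
    wickM κ r f (J μ) = 0 := by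
  obtain ⟨r, rfl⟩ := Nat.exists_eq_add_of_le' hr
  ext z; simp [wickM, contraction, dzbarIter_J]

theorem wickM_J_left_eq_zero (κ μ : ℝ) {r : ℕ} (hr : 2 ≤ r) (f : Fn n) :
    wickM κ r (J μ) f = 0 := by
  obtain ⟨r, rfl⟩ := Nat.exists_eq_add_of_le' hr
  ext z; simp [wickM, contraction, dzIter_J]

theorem contraction_zero (f g : Fn n) : contraction 0 f g = fun z => f z * g z := by
  ext z; simp [contraction, dzIter, dzbarIter]

theorem contraction_one (f g : Fn n) (z : Coord n) :
    contraction 1 f g z = ∑ i, dz i f z * dzbar i g z := by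
  simp only [contraction, dzIter, dzbarIter]
  exact Fintype.sum_equiv (Equiv.funUnique (Fin 1) (Fin (n + 1))) _ _ fun i => rfl

theorem wickM_zero (κ : ℝ) (f g : Fn n) : wickM κ 0 f g = fun z => f z * g z := by
  ext z; simp [wickM, contraction_zero]

theorem wickM_one (κ : ℝ) (f g : Fn n) (z : Coord n) :
    wickM κ 1 f g z = κ * ∑ i, dz i f z * dzbar i g z := by
  simp [wickM, contraction_one]

theorem wickM_one_J_right (κ μ : ℝ) (f : Fn n) :
    wickM κ 1 f (J μ) = fun z => -((κ : ℂ) / 2 * euler f z) := by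
  ext z
  simp only [wickM_one, dzbar_J, euler, Finset.mul_sum, ← Finset.sum_neg_distrib]
  exact Finset.sum_congr rfl fun i _ => by ring

theorem wickM_one_J_left (κ μ : ℝ) (f : Fn n) :
    wickM κ 1 (J μ) f = fun z => -((κ : ℂ) / 2 * eulerBar f z) := by
  ext z
  simp only [wickM_one, dz_J, eulerBar, Finset.mul_sum, ← Finset.sum_neg_distrib]
  exact Finset.sum_congr rfl fun i _ => by ring

theorem poisson_J (κ μ : ℝ) (f : Fn n) (z : Coord n) :
    poisson κ f (J μ) z = Complex.I * (κ / 2) * (euler f z - eulerBar f z) := by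
  simp only [poisson, dz_J, dzbar_J, euler, eulerBar, Finset.mul_sum, ← Finset.sum_sub_distrib]
  refine Finset.sum_congr rfl fun i _ => ?_
  rw [Complex.div_I]
  ring

/-! ### The operator `T` is the geometric series of `K` -/

/-- Compatibility with negation needs no differentiability, unlike additivity. It lets the recursion
for `T` be solved for arbitrary functions. -/
theorem dz_neg (f : Fn n) (i : Fin (n + 1)) : dz i (fun z => -f z) = fun z => -dz i f z := by
  ext z; simp only [dz, fderiv_fun_neg]; simp; ring

theorem dzbar_neg (f : Fn n) (i : Fin (n + 1)) :
    dzbar i (fun z => -f z) = fun z => -dzbar i f z := by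
  ext z; simp only [dzbar, fderiv_fun_neg]; simp; ring

theorem compJ_neg (μ : ℝ) (f : Fn n) : compJ μ (fun z => -f z) = fun z => -compJ μ f z := by
  ext z
  simp only [compJ, euler, eulerBar, dz_neg, dzbar_neg, prol, mul_neg, Finset.sum_neg_distrib]
  split_ifs <;> ring

theorem opK_neg (κ μ : ℝ) (f : Fn n) : opK κ μ (fun z => -f z) = fun z => -opK κ μ f z := by
  ext z
  simp only [opK, euler, compJ_neg, dz_neg, mul_neg, Finset.sum_neg_distrib]

theorem opK_iterate_neg (κ μ : ℝ) (m : ℕ) (f : Fn n) :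
    (opK κ μ)^[m] (fun z => -f z) = fun z => -(opK κ μ)^[m] f z := by
  induction m generalizing f with
  | zero => rfl
  | succ m ih => simp only [Function.iterate_succ_apply, opK_neg, ih]

theorem opK_zero (κ μ : ℝ) : opK κ μ (0 : Fn n) = 0 := by
  have h := opK_neg κ μ (0 : Fn n)
  ext z
  have := congrFun h z
  simp only [Pi.zero_apply, neg_zero] at this
  change opK κ μ (0 : Fn n) z = _ at this
  rw [Pi.zero_apply]
  linear_combination this / 2

theorem opK_iterate_zero (κ μ : ℝ) (m : ℕ) : (opK κ μ)^[m] (0 : Fn n) = 0 :=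
  Function.iterate_fixed (opK_zero κ μ) m

/-- Only the first summand of the recursion survives, and its sign cancels the one in `M₁(·, J) =
-(κ/2) E`. What remains is `T_{m+1} = T_m ∘ K`. -/
theorem opT_eq_iterate (κ μ : ℝ) (m : ℕ) (f : Fn n) : opT κ μ m f = (opK κ μ)^[m] f := by
  induction m using Nat.strong_induction_on generalizing f with
  | _ m ih =>
    cases m with
    | zero => rw [opT]; rfl
    | succ m =>
      ext z
      rw [opT]
      beta_reduce
      rw [Fin.sum_univ_succ]
      have h0 : ∀ k : Fin m, opT κ μ (m - (k.succ : Fin (m + 1)))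
          (wickM κ ((k.succ : Fin (m + 1)) + 1) (compJ μ f) (J μ)) z = 0 := fun k => by
        rw [wickM_J_right_eq_zero _ _ (by simp), ih _ (by omega), opK_iterate_zero]; rfl
      rw [Finset.sum_eq_zero fun k _ => h0 k, add_zero]
      simp only [Fin.val_zero, zero_add, tsub_zero, wickM_one_J_right]
      rw [ih m (Nat.lt_succ_self m), opK_iterate_neg, neg_neg, Function.iterate_succ_apply]
      rfl

end Basic

/-! ### Scalings, the radial projection and smooth division by `J`. -/

section Radial

variable {n : ℕ}

/-! ### Scalings -/

theorem hasFDerivAt_comp_smul {f : Fn n} {c : ℂ} {z : Coord n}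
    (hf : DifferentiableAt ℝ f (c • z)) :
    HasFDerivAt (fun w => f (c • w))
      ((fderiv ℝ f (c • z)).comp (c • ContinuousLinearMap.id ℝ (Coord n))) z :=
  hf.hasFDerivAt.comp z ((hasFDerivAt_id z).const_smul c)

theorem fderiv_apply_single (f : Fn n) (z : Coord n) (i : Fin (n + 1)) (a : ℂ) :
    fderiv ℝ f z (Pi.single i a) = a * dz i f z + (starRingEnd ℂ) a * dzbar i f z := by
  rw [fderiv_apply_eq, Finset.sum_eq_single i (fun j _ hj => by simp [hj]) (by simp)]
  simp

theorem dz_comp_smul {f : Fn n} {c : ℂ} {z : Coord n} (hf : DifferentiableAt ℝ f (c • z))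
    (i : Fin (n + 1)) : dz i (fun w => f (c • w)) z = c * dz i f (c • z) := by
  rw [dz_of_hasFDerivAt (hasFDerivAt_comp_smul hf)]
  simp only [ContinuousLinearMap.comp_apply, _root_.smul_apply, ContinuousLinearMap.id_apply,
    ← Pi.single_smul, fderiv_apply_single, smul_eq_mul, map_mul, map_one, Complex.conj_I]
  linear_combination
    ((-c * dz i f (c • z) + (starRingEnd ℂ) c * dzbar i f (c • z)) / 2) * Complex.I_sq

theorem dzbar_comp_smul {f : Fn n} {c : ℂ} {z : Coord n} (hf : DifferentiableAt ℝ f (c • z))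
    (i : Fin (n + 1)) :
    dzbar i (fun w => f (c • w)) z = (starRingEnd ℂ) c * dzbar i f (c • z) := by
  rw [dzbar_of_hasFDerivAt (hasFDerivAt_comp_smul hf)]
  simp only [ContinuousLinearMap.comp_apply, _root_.smul_apply, ContinuousLinearMap.id_apply,
    ← Pi.single_smul, fderiv_apply_single, smul_eq_mul, map_mul, map_one, Complex.conj_I]
  linear_combination
    ((c * dz i f (c • z) - (starRingEnd ℂ) c * dzbar i f (c • z)) / 2) * Complex.I_sq

theorem euler_comp_smul {f : Fn n} {c : ℂ} {z : Coord n} (hf : DifferentiableAt ℝ f (c • z)) :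
    euler (fun w => f (c • w)) z = euler f (c • z) := by
  simp only [euler, dz_comp_smul hf, Pi.smul_apply, smul_eq_mul]
  exact Finset.sum_congr rfl fun i _ => by ring

theorem eulerBar_comp_smul {f : Fn n} {c : ℂ} {z : Coord n}
    (hf : DifferentiableAt ℝ f (c • z)) :
    eulerBar (fun w => f (c • w)) z = eulerBar f (c • z) := by
  simp only [eulerBar, dzbar_comp_smul hf, Pi.smul_apply, smul_eq_mul, map_mul]
  exact Finset.sum_congr rfl fun i _ => by ring

theorem SmoothFn.comp_smul {f : Fn n} (hf : SmoothFn f) {c : ℂ} (hc : c ≠ 0) :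
    SmoothFn (fun z => f (c • z)) :=
  ContDiffOn.comp hf (contDiff_id.const_smul c).contDiffOn fun _ hz => smul_mem_phase hc hz

theorem hasDerivAt_comp_path {f : Fn n} {a : ℝ → ℂ} {a' : ℂ} {t : ℝ} {z : Coord n}
    (hf : DifferentiableAt ℝ f (a t • z)) (ha : HasDerivAt a a' t) :
    HasDerivAt (fun s => f (a s • z)) (fderiv ℝ f (a t • z) (a' • z)) t :=
  hf.hasFDerivAt.comp_hasDerivAt t (ha.smul_const z)

theorem flow_zero (κ : ℝ) (z : Coord n) : flow κ 0 z = z := by simp [flow]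

theorem flow_mem_phase (κ t : ℝ) {z : Coord n} (hz : z ∈ phase n) : flow κ t z ∈ phase n :=
  smul_mem_phase (Complex.exp_ne_zero _) hz

/-- The velocity of the flow at a point `w` is `(iκ/2) w`; the derivative of `f` in this direction
is `(iκ/2)(E - Ē) f`, which is the bracket with `J`. -/
theorem hasDerivAt_comp_flow (κ μ : ℝ) {f : Fn n} (hf : SmoothFn f) {z : Coord n}
    (hz : z ∈ phase n) (t : ℝ) :
    HasDerivAt (fun s => f (flow κ s z)) (poisson κ f (J μ) (flow κ t z)) t := by
  have hx : HasDerivAt (fun s : ℝ => Complex.I * ((κ / 2 * s : ℝ) : ℂ))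
      (Complex.I * ((κ / 2 : ℝ) : ℂ)) t := by
    have := ((hasDerivAt_id t).const_mul (κ / 2)).ofReal_comp.const_mul Complex.I
    simpa using this
  have h := hasDerivAt_comp_path (z := z) (hf.differentiableAt (flow_mem_phase κ t hz)) hx.cexp
  have e : poisson κ f (J μ) (flow κ t z) =
      fderiv ℝ f (Complex.exp (Complex.I * ((κ / 2 * t : ℝ) : ℂ)) • z)
        ((Complex.exp (Complex.I * ((κ / 2 * t : ℝ) : ℂ)) * (Complex.I * ((κ / 2 : ℝ) : ℂ))) •
          z) := by
    rw [mul_comm (Complex.exp _), ← smul_smul]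
    change _ = fderiv ℝ f (flow κ t z) ((Complex.I * ((κ / 2 : ℝ) : ℂ)) • flow κ t z)
    rw [fderiv_apply_smul, poisson_J, map_mul, Complex.conj_I, Complex.conj_ofReal]
    push_cast
    ring
  rw [e]
  exact h

/-! ### The radial projection -/

theorem J_eq_zero_iff (μ : ℝ) (z : Coord n) : J μ z = 0 ↔ zz z = -2 * μ := by
  rw [J, Complex.ofReal_eq_zero]
  constructor <;> intro h <;> linarith

theorem sqrt_ratio_pos {μ : ℝ} (hμ : μ < 0) {z : Coord n} (hz : z ∈ phase n) :
    0 < Real.sqrt (-2 * μ / zz z) :=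
  Real.sqrt_pos.2 (div_pos (by linarith) (zz_pos hz))

theorem sq_sqrt_ratio_mul {μ : ℝ} (hμ : μ < 0) {z : Coord n} (hz : z ∈ phase n) :
    Real.sqrt (-2 * μ / zz z) ^ 2 * zz z = -2 * μ := by
  have h := zz_pos hz
  rw [Real.sq_sqrt (div_pos (by linarith) h).le]
  field_simp

theorem proj_mem_phase {μ : ℝ} (hμ : μ < 0) {z : Coord n} (hz : z ∈ phase n) :
    proj μ z ∈ phase n :=
  smul_mem_phase (Complex.ofReal_ne_zero.2 (sqrt_ratio_pos hμ hz).ne') hz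

theorem zz_proj {μ : ℝ} (hμ : μ < 0) {z : Coord n} (hz : z ∈ phase n) :
    zz (proj μ z) = -2 * μ := by
  rw [proj, zz_smul, Complex.normSq_ofReal, ← sq, sq_sqrt_ratio_mul hμ hz]

theorem proj_mem_surface {μ : ℝ} (hμ : μ < 0) {z : Coord n} (hz : z ∈ phase n) :
    proj μ z ∈ surface n μ := (J_eq_zero_iff _ _).2 (zz_proj hμ hz)

theorem surface_subset_phase {μ : ℝ} (hμ : μ < 0) : surface n μ ⊆ phase n := by
  rintro z hz rfl
  have := (J_eq_zero_iff _ _).1 hz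
  simp [zz] at this
  exact hμ.ne this

theorem proj_eq_self {μ : ℝ} (hμ : μ < 0) {z : Coord n} (hz : z ∈ surface n μ) :
    proj μ z = z := by
  rw [proj, (J_eq_zero_iff _ _).1 hz, div_self (by linarith)]
  simp

/-- The projection forgets the modulus of the scalar and keeps its phase. Hence prolongations are
invariant under positive scalings, and prolongation commutes with the circle action. -/
theorem proj_smul (μ : ℝ) {c : ℂ} (hc : c ≠ 0) (z : Coord n) :
    proj μ (c • z) = (c / (‖c‖ : ℂ)) • proj μ z := by
  have h : Real.sqrt (-2 * μ / zz (c • z)) = Real.sqrt (-2 * μ / zz z) / ‖c‖ := by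
    rw [zz_smul, Complex.normSq_eq_norm_sq, mul_comm (‖c‖ ^ 2), ← div_div,
      Real.sqrt_div' _ (by positivity), Real.sqrt_sq (norm_nonneg c)]
  rw [proj, proj, h, smul_smul, smul_smul]
  congr 1
  push_cast
  ring

theorem contDiffOn_sqrt_ratio {μ : ℝ} (hμ : μ < 0) :
    ContDiffOn ℝ ∞ (fun z : Coord n => Real.sqrt (-2 * μ / zz z)) (phase n) :=
  (contDiffOn_const.div contDiff_zz.contDiffOn fun _ hz => (zz_pos hz).ne').sqrt
    fun _ hz => (div_pos (by linarith) (zz_pos hz)).ne'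

theorem contDiffOn_proj {μ : ℝ} (hμ : μ < 0) :
    ContDiffOn ℝ ∞ (proj μ : Coord n → Coord n) (phase n) := by
  have h : ContDiffOn ℝ ∞ (fun z : Coord n => (Real.sqrt (-2 * μ / zz z) : ℂ)) (phase n) :=
    Complex.ofRealCLM.contDiff.comp_contDiffOn (contDiffOn_sqrt_ratio hμ)
  exact h.smul contDiffOn_id

theorem SmoothFn.smooth_prol {μ : ℝ} (hμ : μ < 0) {f : Fn n} (hf : SmoothFn f) :
    SmoothFn (prol μ f) :=
  ContDiffOn.comp hf (contDiffOn_proj hμ) fun _ hz => proj_mem_phase hμ hz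

theorem prol_eqOn {μ : ℝ} (hμ : μ < 0) {f g : Fn n} (h : Set.EqOn f g (phase n)) :
    Set.EqOn (prol μ f) (prol μ g) (phase n) := fun _ hz => h (proj_mem_phase hμ hz)

theorem prol_eq_self_on_surface {μ : ℝ} (hμ : μ < 0) (f : Fn n) {z : Coord n}
    (hz : z ∈ surface n μ) : prol μ f z = f z := by
  rw [prol, proj_eq_self hμ hz]

theorem prol_prol {μ : ℝ} (hμ : μ < 0) (f : Fn n) {z : Coord n} (hz : z ∈ phase n) :
    prol μ (prol μ f) z = prol μ f z :=
  prol_eq_self_on_surface hμ f (proj_mem_surface hμ hz)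

/-! ### The component along the constraint function -/

theorem eq_prol_add_compJ_mul_J {μ : ℝ} (hμ : μ < 0) (f : Fn n) (z : Coord n) :
    f z = prol μ f z + compJ μ f z * J μ z := by
  by_cases h : J μ z = 0
  · rw [h, mul_zero, add_zero, prol_eq_self_on_surface hμ f h]
  · rw [compJ, if_neg h, div_mul_cancel₀ _ h]; ring

/-- The radial segment from `proj z` (at `t = 0`) to `z` (at `t = 1`). -/
noncomputable def segCoeff (μ : ℝ) (z : Coord n) (t : ℝ) : ℝ :=
  (1 - t) * Real.sqrt (-2 * μ / zz z) + t

theorem segCoeff_pos {μ : ℝ} (hμ : μ < 0) {z : Coord n} (hz : z ∈ phase n) {t : ℝ}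
    (ht : t ∈ Set.Icc (0 : ℝ) 1) : 0 < segCoeff μ z t := by
  have h := sqrt_ratio_pos hμ hz
  rcases eq_or_lt_of_le ht.1 with rfl | h0
  · simpa [segCoeff] using h
  · have := mul_nonneg (sub_nonneg.2 ht.2) h.le
    unfold segCoeff; linarith

theorem contDiffOn_segCoeff {μ : ℝ} (hμ : μ < 0) :
    ContDiffOn ℝ ∞ (fun p : Coord n × ℝ => segCoeff μ p.1 p.2) (phase n ×ˢ Set.univ) := by
  have h : ContDiffOn ℝ ∞ (fun p : Coord n × ℝ => Real.sqrt (-2 * μ / zz p.1))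
      (phase n ×ˢ Set.univ) :=
    (contDiffOn_sqrt_ratio hμ).comp contDiff_fst.contDiffOn fun p hp => hp.1
  exact ((contDiffOn_const.sub contDiff_snd.contDiffOn).mul h).add contDiff_snd.contDiffOn

/-- The integrand in the integral formula for the component along `J`. -/
noncomputable def radialDeriv (μ : ℝ) (f : Fn n) (p : Coord n × ℝ) : ℂ :=
  fderiv ℝ f ((segCoeff μ p.1 p.2 : ℂ) • p.1) p.1

/-- The radial segments lying in the phase space. -/
noncomputable def segDomain (n : ℕ) (μ : ℝ) : Set (Coord n × ℝ) :=
  (phase n ×ˢ Set.univ) ∩ (fun p : Coord n × ℝ => segCoeff μ p.1 p.2) ⁻¹' {0}ᶜ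

theorem isOpen_segDomain {μ : ℝ} (hμ : μ < 0) : IsOpen (segDomain n μ) :=
  (contDiffOn_segCoeff hμ).continuousOn.isOpen_inter_preimage
    ((isOpen_phase n).prod isOpen_univ) isOpen_compl_singleton

theorem prod_Icc_subset_segDomain {μ : ℝ} (hμ : μ < 0) :
    phase n ×ˢ Set.Icc (0 : ℝ) 1 ⊆ segDomain n μ :=
  fun _ hp => ⟨⟨hp.1, trivial⟩, (segCoeff_pos hμ hp.1 hp.2).ne'⟩

theorem contDiffOn_radialDeriv {μ : ℝ} (hμ : μ < 0) {f : Fn n} (hf : SmoothFn f) :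
    ContDiffOn ℝ ∞ (radialDeriv μ f) (segDomain n μ) := by
  have h1 : ContDiffOn ℝ ∞ (fun p : Coord n × ℝ => (segCoeff μ p.1 p.2 : ℂ) • p.1)
      (segDomain n μ) :=
    (Complex.ofRealCLM.contDiff.comp_contDiffOn
      ((contDiffOn_segCoeff hμ).mono Set.inter_subset_left)).smul contDiff_fst.contDiffOn
  have h2 : ContDiffOn ℝ ∞ (fderiv ℝ f) (phase n) :=
    ContDiffOn.fderiv_of_isOpen hf (isOpen_phase n) (by simp)
  exact (h2.comp h1 fun p hp => smul_mem_phase (Complex.ofReal_ne_zero.2 hp.2)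
    hp.1.1).clm_apply contDiff_fst.contDiffOn

/-- Fundamental theorem of calculus along the radial segment from `proj μ z` to `z`, whose length
factor `1 - √(-2μ/z z̄)` is pulled out. -/
theorem sub_prol_eq_integral {μ : ℝ} (hμ : μ < 0) {f : Fn n} (hf : SmoothFn f) {z : Coord n}
    (hz : z ∈ phase n) :
    f z - prol μ f z = (1 - (Real.sqrt (-2 * μ / zz z) : ℂ)) *
      ∫ t in (0 : ℝ)..1, radialDeriv μ f (z, t) := by
  set s := Real.sqrt (-2 * μ / zz z) with hs
  have hcont : ContinuousOn (fun t => radialDeriv μ f (z, t)) (Set.Icc 0 1) :=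
    (contDiffOn_radialDeriv hμ hf).continuousOn.comp (by fun_prop)
      fun t ht => prod_Icc_subset_segDomain hμ ⟨hz, ht⟩
  have hd : ∀ t ∈ Set.uIcc (0 : ℝ) 1, HasDerivAt (fun t => f ((segCoeff μ z t : ℂ) • z))
      ((1 - (s : ℂ)) * radialDeriv μ f (z, t)) t := fun t ht => by
    rw [Set.uIcc_of_le zero_le_one] at ht
    have hc : HasDerivAt (fun t => (segCoeff μ z t : ℂ)) ((1 - s : ℝ) : ℂ) t := by
      refine HasDerivAt.ofReal_comp ?_
      unfold segCoeff
      rw [← hs]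
      have h := (((hasDerivAt_id t).const_sub 1).mul_const s).add (hasDerivAt_id t)
      rwa [show -1 * s + 1 = 1 - s by ring] at h
    have h := hasDerivAt_comp_path (a := fun t => (segCoeff μ z t : ℂ)) (hf.differentiableAt (smul_mem_phase
      (Complex.ofReal_ne_zero.2 (segCoeff_pos hμ hz ht).ne') hz)) hc
    rw [Complex.coe_smul (1 - s) z, map_smul, Complex.real_smul, Complex.ofReal_sub,
      Complex.ofReal_one] at h
    exact h
  rw [← intervalIntegral.integral_const_mul, intervalIntegral.integral_eq_sub_of_hasDerivAt hd]
  · simp [segCoeff, prol, proj]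
  · refine ContinuousOn.intervalIntegrable ?_
    rw [Set.uIcc_of_le zero_le_one]
    exact continuousOn_const.mul hcont

/-- With `s = √(-2μ/z z̄)` one has `J = -½ z z̄ (1 - s)(1 + s)`, so the factor `1 - s` of the
difference cancels and no singular denominator is left. On the surface `s = 1` and the integrand is
constant, which matches the value prescribed there. Smoothness of the quotient follows. -/
theorem compJ_eqOn_integral {μ : ℝ} (hμ : μ < 0) {f : Fn n} (hf : SmoothFn f) :
    Set.EqOn (compJ μ f) (fun z => ((-2 / (zz z * (1 + Real.sqrt (-2 * μ / zz z))) : ℝ) : ℂ) *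
      ∫ t in (0 : ℝ)..1, radialDeriv μ f (z, t)) (phase n) := fun z hz => by
  have hx := zz_pos hz
  have hs := sqrt_ratio_pos hμ hz
  have hsx := sq_sqrt_ratio_mul hμ hz
  by_cases h : J μ z = 0
  · have hy := (J_eq_zero_iff _ _).1 h
    have hs1 : Real.sqrt (-2 * μ / zz z) = 1 := by
      rw [hy, div_self (by linarith), Real.sqrt_one]
    have hr : ∀ t, radialDeriv μ f (z, t) = euler f z + eulerBar f z := fun t => by
      have h1 := fderiv_apply_smul f z 1
      have h2 : segCoeff μ z t = 1 := by rw [segCoeff, hs1]; ring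
      rw [one_smul, map_one, one_mul, one_mul] at h1
      rw [radialDeriv, h2, Complex.ofReal_one, one_smul, h1]
    have hμ' : (μ : ℂ) ≠ 0 := Complex.ofReal_ne_zero.2 hμ.ne
    simp only [compJ, if_pos h, hr, hs1]
    simp only [hy, intervalIntegral.integral_const]
    simp
    field_simp
    norm_num
  · rw [compJ, if_neg h, sub_prol_eq_integral hμ hf hz, div_eq_iff h, J]
    beta_reduce
    generalize Real.sqrt (-2 * μ / zz z) = s at hs hsx ⊢
    have : (1 - s) = (-2 / (zz z * (1 + s))) * (-(1 / 2) * zz z - μ) := by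
      field_simp
      linear_combination -hsx
    have h' := congrArg (fun x : ℝ => (x : ℂ)) this
    simp only [Complex.ofReal_sub, Complex.ofReal_one] at h'
    rw [h']
    push_cast
    ring

theorem SmoothFn.smooth_compJ {μ : ℝ} (hμ : μ < 0) {f : Fn n} (hf : SmoothFn f) :
    SmoothFn (compJ μ f) := by
  refine SmoothFn.congr ?_ (compJ_eqOn_integral hμ hf)
  have h1 : ContDiffOn ℝ ∞
      (fun z : Coord n => -2 / (zz z * (1 + Real.sqrt (-2 * μ / zz z)))) (phase n) :=
    contDiffOn_const.div (contDiff_zz.contDiffOn.mul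
      (contDiffOn_const.add (contDiffOn_sqrt_ratio hμ))) fun z hz =>
      (mul_pos (zz_pos hz) (by linarith [sqrt_ratio_pos hμ hz])).ne'
  exact (Complex.ofRealCLM.contDiff.comp_contDiffOn h1).mul
    (contDiffOn_parametric_integral (isOpen_phase n) (isOpen_segDomain hμ)
      (prod_Icc_subset_segDomain hμ) (contDiffOn_radialDeriv hμ hf))

theorem euler_eqOn {f g : Fn n} (h : Set.EqOn f g (phase n)) :
    Set.EqOn (euler f) (euler g) (phase n) := fun z hz =>
  Finset.sum_congr rfl fun i _ => by rw [dz_eqOn (isOpen_phase n) h i hz]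

theorem eulerBar_eqOn {f g : Fn n} (h : Set.EqOn f g (phase n)) :
    Set.EqOn (eulerBar f) (eulerBar g) (phase n) := fun z hz =>
  Finset.sum_congr rfl fun i _ => by rw [dzbar_eqOn (isOpen_phase n) h i hz]

theorem compJ_eqOn {μ : ℝ} (hμ : μ < 0) {f g : Fn n} (h : Set.EqOn f g (phase n)) :
    Set.EqOn (compJ μ f) (compJ μ g) (phase n) := fun z hz => by
  rw [compJ, compJ, h hz, prol_eqOn hμ h hz, euler_eqOn h hz, eulerBar_eqOn h hz]

/-- A continuous function on the phase space that vanishes off the constraint surface is zero. -/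
theorem eqOn_zero_of_mul_J_eq_zero {μ : ℝ} (hμ : μ < 0) {h : Fn n} (hh : SmoothFn h)
    (h0 : ∀ z ∈ phase n, h z * J μ z = 0) : ∀ z ∈ phase n, h z = 0 := by
  intro z hz
  by_cases hJ : J μ z = 0
  · have hpath : ContinuousAt (fun t : ℝ => h ((t : ℂ) • z)) 1 := by
      have h1 : ContinuousAt h (((1 : ℝ) : ℂ) • z) := by
        simpa using (hh.differentiableAt hz).continuousAt
      exact ContinuousAt.comp (g := h) (f := fun t : ℝ => (t : ℂ) • z) h1
        (Complex.continuous_ofReal.smul continuous_const).continuousAt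
    -- A surface point is approached radially from outside, where `J` does not vanish.
    have hev : ∀ᶠ t : ℝ in nhdsWithin 1 (Set.Ioi 1), h ((t : ℂ) • z) = 0 := by
      filter_upwards [self_mem_nhdsWithin] with t ht
      have ht1 : (1 : ℝ) < t := ht
      have ht0 : (t : ℂ) ≠ 0 := Complex.ofReal_ne_zero.2 (by linarith)
      refine (mul_eq_zero.1 (h0 _ (smul_mem_phase ht0 hz))).resolve_right fun h2 => ?_
      rw [J_eq_zero_iff, zz_smul, Complex.normSq_ofReal, (J_eq_zero_iff _ _).1 hJ] at h2
      have : (t * t - 1) * (-2 * μ) = 0 := by linarith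
      rcases mul_eq_zero.1 this with h3 | h3
      · nlinarith
      · linarith
    have hlim : Filter.Tendsto (fun t : ℝ => h ((t : ℂ) • z)) (nhdsWithin 1 (Set.Ioi 1))
        (nhds (h (((1 : ℝ) : ℂ) • z))) := hpath.tendsto.mono_left nhdsWithin_le_nhds
    have := tendsto_nhds_unique (hlim.congr' hev) tendsto_const_nhds
    simpa using this
  · exact (mul_eq_zero.1 (h0 z hz)).resolve_right hJ

theorem eqOn_compJ_of_eq_prol_add {μ : ℝ} (hμ : μ < 0) {f h : Fn n} (hf : SmoothFn f)
    (hh : SmoothFn h) (heq : ∀ z ∈ phase n, f z = prol μ f z + h z * J μ z) :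
    Set.EqOn h (compJ μ f) (phase n) := by
  have hd : SmoothFn (fun z => h z - compJ μ f z) := ContDiffOn.sub hh (hf.smooth_compJ hμ)
  intro z hz
  refine sub_eq_zero.1 (eqOn_zero_of_mul_J_eq_zero hμ hd (fun w hw => ?_) z hz)
  linear_combination (eq_prol_add_compJ_mul_J hμ f w) - heq w hw

end Radial

/-! ### Exponentials of contractions by commuting derivations, and their associativity. -/

section FormalSeries

open Finset

/-! ### Formal series over a commutative algebra -/

variable {A : Type*} [CommRing A] [Algebra ℂ A]

/-- The `λ`-bilinear extension to series of a formal series of bilinear maps. -/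
noncomputable def seriesMul (M : ℕ → A →ₗ[ℂ] A →ₗ[ℂ] A) (f g : ℕ → A) : ℕ → A := fun m =>
  ∑ p ∈ antidiagonal m, ∑ q ∈ antidiagonal p.2, M p.1 (f q.1) (g q.2)

/-- The `λ`-linear extension to series of a formal series of linear maps. -/
noncomputable def seriesMap (D : ℕ → A →ₗ[ℂ] A) (f : ℕ → A) : ℕ → A := fun m =>
  ∑ p ∈ antidiagonal m, D p.1 (f p.2)

theorem seriesMul_add_left (M : ℕ → A →ₗ[ℂ] A →ₗ[ℂ] A) (f f' g : ℕ → A) :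
    seriesMul M (f + f') g = seriesMul M f g + seriesMul M f' g := by
  ext m; simp [seriesMul, sum_add_distrib]

theorem seriesMul_add_right (M : ℕ → A →ₗ[ℂ] A →ₗ[ℂ] A) (f g g' : ℕ → A) :
    seriesMul M f (g + g') = seriesMul M f g + seriesMul M f g' := by
  ext m; simp [seriesMul, sum_add_distrib]

theorem seriesMul_sub_left (M : ℕ → A →ₗ[ℂ] A →ₗ[ℂ] A) (f f' g : ℕ → A) :
    seriesMul M (f - f') g = seriesMul M f g - seriesMul M f' g := by
  ext m; simp [seriesMul, sum_sub_distrib]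

/-- A common normal form for the two bracketings of a triple product: the total order of the two
operators is split off first, then the orders of the three factors. The inner sum is then a single
order of the associativity identity. -/
theorem sum_antidiagonal_reindex_left {B : Type*} [AddCommMonoid B]
    (F : ℕ → ℕ → ℕ → ℕ → ℕ → B) (m : ℕ) :
    ∑ p ∈ antidiagonal m, ∑ q ∈ antidiagonal p.2, ∑ r ∈ antidiagonal q.1,
      ∑ s ∈ antidiagonal r.2, F p.1 r.1 s.1 s.2 q.2 =
    ∑ p ∈ antidiagonal m, ∑ q ∈ antidiagonal p.2, ∑ r ∈ antidiagonal q.2,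
      ∑ s ∈ antidiagonal p.1, F s.1 s.2 q.1 r.1 r.2 := by
  simp only [sum_sigma']
  refine sum_nbij'
    (fun x => ⟨(x.1.1 + x.2.2.1.1, x.2.2.2.1 + x.2.2.2.2 + x.2.1.2),
      (x.2.2.2.1, x.2.2.2.2 + x.2.1.2), (x.2.2.2.2, x.2.1.2), (x.1.1, x.2.2.1.1)⟩)
    (fun y => ⟨(y.2.2.2.1, y.2.2.2.2 + y.2.1.1 + y.2.2.1.1 + y.2.2.1.2),
      (y.2.2.2.2 + y.2.1.1 + y.2.2.1.1, y.2.2.1.2), (y.2.2.2.2, y.2.1.1 + y.2.2.1.1),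
      (y.2.1.1, y.2.2.1.1)⟩) ?_ ?_ ?_ ?_ ?_
  all_goals
    rintro ⟨⟨a, b⟩, ⟨c, d⟩, ⟨e, f⟩, ⟨g, h⟩⟩ hx
    simp only [mem_sigma, HasAntidiagonal.mem_antidiagonal, and_true, true_and] at hx ⊢
  · omega
  · omega
  · obtain ⟨h1, h2, h3, h4⟩ := hx
    subst h4 h3 h2 h1
    simp [add_assoc]
  · obtain ⟨h1, h2, h3, h4⟩ := hx
    subst h4 h3 h2 h1
    simp [add_assoc]

theorem sum_antidiagonal_reindex_right {B : Type*} [AddCommMonoid B]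
    (F : ℕ → ℕ → ℕ → ℕ → ℕ → B) (m : ℕ) :
    ∑ p ∈ antidiagonal m, ∑ q ∈ antidiagonal p.2, ∑ r ∈ antidiagonal q.2,
      ∑ s ∈ antidiagonal r.2, F p.1 r.1 q.1 s.1 s.2 =
    ∑ p ∈ antidiagonal m, ∑ q ∈ antidiagonal p.2, ∑ r ∈ antidiagonal q.2,
      ∑ s ∈ antidiagonal p.1, F s.1 s.2 q.1 r.1 r.2 := by
  simp only [sum_sigma']
  refine sum_nbij'
    (fun x => ⟨(x.1.1 + x.2.2.1.1, x.2.1.1 + x.2.2.2.1 + x.2.2.2.2),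
      (x.2.1.1, x.2.2.2.1 + x.2.2.2.2), (x.2.2.2.1, x.2.2.2.2), (x.1.1, x.2.2.1.1)⟩)
    (fun y => ⟨(y.2.2.2.1, y.2.2.2.2 + y.2.1.1 + y.2.2.1.1 + y.2.2.1.2),
      (y.2.1.1, y.2.2.2.2 + y.2.2.1.1 + y.2.2.1.2), (y.2.2.2.2, y.2.2.1.1 + y.2.2.1.2),
      (y.2.2.1.1, y.2.2.1.2)⟩) ?_ ?_ ?_ ?_ ?_
  all_goals
    rintro ⟨⟨a, b⟩, ⟨c, d⟩, ⟨e, f⟩, ⟨g, h⟩⟩ hx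
    simp only [mem_sigma, HasAntidiagonal.mem_antidiagonal, and_true] at hx ⊢
  · omega
  · omega
  · obtain ⟨h1, h2, h3, h4⟩ := hx
    subst h4 h3 h2 h1
    simp [add_assoc, add_left_comm]
  · obtain ⟨h1, h2, h3, h4⟩ := hx
    subst h4 h3 h2 h1
    simp [add_assoc]

theorem seriesMul_assoc (M : ℕ → A →ₗ[ℂ] A →ₗ[ℂ] A)
    (hM : ∀ m f g h, ∑ p ∈ antidiagonal m, M p.1 (M p.2 f g) h =
      ∑ p ∈ antidiagonal m, M p.1 f (M p.2 g h)) (f g h : ℕ → A) :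
    seriesMul M (seriesMul M f g) h = seriesMul M f (seriesMul M g h) := by
  ext m
  simp only [seriesMul, map_sum, LinearMap.sum_apply]
  rw [sum_antidiagonal_reindex_left (fun a b i j k => M a (M b (f i) (g j)) (h k)),
    sum_antidiagonal_reindex_right (fun a b i j k => M a (f i) (M b (g j) (h k)))]
  simp only [hM]

/-- The iterated contraction `∑ d_{i₁} ⋯ d_{iᵣ} f · e_{i₁} ⋯ e_{iᵣ} g`. -/
noncomputable def iterContr {ι : Type*} [Fintype ι] (d e : ι → Derivation ℂ A A) :
    ℕ → A →ₗ[ℂ] A →ₗ[ℂ] A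
  | 0 => LinearMap.mul ℂ A
  | r + 1 => ∑ i, (iterContr d e r).compl₁₂ (d i : A →ₗ[ℂ] A) (e i : A →ₗ[ℂ] A)

section

variable {ι : Type*} [Fintype ι] (d e : ι → Derivation ℂ A A)

theorem iterContr_zero (f g : A) : iterContr d e 0 f g = f * g := rfl

theorem iterContr_succ (r : ℕ) (f g : A) :
    iterContr d e (r + 1) f g = ∑ i, iterContr d e r (d i f) (e i g) := by
  simp [iterContr, LinearMap.sum_apply]

theorem iterContr_leibniz (δ : Derivation ℂ A A) (hd : ∀ i a, δ (d i a) = d i (δ a))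
    (he : ∀ i a, δ (e i a) = e i (δ a)) (r : ℕ) (f g : A) :
    δ (iterContr d e r f g) = iterContr d e r (δ f) g + iterContr d e r f (δ g) := by
  induction r generalizing f g with
  | zero => simp only [iterContr_zero, Derivation.leibniz, smul_eq_mul]; ring
  | succ r ih => simp only [iterContr_succ, map_sum, ih, hd, he, sum_add_distrib]

/-- Pascal's rule selects whether the additional contraction is the inner or the outer one, and
Leibniz distributes an outer one. It then joins `f` to `g`, `f` to `h`, or `g` to `h`. -/
theorem sum_choose_smul_iterContr_succ (hdd : ∀ i j a, d i (d j a) = d j (d i a))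
    (hde : ∀ i j a, d i (e j a) = e j (d i a)) (m : ℕ) (f g h : A) :
    ∑ p ∈ antidiagonal (m + 1),
        (m + 1).choose p.1 • iterContr d e p.1 (iterContr d e p.2 f g) h =
      ∑ i, (∑ p ∈ antidiagonal m,
          m.choose p.1 • iterContr d e p.1 (iterContr d e p.2 (d i f) (e i g)) h +
        ∑ p ∈ antidiagonal m,
          m.choose p.1 • iterContr d e p.1 (iterContr d e p.2 (d i f) g) (e i h) +
        ∑ p ∈ antidiagonal m,
          m.choose p.1 • iterContr d e p.1 (iterContr d e p.2 f (d i g)) (e i h)) := by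
  rw [sum_antidiagonal_choose_succ_nsmul
    (fun a b => iterContr d e a (iterContr d e b f g) h)]
  simp only [iterContr_succ, iterContr_leibniz d e (d _) (hdd _) (hde _), map_sum, map_add,
    LinearMap.sum_apply, LinearMap.add_apply, sum_add_distrib, smul_sum, smul_add]
  rw [add_assoc]
  congr 1
  · exact sum_comm
  · simp only [← sum_add_distrib]
    rw [sum_comm]
    refine sum_congr rfl fun i _ => sum_congr rfl fun p hp => ?_
    rw [Nat.choose_symm_of_eq_add (HasAntidiagonal.mem_antidiagonal.1 hp).symm]

theorem sum_choose_smul_iterContr_succ' (hee : ∀ i j a, e i (e j a) = e j (e i a))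
    (hde : ∀ i j a, d i (e j a) = e j (d i a)) (m : ℕ) (f g h : A) :
    ∑ p ∈ antidiagonal (m + 1),
        (m + 1).choose p.1 • iterContr d e p.1 f (iterContr d e p.2 g h) =
      ∑ i, (∑ p ∈ antidiagonal m,
          m.choose p.1 • iterContr d e p.1 (d i f) (iterContr d e p.2 (e i g) h) +
        ∑ p ∈ antidiagonal m,
          m.choose p.1 • iterContr d e p.1 (d i f) (iterContr d e p.2 g (e i h)) +
        ∑ p ∈ antidiagonal m,
          m.choose p.1 • iterContr d e p.1 f (iterContr d e p.2 (d i g) (e i h))) := by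
  rw [sum_antidiagonal_choose_succ_nsmul
    (fun a b => iterContr d e a f (iterContr d e b g h)), add_comm]
  simp only [iterContr_succ, iterContr_leibniz d e (e _) (fun i a => (hde i _ a).symm) (hee _),
    map_sum, map_add, sum_add_distrib, smul_sum, smul_add]
  congr 1
  · simp only [← sum_add_distrib]
    rw [sum_comm]
    refine sum_congr rfl fun i _ => sum_congr rfl fun p hp => ?_
    rw [Nat.choose_symm_of_eq_add (HasAntidiagonal.mem_antidiagonal.1 hp).symm]
  · exact sum_comm

/-- Both bracketings satisfy the same recursion, with one term for each pair of factors that the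
extra contraction can join. The start is associativity of multiplication. -/
theorem sum_choose_smul_iterContr_assoc (hdd : ∀ i j a, d i (d j a) = d j (d i a))
    (hee : ∀ i j a, e i (e j a) = e j (e i a)) (hde : ∀ i j a, d i (e j a) = e j (d i a))
    (m : ℕ) (f g h : A) :
    ∑ p ∈ antidiagonal m, m.choose p.1 • iterContr d e p.1 (iterContr d e p.2 f g) h =
      ∑ p ∈ antidiagonal m, m.choose p.1 • iterContr d e p.1 f (iterContr d e p.2 g h) := by
  induction m generalizing f g h with
  | zero => simp [iterContr_zero, mul_assoc]
  | succ m ih =>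
    rw [sum_choose_smul_iterContr_succ d e hdd hde, sum_choose_smul_iterContr_succ' d e hee hde]
    simp only [ih]

/-- Turns the exponential normalisation into the binomial weights of the preceding identity. -/
theorem pow_div_factorial_mul (κ : ℂ) {m a b : ℕ} (h : a + b = m) :
    κ ^ a / (a.factorial : ℂ) * (κ ^ b / (b.factorial : ℂ)) =
      κ ^ m / (m.factorial : ℂ) * (m.choose a : ℂ) := by
  subst h
  have h1 : (a.factorial : ℂ) ≠ 0 := Nat.cast_ne_zero.2 a.factorial_ne_zero
  have h2 : (b.factorial : ℂ) ≠ 0 := Nat.cast_ne_zero.2 b.factorial_ne_zero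
  have h3 : ((a + b).factorial : ℂ) ≠ 0 := Nat.cast_ne_zero.2 (a + b).factorial_ne_zero
  have h4 : ((a + b).choose a : ℂ) * a.factorial * b.factorial = (a + b).factorial := by
    rw [Nat.choose_symm_add]
    exact_mod_cast Nat.add_choose_mul_factorial_mul_factorial a b
  field_simp
  rw [← h4]
  ring

/-- The terms of the exponential of the contraction. -/
noncomputable def expContr (κ : ℂ) (r : ℕ) : A →ₗ[ℂ] A →ₗ[ℂ] A :=
  (κ ^ r / (r.factorial : ℂ)) • iterContr d e r

theorem expContr_assoc (hdd : ∀ i j a, d i (d j a) = d j (d i a))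
    (hee : ∀ i j a, e i (e j a) = e j (e i a)) (hde : ∀ i j a, d i (e j a) = e j (d i a))
    (κ : ℂ) (m : ℕ) (f g h : A) :
    ∑ p ∈ antidiagonal m, expContr d e κ p.1 (expContr d e κ p.2 f g) h =
      ∑ p ∈ antidiagonal m, expContr d e κ p.1 f (expContr d e κ p.2 g h) := by
  have key := congrArg (fun x => (κ ^ m / (m.factorial : ℂ)) • x)
    (sum_choose_smul_iterContr_assoc d e hdd hee hde m f g h)
  simp only [smul_sum] at key
  refine Eq.trans (sum_congr rfl fun p hp => ?_) (key.trans (sum_congr rfl fun p hp => ?_))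
  · simp only [expContr, LinearMap.smul_apply, map_smul, smul_smul]
    rw [mul_comm, pow_div_factorial_mul κ (HasAntidiagonal.mem_antidiagonal.1 hp), ← smul_smul,
      Nat.cast_smul_eq_nsmul]
  · simp only [expContr, LinearMap.smul_apply, map_smul, smul_smul]
    rw [mul_comm (κ ^ p.2 / _), pow_div_factorial_mul κ (HasAntidiagonal.mem_antidiagonal.1 hp), ← smul_smul,
      Nat.cast_smul_eq_nsmul]

end

end FormalSeries

/-! ### The algebra of smooth functions on the phase space and its Wick product. -/

section SmoothAlgebra

variable {n : ℕ}

/-! ### The algebra of smooth functions on the phase space -/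

theorem smoothFn_const (c : ℂ) : SmoothFn (fun _ : Coord n => c) := contDiffOn_const

theorem SmoothFn.add {f g : Fn n} (hf : SmoothFn f) (hg : SmoothFn g) :
    SmoothFn (fun z => f z + g z) := ContDiffOn.add hf hg

theorem SmoothFn.sub {f g : Fn n} (hf : SmoothFn f) (hg : SmoothFn g) :
    SmoothFn (fun z => f z - g z) := ContDiffOn.sub hf hg

theorem SmoothFn.mul {f g : Fn n} (hf : SmoothFn f) (hg : SmoothFn g) :
    SmoothFn (fun z => f z * g z) := ContDiffOn.mul hf hg

theorem SmoothFn.sum {ι : Type*} {s : Finset ι} {f : ι → Fn n} (hf : ∀ i ∈ s, SmoothFn (f i)) :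
    SmoothFn (fun z => ∑ i ∈ s, f i z) := ContDiffOn.sum hf

theorem smoothFn_coord (i : Fin (n + 1)) : SmoothFn (fun z : Coord n => z i) :=
  (ContinuousLinearMap.proj (R := ℝ) (φ := fun _ : Fin (n + 1) => ℂ) i).contDiff.contDiffOn

theorem smoothFn_conj_coord (i : Fin (n + 1)) :
    SmoothFn (fun z : Coord n => (starRingEnd ℂ) (z i)) :=
  ((Complex.conjCLE : ℂ →L[ℝ] ℂ).comp
    (ContinuousLinearMap.proj (R := ℝ) (φ := fun _ : Fin (n + 1) => ℂ) i)).contDiff.contDiffOn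

theorem SmoothFn.smooth_euler {f : Fn n} (hf : SmoothFn f) : SmoothFn (euler f) :=
  SmoothFn.sum fun i _ => (smoothFn_coord i).mul (hf.smooth_dz i)

theorem SmoothFn.smooth_eulerBar {f : Fn n} (hf : SmoothFn f) : SmoothFn (eulerBar f) :=
  SmoothFn.sum fun i _ => (smoothFn_conj_coord i).mul (hf.smooth_dzbar i)

/-- The smooth functions on the phase space, as a subalgebra of all functions. -/
noncomputable def smoothSubalgebra (n : ℕ) : Subalgebra ℂ (phase n → ℂ) where
  carrier := {u | ∃ f : Fn n, SmoothFn f ∧ ∀ z : phase n, u z = f z}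
  mul_mem' := by
    rintro u v ⟨f, hf, hu⟩ ⟨g, hg, hv⟩
    exact ⟨_, hf.mul hg, fun z => by rw [Pi.mul_apply, hu, hv]⟩
  add_mem' := by
    rintro u v ⟨f, hf, hu⟩ ⟨g, hg, hv⟩
    exact ⟨_, hf.add hg, fun z => by rw [Pi.add_apply, hu, hv]⟩
  algebraMap_mem' c := ⟨_, smoothFn_const c, fun _ => rfl⟩

/-- The algebra of smooth functions on the phase space. -/
def SmoothAlg (n : ℕ) : Type := smoothSubalgebra n

noncomputable instance : CommRing (SmoothAlg n) :=
  inferInstanceAs (CommRing (smoothSubalgebra n))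

noncomputable instance : Algebra ℂ (SmoothAlg n) :=
  inferInstanceAs (Algebra ℂ (smoothSubalgebra n))

/-- The element of the algebra of smooth functions given by a smooth function. -/
def toAlg (f : Fn n) (hf : SmoothFn f) : SmoothAlg n := ⟨fun z => f z, f, hf, fun _ => rfl⟩

/-- A smooth function representing an element of the algebra of smooth functions. -/
noncomputable def repr (a : SmoothAlg n) : Fn n := a.2.choose

theorem smoothFn_repr (a : SmoothAlg n) : SmoothFn (repr a) := a.2.choose_spec.1

theorem toAlg_repr (a : SmoothAlg n) : toAlg (repr a) (smoothFn_repr a) = a :=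
  Subtype.ext (funext fun z => (a.2.choose_spec.2 z).symm)

theorem toAlg_eq_iff {f g : Fn n} (hf : SmoothFn f) (hg : SmoothFn g) :
    toAlg f hf = toAlg g hg ↔ Set.EqOn f g (phase n) := by
  refine ⟨fun h z hz => congrFun (congrArg Subtype.val h) ⟨z, hz⟩, fun h => ?_⟩
  exact Subtype.ext (funext fun z => h z.2)

theorem exists_toAlg_eq (a : SmoothAlg n) : ∃ f : Fn n, ∃ hf : SmoothFn f, toAlg f hf = a :=
  ⟨_, _, toAlg_repr a⟩

theorem toAlg_add {f g : Fn n} (hf : SmoothFn f) (hg : SmoothFn g) :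
    toAlg (fun z => f z + g z) (hf.add hg) = toAlg f hf + toAlg g hg := rfl

theorem toAlg_sub {f g : Fn n} (hf : SmoothFn f) (hg : SmoothFn g) :
    toAlg (fun z => f z - g z) (hf.sub hg) = toAlg f hf - toAlg g hg := rfl

theorem toAlg_mul {f g : Fn n} (hf : SmoothFn f) (hg : SmoothFn g) :
    toAlg (fun z => f z * g z) (hf.mul hg) = toAlg f hf * toAlg g hg := rfl

theorem toAlg_const_mul (c : ℂ) {f : Fn n} (hf : SmoothFn f) :
    toAlg (fun z => c * f z) ((smoothFn_const c).mul hf) = c • toAlg f hf := rfl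

theorem toAlg_const (c : ℂ) :
    toAlg (fun _ : Coord n => c) (smoothFn_const c) = algebraMap ℂ (SmoothAlg n) c := rfl

theorem toAlg_sum {ι : Type*} (s : Finset ι) {f : ι → Fn n} (hf : ∀ i, SmoothFn (f i)) :
    toAlg (fun z => ∑ i ∈ s, f i z) (SmoothFn.sum fun i _ => hf i) =
      ∑ i ∈ s, toAlg (f i) (hf i) := by
  classical
  induction s using Finset.induction_on with
  | empty =>
    simp only [Finset.sum_empty]
    exact (toAlg_const 0).trans (map_zero _)
  | insert i s his ih =>
    rw [Finset.sum_insert his, ← ih, ← toAlg_add, toAlg_eq_iff]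
    exact fun z _ => Finset.sum_insert his

/-- Operators on functions that induce linear operators on smooth functions on the phase space. -/
structure IsSmoothOp (D : Fn n → Fn n) : Prop where
  smooth : ∀ {f : Fn n}, SmoothFn f → SmoothFn (D f)
  eqOn : ∀ {f g : Fn n}, Set.EqOn f g (phase n) → Set.EqOn (D f) (D g) (phase n)
  add : ∀ {f g : Fn n}, SmoothFn f → SmoothFn g → ∀ z ∈ phase n,
    D (fun w => f w + g w) z = D f z + D g z
  const_mul : ∀ (c : ℂ) {f : Fn n}, SmoothFn f → ∀ z ∈ phase n,
    D (fun w => c * f w) z = c * D f z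

/-- The linear operator on the algebra of smooth functions induced by an operator on functions. -/
noncomputable def IsSmoothOp.lift {D : Fn n → Fn n} (hD : IsSmoothOp D) :
    SmoothAlg n →ₗ[ℂ] SmoothAlg n where
  toFun a := toAlg (D (repr a)) (hD.smooth (smoothFn_repr a))
  map_add' a b := by
    rw [← toAlg_add (hD.smooth (smoothFn_repr a)) (hD.smooth (smoothFn_repr b)), toAlg_eq_iff]
    intro z hz
    beta_reduce
    rw [← hD.add (smoothFn_repr a) (smoothFn_repr b) z hz]
    refine hD.eqOn ?_ hz
    rw [← toAlg_eq_iff (smoothFn_repr _) ((smoothFn_repr a).add (smoothFn_repr b)), toAlg_add (smoothFn_repr a) (smoothFn_repr b)]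
    simp only [toAlg_repr]
  map_smul' c a := by
    rw [RingHom.id_apply, ← toAlg_const_mul c (hD.smooth (smoothFn_repr a)), toAlg_eq_iff]
    intro z hz
    beta_reduce
    rw [← hD.const_mul c (smoothFn_repr a) z hz]
    refine hD.eqOn ?_ hz
    rw [← toAlg_eq_iff (smoothFn_repr _) ((smoothFn_const c).mul (smoothFn_repr a)),
      toAlg_const_mul c (smoothFn_repr a)]
    simp only [toAlg_repr]

theorem IsSmoothOp.lift_toAlg {D : Fn n → Fn n} (hD : IsSmoothOp D) {f : Fn n}
    (hf : SmoothFn f) : hD.lift (toAlg f hf) = toAlg (D f) (hD.smooth hf) :=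
  (toAlg_eq_iff (hD.smooth (smoothFn_repr _)) _).2 (hD.eqOn ((toAlg_eq_iff (smoothFn_repr _) hf).1 (toAlg_repr _)))

theorem isSmoothOp_dz (i : Fin (n + 1)) : IsSmoothOp (dz (n := n) i) where
  smooth hf := hf.smooth_dz i
  eqOn h := dz_eqOn (isOpen_phase n) h i
  add hf hg _ hz := dz_add (hf.differentiableAt hz) (hg.differentiableAt hz) i
  const_mul c f hf z hz := by
    rw [dz_mul (differentiableAt_const c) (hf.differentiableAt hz), dz_const]; simp

theorem isSmoothOp_dzbar (i : Fin (n + 1)) : IsSmoothOp (dzbar (n := n) i) where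
  smooth hf := hf.smooth_dzbar i
  eqOn h := dzbar_eqOn (isOpen_phase n) h i
  add hf hg _ hz := dzbar_add (hf.differentiableAt hz) (hg.differentiableAt hz) i
  const_mul c f hf z hz := by
    rw [dzbar_mul (differentiableAt_const c) (hf.differentiableAt hz), dzbar_const]; simp

theorem isSmoothOp_euler : IsSmoothOp (euler (n := n)) where
  smooth hf := hf.smooth_euler
  eqOn h := euler_eqOn h
  add hf hg z hz := by
    simp only [euler, (isSmoothOp_dz _).add hf hg z hz, mul_add, Finset.sum_add_distrib]
  const_mul c f hf z hz := by
    simp only [euler, (isSmoothOp_dz _).const_mul c hf z hz, Finset.mul_sum, mul_left_comm]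

theorem isSmoothOp_eulerBar : IsSmoothOp (eulerBar (n := n)) where
  smooth hf := hf.smooth_eulerBar
  eqOn h := eulerBar_eqOn h
  add hf hg z hz := by
    simp only [eulerBar, (isSmoothOp_dzbar _).add hf hg z hz, mul_add, Finset.sum_add_distrib]
  const_mul c f hf z hz := by
    simp only [eulerBar, (isSmoothOp_dzbar _).const_mul c hf z hz, Finset.mul_sum,
      mul_left_comm]

theorem isSmoothOp_prol {μ : ℝ} (hμ : μ < 0) : IsSmoothOp (prol (n := n) μ) where
  smooth hf := hf.smooth_prol hμ
  eqOn h := prol_eqOn hμ h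
  add _ _ _ _ := rfl
  const_mul _ _ _ _ _ := rfl

theorem isSmoothOp_compJ {μ : ℝ} (hμ : μ < 0) : IsSmoothOp (compJ (n := n) μ) where
  smooth hf := hf.smooth_compJ hμ
  eqOn h := compJ_eqOn hμ h
  add hf hg z hz := by
    simp only [compJ, prol, isSmoothOp_euler.add hf hg z hz, isSmoothOp_eulerBar.add hf hg z hz]
    split_ifs <;> ring
  const_mul c f hf z hz := by
    simp only [compJ, prol, isSmoothOp_euler.const_mul c hf z hz,
      isSmoothOp_eulerBar.const_mul c hf z hz]
    split_ifs <;> ring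

theorem isSmoothOp_opK (κ : ℝ) {μ : ℝ} (hμ : μ < 0) : IsSmoothOp (opK (n := n) κ μ) where
  smooth hf := (smoothFn_const _).mul (hf.smooth_compJ hμ).smooth_euler
  eqOn h z hz := by
    simp only [opK, isSmoothOp_euler.eqOn ((isSmoothOp_compJ hμ).eqOn h) hz]
  add hf hg z hz := by
    have h : Set.EqOn (compJ μ _) _ (phase n) := fun z hz => (isSmoothOp_compJ hμ).add hf hg z hz
    simp only [opK, isSmoothOp_euler.eqOn h hz,
      isSmoothOp_euler.add (hf.smooth_compJ hμ) (hg.smooth_compJ hμ) z hz, mul_add]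
  const_mul c f hf z hz := by
    have h : Set.EqOn (compJ μ _) _ (phase n) :=
      fun z hz => (isSmoothOp_compJ hμ).const_mul c hf z hz
    simp only [opK, isSmoothOp_euler.eqOn h hz,
      isSmoothOp_euler.const_mul c (hf.smooth_compJ hμ) z hz, mul_left_comm]

theorem isSmoothOp_comp_smul {c : ℂ} (hc : c ≠ 0) :
    IsSmoothOp (fun (f : Fn n) z => f (c • z)) where
  smooth hf := hf.comp_smul hc
  eqOn h _ hz := h (smul_mem_phase hc hz)
  add _ _ _ _ := rfl
  const_mul _ _ _ _ _ := rfl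

/-- `∂/∂zⁱ` as a derivation. -/
noncomputable def dzDer (i : Fin (n + 1)) : Derivation ℂ (SmoothAlg n) (SmoothAlg n) :=
  Derivation.mk' (isSmoothOp_dz i).lift fun a b => by
    obtain ⟨f, hf, rfl⟩ := exists_toAlg_eq a
    obtain ⟨g, hg, rfl⟩ := exists_toAlg_eq b
    rw [← toAlg_mul]
    simp only [IsSmoothOp.lift_toAlg, smul_eq_mul]
    rw [← toAlg_mul, ← toAlg_mul, ← toAlg_add, toAlg_eq_iff]
    intro z hz
    rw [dz_mul (hf.differentiableAt hz) (hg.differentiableAt hz)]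
    ring

/-- `∂/∂z̄ⁱ` as a derivation. -/
noncomputable def dzbarDer (i : Fin (n + 1)) : Derivation ℂ (SmoothAlg n) (SmoothAlg n) :=
  Derivation.mk' (isSmoothOp_dzbar i).lift fun a b => by
    obtain ⟨f, hf, rfl⟩ := exists_toAlg_eq a
    obtain ⟨g, hg, rfl⟩ := exists_toAlg_eq b
    rw [← toAlg_mul]
    simp only [IsSmoothOp.lift_toAlg, smul_eq_mul]
    rw [← toAlg_mul, ← toAlg_mul, ← toAlg_add, toAlg_eq_iff]
    intro z hz
    rw [dzbar_mul (hf.differentiableAt hz) (hg.differentiableAt hz)]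
    ring

theorem dzDer_toAlg (i : Fin (n + 1)) {f : Fn n} (hf : SmoothFn f) :
    dzDer i (toAlg f hf) = toAlg (dz i f) (hf.smooth_dz i) := (isSmoothOp_dz i).lift_toAlg hf

theorem dzbarDer_toAlg (i : Fin (n + 1)) {f : Fn n} (hf : SmoothFn f) :
    dzbarDer i (toAlg f hf) = toAlg (dzbar i f) (hf.smooth_dzbar i) :=
  (isSmoothOp_dzbar i).lift_toAlg hf

theorem dzDer_dzDer_comm (i j : Fin (n + 1)) (a : SmoothAlg n) :
    dzDer i (dzDer j a) = dzDer j (dzDer i a) := by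
  obtain ⟨f, hf, rfl⟩ := exists_toAlg_eq a
  simp only [dzDer_toAlg, toAlg_eq_iff]
  exact fun z hz => dz_dz_comm hf hz i j

theorem dzbarDer_dzbarDer_comm (i j : Fin (n + 1)) (a : SmoothAlg n) :
    dzbarDer i (dzbarDer j a) = dzbarDer j (dzbarDer i a) := by
  obtain ⟨f, hf, rfl⟩ := exists_toAlg_eq a
  simp only [dzbarDer_toAlg, toAlg_eq_iff]
  exact fun z hz => dzbar_dzbar_comm hf hz i j

theorem dzDer_dzbarDer_comm (i j : Fin (n + 1)) (a : SmoothAlg n) :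
    dzDer i (dzbarDer j a) = dzbarDer j (dzDer i a) := by
  obtain ⟨f, hf, rfl⟩ := exists_toAlg_eq a
  simp only [dzbarDer_toAlg, dzDer_toAlg, toAlg_eq_iff]
  exact fun z hz => dz_dzbar_comm hf hz i j

theorem euler_mul {f g : Fn n} {z : Coord n} (hf : DifferentiableAt ℝ f z)
    (hg : DifferentiableAt ℝ g z) :
    euler (fun w => f w * g w) z = euler f z * g z + f z * euler g z := by
  simp only [euler, dz_mul hf hg, Finset.sum_mul, Finset.mul_sum, ← Finset.sum_add_distrib]
  exact Finset.sum_congr rfl fun i _ => by ring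

theorem eulerBar_mul {f g : Fn n} {z : Coord n} (hf : DifferentiableAt ℝ f z)
    (hg : DifferentiableAt ℝ g z) :
    eulerBar (fun w => f w * g w) z = eulerBar f z * g z + f z * eulerBar g z := by
  simp only [eulerBar, dzbar_mul hf hg, Finset.sum_mul, Finset.mul_sum,
    ← Finset.sum_add_distrib]
  exact Finset.sum_congr rfl fun i _ => by ring

/-- The Euler operator as a derivation. -/
noncomputable def eulerDer (n : ℕ) : Derivation ℂ (SmoothAlg n) (SmoothAlg n) :=
  Derivation.mk' isSmoothOp_euler.lift fun a b => by
    obtain ⟨f, hf, rfl⟩ := exists_toAlg_eq a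
    obtain ⟨g, hg, rfl⟩ := exists_toAlg_eq b
    rw [← toAlg_mul]
    simp only [IsSmoothOp.lift_toAlg, smul_eq_mul]
    rw [← toAlg_mul, ← toAlg_mul, ← toAlg_add, toAlg_eq_iff]
    intro z hz
    rw [euler_mul (hf.differentiableAt hz) (hg.differentiableAt hz)]
    ring

/-- The conjugate Euler operator as a derivation. -/
noncomputable def eulerBarDer (n : ℕ) : Derivation ℂ (SmoothAlg n) (SmoothAlg n) :=
  Derivation.mk' isSmoothOp_eulerBar.lift fun a b => by
    obtain ⟨f, hf, rfl⟩ := exists_toAlg_eq a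
    obtain ⟨g, hg, rfl⟩ := exists_toAlg_eq b
    rw [← toAlg_mul]
    simp only [IsSmoothOp.lift_toAlg, smul_eq_mul]
    rw [← toAlg_mul, ← toAlg_mul, ← toAlg_add, toAlg_eq_iff]
    intro z hz
    rw [eulerBar_mul (hf.differentiableAt hz) (hg.differentiableAt hz)]
    ring

theorem eulerDer_toAlg {f : Fn n} (hf : SmoothFn f) :
    eulerDer n (toAlg f hf) = toAlg (euler f) hf.smooth_euler := isSmoothOp_euler.lift_toAlg hf

theorem eulerBarDer_toAlg {f : Fn n} (hf : SmoothFn f) :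
    eulerBarDer n (toAlg f hf) = toAlg (eulerBar f) hf.smooth_eulerBar :=
  isSmoothOp_eulerBar.lift_toAlg hf

/-- The constraint function as an element of the algebra of smooth functions. -/
noncomputable def JA (n : ℕ) (μ : ℝ) : SmoothAlg n := toAlg (J μ) (smoothFn_J μ)

/-- `z z̄` as an element of the algebra of smooth functions. -/
def zzA (n : ℕ) : SmoothAlg n := toAlg _ smoothFn_zz

/-- Scaling `f ↦ f (c •)` on the algebra of smooth functions. -/
noncomputable def scaleA {c : ℂ} (hc : c ≠ 0) : SmoothAlg n →ₗ[ℂ] SmoothAlg n :=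
  (isSmoothOp_comp_smul hc).lift

theorem scaleA_toAlg {c : ℂ} (hc : c ≠ 0) {f : Fn n} (hf : SmoothFn f) :
    scaleA hc (toAlg f hf) = toAlg (fun z => f (c • z)) (hf.comp_smul hc) :=
  (isSmoothOp_comp_smul hc).lift_toAlg hf

theorem scaleA_mul {c : ℂ} (hc : c ≠ 0) (a b : SmoothAlg n) :
    scaleA hc (a * b) = scaleA hc a * scaleA hc b := by
  obtain ⟨f, hf, rfl⟩ := exists_toAlg_eq a
  obtain ⟨g, hg, rfl⟩ := exists_toAlg_eq b
  rw [← toAlg_mul, scaleA_toAlg, scaleA_toAlg, scaleA_toAlg]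
  rfl

theorem dzDer_scaleA {c : ℂ} (hc : c ≠ 0) (i : Fin (n + 1)) (a : SmoothAlg n) :
    dzDer i (scaleA hc a) = c • scaleA hc (dzDer i a) := by
  obtain ⟨f, hf, rfl⟩ := exists_toAlg_eq a
  rw [dzDer_toAlg, scaleA_toAlg, scaleA_toAlg, dzDer_toAlg, ← toAlg_const_mul, toAlg_eq_iff]
  exact fun z hz => dz_comp_smul (hf.differentiableAt (smul_mem_phase hc hz)) i

theorem dzbarDer_scaleA {c : ℂ} (hc : c ≠ 0) (i : Fin (n + 1)) (a : SmoothAlg n) :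
    dzbarDer i (scaleA hc a) = (starRingEnd ℂ) c • scaleA hc (dzbarDer i a) := by
  obtain ⟨f, hf, rfl⟩ := exists_toAlg_eq a
  rw [dzbarDer_toAlg, scaleA_toAlg, scaleA_toAlg, dzbarDer_toAlg, ← toAlg_const_mul,
    toAlg_eq_iff]
  exact fun z hz => dzbar_comp_smul (hf.differentiableAt (smul_mem_phase hc hz)) i

theorem eulerDer_scaleA {c : ℂ} (hc : c ≠ 0) (a : SmoothAlg n) :
    eulerDer n (scaleA hc a) = scaleA hc (eulerDer n a) := by
  obtain ⟨f, hf, rfl⟩ := exists_toAlg_eq a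
  rw [eulerDer_toAlg, scaleA_toAlg, scaleA_toAlg, eulerDer_toAlg, toAlg_eq_iff]
  exact fun z hz => euler_comp_smul (hf.differentiableAt (smul_mem_phase hc hz))

theorem eulerBarDer_scaleA {c : ℂ} (hc : c ≠ 0) (a : SmoothAlg n) :
    eulerBarDer n (scaleA hc a) = scaleA hc (eulerBarDer n a) := by
  obtain ⟨f, hf, rfl⟩ := exists_toAlg_eq a
  rw [eulerBarDer_toAlg, scaleA_toAlg, scaleA_toAlg, eulerBarDer_toAlg, toAlg_eq_iff]
  exact fun z hz => eulerBar_comp_smul (hf.differentiableAt (smul_mem_phase hc hz))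

/-! ### Iterated derivatives and the Wick product -/

theorem SmoothFn.smooth_dzIter {f : Fn n} (hf : SmoothFn f) (r : ℕ) (i : Fin r → Fin (n + 1)) :
    SmoothFn (dzIter r i f) := by
  induction r with
  | zero => exact hf
  | succ r ih => exact (ih _).smooth_dz _

theorem SmoothFn.smooth_dzbarIter {f : Fn n} (hf : SmoothFn f) (r : ℕ)
    (i : Fin r → Fin (n + 1)) : SmoothFn (dzbarIter r i f) := by
  induction r with
  | zero => exact hf
  | succ r ih => exact (ih _).smooth_dzbar _

theorem dzIter_eqOn {U : Set (Coord n)} (hU : IsOpen U) {f g : Fn n} (h : Set.EqOn f g U)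
    (r : ℕ) (i : Fin r → Fin (n + 1)) : Set.EqOn (dzIter r i f) (dzIter r i g) U := by
  induction r with
  | zero => exact h
  | succ r ih => exact dz_eqOn hU (ih _) _

theorem dzbarIter_eqOn {U : Set (Coord n)} (hU : IsOpen U) {f g : Fn n} (h : Set.EqOn f g U)
    (r : ℕ) (i : Fin r → Fin (n + 1)) : Set.EqOn (dzbarIter r i f) (dzbarIter r i g) U := by
  induction r with
  | zero => exact h
  | succ r ih => exact dzbar_eqOn hU (ih _) _

theorem contraction_eqOn {U : Set (Coord n)} (hU : IsOpen U) {f f' g g' : Fn n}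
    (hf : Set.EqOn f f' U) (hg : Set.EqOn g g' U) (r : ℕ) :
    Set.EqOn (contraction r f g) (contraction r f' g') U := fun z hz => by
  simp only [contraction, dzIter_eqOn hU hf r _ hz, dzbarIter_eqOn hU hg r _ hz]

theorem wickM_eqOn (κ : ℝ) {U : Set (Coord n)} (hU : IsOpen U) {f f' g g' : Fn n}
    (hf : Set.EqOn f f' U) (hg : Set.EqOn g g' U) (r : ℕ) :
    Set.EqOn (wickM κ r f g) (wickM κ r f' g') U := fun z hz => by
  simp only [wickM, contraction_eqOn hU hf hg r hz]

/-- Iterated derivatives add the new one on the outside, iterated contractions on the inside.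
Symmetry of second derivatives reconciles the two. -/
theorem dzIter_dz_eqOn {f : Fn n} (hf : SmoothFn f) (j : Fin (n + 1)) (r : ℕ)
    (i : Fin r → Fin (n + 1)) :
    Set.EqOn (dzIter r i (dz j f)) (dz j (dzIter r i f)) (phase n) := by
  induction r with
  | zero => exact fun z _ => rfl
  | succ r ih =>
    intro z hz
    rw [dzIter, dz_eqOn (isOpen_phase n) (ih _) _ hz, dz_dz_comm (hf.smooth_dzIter _ _) hz]
    rfl

theorem dzbarIter_dzbar_eqOn {f : Fn n} (hf : SmoothFn f) (j : Fin (n + 1)) (r : ℕ)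
    (i : Fin r → Fin (n + 1)) :
    Set.EqOn (dzbarIter r i (dzbar j f)) (dzbar j (dzbarIter r i f)) (phase n) := by
  induction r with
  | zero => exact fun z _ => rfl
  | succ r ih =>
    intro z hz
    rw [dzbarIter, dzbar_eqOn (isOpen_phase n) (ih _) _ hz,
      dzbar_dzbar_comm (hf.smooth_dzbarIter _ _) hz]
    rfl

theorem contraction_succ {f g : Fn n} (hf : SmoothFn f) (hg : SmoothFn g) (r : ℕ) {z : Coord n}
    (hz : z ∈ phase n) :
    contraction (r + 1) f g z = ∑ j, contraction r (dz j f) (dzbar j g) z := by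
  simp only [contraction]
  rw [← (Fin.consEquiv (fun _ => Fin (n + 1))).sum_comp, Fintype.sum_prod_type]
  refine Finset.sum_congr rfl fun j _ => Finset.sum_congr rfl fun i _ => ?_
  rw [dzIter_dz_eqOn hf j r i hz, dzbarIter_dzbar_eqOn hg j r i hz]
  rfl

theorem SmoothFn.smooth_contraction {f g : Fn n} (hf : SmoothFn f) (hg : SmoothFn g) (r : ℕ) :
    SmoothFn (contraction r f g) :=
  SmoothFn.sum fun i _ => (hf.smooth_dzIter r i).mul (hg.smooth_dzbarIter r i)

theorem SmoothFn.smooth_wickM (κ : ℝ) {f g : Fn n} (hf : SmoothFn f) (hg : SmoothFn g) (r : ℕ) :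
    SmoothFn (wickM κ r f g) := (smoothFn_const _).mul (hf.smooth_contraction hg r)

theorem toAlg_contraction {f g : Fn n} (hf : SmoothFn f) (hg : SmoothFn g) (r : ℕ) :
    toAlg (contraction r f g) (hf.smooth_contraction hg r) =
      iterContr dzDer dzbarDer r (toAlg f hf) (toAlg g hg) := by
  induction r generalizing f g with
  | zero =>
    rw [iterContr_zero, ← toAlg_mul, toAlg_eq_iff, contraction_zero]
    exact fun _ _ => rfl
  | succ r ih =>
    simp only [iterContr_succ, dzDer_toAlg, dzbarDer_toAlg, ← ih]
    rw [← toAlg_sum, toAlg_eq_iff]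
    exact fun z hz => contraction_succ hf hg r hz

/-- The bidifferential operators of the Wick product on the algebra of smooth functions. -/
noncomputable def wickMA (n : ℕ) (κ : ℝ) (r : ℕ) :
    SmoothAlg n →ₗ[ℂ] SmoothAlg n →ₗ[ℂ] SmoothAlg n := expContr dzDer dzbarDer (κ : ℂ) r

theorem toAlg_wickM (κ : ℝ) {f g : Fn n} (hf : SmoothFn f) (hg : SmoothFn g) (r : ℕ) :
    toAlg (wickM κ r f g) (hf.smooth_wickM κ hg r) =
      wickMA n κ r (toAlg f hf) (toAlg g hg) := by
  rw [wickMA, expContr, LinearMap.smul_apply, LinearMap.smul_apply, ← toAlg_contraction,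
    ← toAlg_const_mul]
  rfl

/-- The series in the algebra of smooth functions given by a smooth series. -/
def toSer (f : Series n) (hf : f ∈ smoothSeries n) : ℕ → SmoothAlg n := fun m =>
  toAlg (f m) (hf m)

theorem toSer_eq_iff {f g : Series n} (hf : f ∈ smoothSeries n) (hg : g ∈ smoothSeries n) :
    toSer f hf = toSer g hg ↔ SEq f g := by
  rw [funext_iff]
  exact forall_congr' fun m => toAlg_eq_iff _ _

theorem exists_toSer_eq (a : ℕ → SmoothAlg n) :
    ∃ f : Series n, ∃ hf : f ∈ smoothSeries n, toSer f hf = a :=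
  ⟨fun m => repr (a m), fun m => smoothFn_repr (a m), funext fun m => toAlg_repr (a m)⟩

theorem ext₂_mem {D : ℕ → Fn n → Fn n → Fn n}
    (hD : ∀ r {f g : Fn n}, SmoothFn f → SmoothFn g → SmoothFn (D r f g)) {f g : Series n}
    (hf : f ∈ smoothSeries n) (hg : g ∈ smoothSeries n) : ext₂ D f g ∈ smoothSeries n :=
  fun _ => SmoothFn.sum fun _ _ => SmoothFn.sum fun _ _ => hD _ (hf _) (hg _)

theorem wick_mem (κ : ℝ) {f g : Series n} (hf : f ∈ smoothSeries n) (hg : g ∈ smoothSeries n) :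
    wick κ f g ∈ smoothSeries n := ext₂_mem (fun r _ _ hf hg => hf.smooth_wickM κ hg r) hf hg

/-- The Wick product of series in the algebra of smooth functions. -/
noncomputable def wickA (n : ℕ) (κ : ℝ) (f g : ℕ → SmoothAlg n) : ℕ → SmoothAlg n :=
  seriesMul (wickMA n κ) f g

theorem toSer_ext₂ {D : ℕ → Fn n → Fn n → Fn n}
    (hD : ∀ r {f g : Fn n}, SmoothFn f → SmoothFn g → SmoothFn (D r f g))
    {M : ℕ → SmoothAlg n →ₗ[ℂ] SmoothAlg n →ₗ[ℂ] SmoothAlg n}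
    {f g : Series n} (hf : f ∈ smoothSeries n) (hg : g ∈ smoothSeries n)
    (hM : ∀ r i j, toAlg (D r (f i) (g j)) (hD r (hf i) (hg j)) =
      M r (toAlg (f i) (hf i)) (toAlg (g j) (hg j))) :
    toSer (ext₂ D f g) (ext₂_mem hD hf hg) = seriesMul M (toSer f hf) (toSer g hg) := by
  ext1 m
  simp only [seriesMul, toSer, ← hM]
  refine (toAlg_sum (Finset.HasAntidiagonal.antidiagonal m) fun p => SmoothFn.sum fun q _ =>
    hD _ (hf _) (hg _)).trans ?_
  exact Finset.sum_congr rfl fun p _ =>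
    toAlg_sum (Finset.HasAntidiagonal.antidiagonal p.2) fun q => hD _ (hf _) (hg _)

theorem toSer_wick (κ : ℝ) {f g : Series n} (hf : f ∈ smoothSeries n)
    (hg : g ∈ smoothSeries n) :
    toSer (wick κ f g) (wick_mem κ hf hg) = wickA n κ (toSer f hf) (toSer g hg) := by
  have hM : ∀ r i j, toAlg (wickM κ r (f i) (g j)) ((hf i).smooth_wickM κ (hg j) r) =
      wickMA n κ r (toAlg (f i) (hf i)) (toAlg (g j) (hg j)) :=
    fun r i j => toAlg_wickM κ (hf i) (hg j) r
  exact toSer_ext₂ (fun r _ _ hf hg => hf.smooth_wickM κ hg r) hf hg hM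

theorem wickA_assoc (κ : ℝ) (f g h : ℕ → SmoothAlg n) :
    wickA n κ (wickA n κ f g) h = wickA n κ f (wickA n κ g h) :=
  seriesMul_assoc (wickMA n κ) (fun m f g h => expContr_assoc dzDer dzbarDer dzDer_dzDer_comm
    dzbarDer_dzbarDer_comm dzDer_dzbarDer_comm κ m f g h) f g h

end SmoothAlgebra

/-! ### Division with remainder by `J` and the reduced product. -/

section Reduction

open Finset

variable {n : ℕ}

/-! ### Prolongation, component along `J`, and the operator `K` on the algebra -/

/-- Prolongation on the algebra of smooth functions. -/
noncomputable def prolA {μ : ℝ} (hμ : μ < 0) : SmoothAlg n →ₗ[ℂ] SmoothAlg n :=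
  (isSmoothOp_prol hμ).lift

/-- Component along `J` on the algebra of smooth functions. -/
noncomputable def compJA {μ : ℝ} (hμ : μ < 0) : SmoothAlg n →ₗ[ℂ] SmoothAlg n :=
  (isSmoothOp_compJ hμ).lift

/-- The operator `K` on the algebra of smooth functions. -/
noncomputable def opKA (κ : ℝ) {μ : ℝ} (hμ : μ < 0) : SmoothAlg n →ₗ[ℂ] SmoothAlg n :=
  (isSmoothOp_opK κ hμ).lift

variable {κ μ : ℝ} (hμ : μ < 0)

theorem prolA_toAlg {f : Fn n} (hf : SmoothFn f) :
    prolA hμ (toAlg f hf) = toAlg (prol μ f) (hf.smooth_prol hμ) :=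
  (isSmoothOp_prol hμ).lift_toAlg hf

theorem compJA_toAlg {f : Fn n} (hf : SmoothFn f) :
    compJA hμ (toAlg f hf) = toAlg (compJ μ f) (hf.smooth_compJ hμ) :=
  (isSmoothOp_compJ hμ).lift_toAlg hf

theorem opKA_toAlg {f : Fn n} (hf : SmoothFn f) :
    opKA κ hμ (toAlg f hf) = toAlg (opK κ μ f) ((isSmoothOp_opK κ hμ).smooth hf) :=
  (isSmoothOp_opK κ hμ).lift_toAlg hf

theorem opKA_apply (a : SmoothAlg n) :
    opKA κ hμ a = ((κ : ℂ) / 2) • eulerDer n (compJA hμ a) := by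
  obtain ⟨f, hf, rfl⟩ := exists_toAlg_eq a
  rw [opKA_toAlg, compJA_toAlg, eulerDer_toAlg, ← toAlg_const_mul]
  rfl

theorem prolA_mul (a b : SmoothAlg n) : prolA hμ (a * b) = prolA hμ a * prolA hμ b := by
  obtain ⟨f, hf, rfl⟩ := exists_toAlg_eq a
  obtain ⟨g, hg, rfl⟩ := exists_toAlg_eq b
  rw [← toAlg_mul, prolA_toAlg, prolA_toAlg, prolA_toAlg]
  rfl

theorem prolA_prolA (a : SmoothAlg n) : prolA hμ (prolA hμ a) = prolA hμ a := by
  obtain ⟨f, hf, rfl⟩ := exists_toAlg_eq a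
  rw [prolA_toAlg, prolA_toAlg, toAlg_eq_iff]
  exact fun z hz => prol_prol hμ f hz

theorem prolA_JA : prolA hμ (JA n μ) = 0 := by
  rw [JA, prolA_toAlg, ← map_zero (algebraMap ℂ (SmoothAlg n)), ← toAlg_const, toAlg_eq_iff]
  exact fun z hz => proj_mem_surface hμ hz

theorem eq_prolA_add_compJA_mul (a : SmoothAlg n) :
    a = prolA hμ a + compJA hμ a * JA n μ := by
  obtain ⟨f, hf, rfl⟩ := exists_toAlg_eq a
  rw [prolA_toAlg, compJA_toAlg, JA, ← toAlg_mul, ← toAlg_add, toAlg_eq_iff]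
  exact fun z _ => eq_prol_add_compJ_mul_J hμ f z

theorem eq_zero_of_mul_JA_eq_zero (hμ : μ < 0) {a : SmoothAlg n} (h : a * JA n μ = 0) : a = 0 := by
  obtain ⟨f, hf, rfl⟩ := exists_toAlg_eq a
  rw [JA, ← toAlg_mul, ← map_zero (algebraMap ℂ (SmoothAlg n)), ← toAlg_const,
    toAlg_eq_iff] at h
  rw [← map_zero (algebraMap ℂ (SmoothAlg n)), ← toAlg_const, toAlg_eq_iff]
  exact eqOn_zero_of_mul_J_eq_zero hμ hf fun z hz => h hz

/-- Prolongation kills multiples of `J`, which isolates `p`; afterwards `J` can be cancelled because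
it is nonzero on a dense set. -/
theorem eq_zero_of_add_mul_JA_eq_zero {p a : SmoothAlg n} (hp : prolA hμ p = p)
    (h : p + a * JA n μ = 0) : p = 0 ∧ a = 0 := by
  have h1 := congrArg (prolA hμ) h
  rw [map_add, prolA_mul, prolA_JA, mul_zero, add_zero, hp, map_zero] at h1
  rw [h1, zero_add] at h
  exact ⟨h1, eq_zero_of_mul_JA_eq_zero hμ h⟩

/-- Allows `π_J` to be computed by exhibiting a decomposition, without returning to its definition
by cases. -/
theorem prolA_compJA_unique {a p b : SmoothAlg n} (hp : prolA hμ p = p)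
    (h : a = p + b * JA n μ) : prolA hμ a = p ∧ compJA hμ a = b := by
  have h1 : prolA hμ (prolA hμ a - p) = prolA hμ a - p := by rw [map_sub, prolA_prolA, hp]
  have h2 := eq_zero_of_add_mul_JA_eq_zero hμ (a := compJA hμ a - b) h1 (by
    linear_combination h - eq_prolA_add_compJA_mul hμ a)
  exact ⟨sub_eq_zero.1 h2.1, sub_eq_zero.1 h2.2⟩

/-! ### The Wick product with `J` -/

/-- The constraint function as a series. -/
noncomputable def JS (n : ℕ) (μ : ℝ) : ℕ → SmoothAlg n := Pi.single 0 (JA n μ)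

theorem seriesMul_single_right {A : Type*} [CommRing A] [Algebra ℂ A]
    (M : ℕ → A →ₗ[ℂ] A →ₗ[ℂ] A) (f : ℕ → A) (a : A) (m : ℕ) :
    seriesMul M f (Pi.single 0 a) m = ∑ p ∈ antidiagonal m, M p.1 (f p.2) a := by
  refine sum_congr rfl fun p _ => ?_
  rw [sum_eq_single (p.2, 0)]
  · simp
  · rintro ⟨i, j⟩ hq hne
    have hj : j ≠ 0 := by
      rintro rfl
      exact hne (by rw [HasAntidiagonal.mem_antidiagonal] at hq; simpa using hq)
    simp [Pi.single_eq_of_ne hj]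
  · simp [HasAntidiagonal.mem_antidiagonal]

theorem seriesMul_single_left {A : Type*} [CommRing A] [Algebra ℂ A]
    (M : ℕ → A →ₗ[ℂ] A →ₗ[ℂ] A) (f : ℕ → A) (a : A) (m : ℕ) :
    seriesMul M (Pi.single 0 a) f m = ∑ p ∈ antidiagonal m, M p.1 a (f p.2) := by
  refine sum_congr rfl fun p _ => ?_
  rw [sum_eq_single (0, p.2)]
  · simp
  · rintro ⟨i, j⟩ hq hne
    have hj : i ≠ 0 := by
      rintro rfl
      exact hne (by rw [HasAntidiagonal.mem_antidiagonal] at hq; simpa using hq)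
    simp [Pi.single_eq_of_ne hj]
  · simp [HasAntidiagonal.mem_antidiagonal]

theorem wickMA_zero (a b : SmoothAlg n) : wickMA n κ 0 a b = a * b := by
  simp [wickMA, expContr, iterContr_zero]

theorem toAlg_zero : toAlg (0 : Fn n) (smoothFn_const 0) = 0 := rfl

theorem wickMA_JA_right_eq_zero {r : ℕ} (hr : 2 ≤ r) (a : SmoothAlg n) :
    wickMA n κ r a (JA n μ) = 0 := by
  obtain ⟨f, hf, rfl⟩ := exists_toAlg_eq a
  rw [JA, ← toAlg_wickM, ← toAlg_zero, toAlg_eq_iff, wickM_J_right_eq_zero κ μ hr]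
  exact Set.eqOn_refl _ _

theorem wickMA_JA_left_eq_zero {r : ℕ} (hr : 2 ≤ r) (a : SmoothAlg n) :
    wickMA n κ r (JA n μ) a = 0 := by
  obtain ⟨f, hf, rfl⟩ := exists_toAlg_eq a
  rw [JA, ← toAlg_wickM, ← toAlg_zero, toAlg_eq_iff, wickM_J_left_eq_zero κ μ hr]
  exact Set.eqOn_refl _ _

theorem wickMA_one_JA_right (a : SmoothAlg n) :
    wickMA n κ 1 a (JA n μ) = -(((κ : ℂ) / 2) • eulerDer n a) := by
  obtain ⟨f, hf, rfl⟩ := exists_toAlg_eq a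
  rw [JA, ← toAlg_wickM, eulerDer_toAlg, ← neg_smul, ← toAlg_const_mul, toAlg_eq_iff,
    wickM_one_J_right]
  exact fun z _ => (neg_mul _ _).symm

theorem wickMA_one_JA_left (a : SmoothAlg n) :
    wickMA n κ 1 (JA n μ) a = -(((κ : ℂ) / 2) • eulerBarDer n a) := by
  obtain ⟨f, hf, rfl⟩ := exists_toAlg_eq a
  rw [JA, ← toAlg_wickM, eulerBarDer_toAlg, ← neg_smul, ← toAlg_const_mul, toAlg_eq_iff,
    wickM_one_J_left]
  exact fun z _ => (neg_mul _ _).symm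

theorem wickA_JS_zero (f : ℕ → SmoothAlg n) : wickA n κ f (JS n μ) 0 = f 0 * JA n μ := by
  rw [wickA, JS, seriesMul_single_right]
  simp [wickMA_zero]

/-- Of the whole convolution only `M₀` and `M₁` contribute. This makes division by `J` a two-term
recursion. -/
theorem wickA_JS_succ (f : ℕ → SmoothAlg n) (m : ℕ) :
    wickA n κ f (JS n μ) (m + 1) = f (m + 1) * JA n μ - ((κ : ℂ) / 2) • eulerDer n (f m) := by
  rw [wickA, JS, seriesMul_single_right, Nat.sum_antidiagonal_succ, wickMA_zero, sub_eq_add_neg,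
    ← wickMA_one_JA_right (μ := μ)]
  congr 1
  cases m with
  | zero => simp
  | succ m =>
    rw [Nat.sum_antidiagonal_succ, sum_eq_zero, add_zero]
    exact fun p _ => wickMA_JA_right_eq_zero (by omega) _

theorem JS_wickA_zero (f : ℕ → SmoothAlg n) : wickA n κ (JS n μ) f 0 = f 0 * JA n μ := by
  rw [wickA, JS, seriesMul_single_left]
  simp [wickMA_zero, mul_comm]

theorem JS_wickA_succ (f : ℕ → SmoothAlg n) (m : ℕ) :
    wickA n κ (JS n μ) f (m + 1) =
      f (m + 1) * JA n μ - ((κ : ℂ) / 2) • eulerBarDer n (f m) := by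
  rw [wickA, JS, seriesMul_single_left, Nat.sum_antidiagonal_succ, wickMA_zero, sub_eq_add_neg,
    ← wickMA_one_JA_left (μ := μ), mul_comm]
  congr 1
  cases m with
  | zero => simp
  | succ m =>
    rw [Nat.sum_antidiagonal_succ, sum_eq_zero, add_zero]
    exact fun p _ => wickMA_JA_left_eq_zero (by omega) _

theorem wickA_add_left (f f' g : ℕ → SmoothAlg n) :
    wickA n κ (f + f') g = wickA n κ f g + wickA n κ f' g := seriesMul_add_left _ _ _ _

theorem wickA_add_right (f g g' : ℕ → SmoothAlg n) :
    wickA n κ f (g + g') = wickA n κ f g + wickA n κ f g' := seriesMul_add_right _ _ _ _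

theorem wickA_sub_left (f f' g : ℕ → SmoothAlg n) :
    wickA n κ (f - f') g = wickA n κ f g - wickA n κ f' g := seriesMul_sub_left _ _ _ _

/-! ### Division with remainder by `J` for the Wick product -/

/-- The operator `T` on series in the algebra of smooth functions. -/
noncomputable def opTS (κ : ℝ) (f : ℕ → SmoothAlg n) : ℕ → SmoothAlg n :=
  seriesMap (fun r => opKA κ hμ ^ r) f

theorem opTS_zero (f : ℕ → SmoothAlg n) : opTS hμ κ f 0 = f 0 := by
  simp [opTS, seriesMap]

/-- The coefficients of `T f = f + λ K T f`, the form in which the geometric series is used from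
here on. -/
theorem opTS_succ (f : ℕ → SmoothAlg n) (m : ℕ) :
    opTS hμ κ f (m + 1) = f (m + 1) + opKA κ hμ (opTS hμ κ f m) := by
  simp only [opTS, seriesMap, Nat.sum_antidiagonal_succ, pow_zero, Module.End.one_apply, map_sum,
    pow_succ', Module.End.mul_apply]

/-- The remainder in the division by `J`. -/
noncomputable def remS (κ : ℝ) (f : ℕ → SmoothAlg n) : ℕ → SmoothAlg n :=
  fun m => prolA hμ (opTS hμ κ f m)

/-- The quotient in the division by `J`. -/
noncomputable def quotS (κ : ℝ) (f : ℕ → SmoothAlg n) : ℕ → SmoothAlg n :=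
  fun m => compJA hμ (opTS hμ κ f m)

/-- Classical division applied to each coefficient of `T f`. The surplus `K (T f)_m` is the
derivative term that the Wick product with `J` subtracts from the quotient. -/
theorem eq_remS_add (f : ℕ → SmoothAlg n) :
    f = remS hμ κ f + wickA n κ (quotS hμ κ f) (JS n μ) := by
  ext1 m
  have h := eq_prolA_add_compJA_mul hμ (opTS hμ κ f m)
  cases m with
  | zero =>
    rw [Pi.add_apply, wickA_JS_zero]
    exact (opTS_zero hμ f).symm.trans h
  | succ m =>
    rw [Pi.add_apply, wickA_JS_succ]
    conv_lhs at h => rw [opTS_succ, opKA_apply]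
    simp only [remS, quotS]
    linear_combination h

/-- Once `a m` is zero its derivative drops out of the next order, which becomes a classical
division problem with only the zero solution. -/
theorem eq_zero_of_add_wickA_JS_eq_zero {h a : ℕ → SmoothAlg n}
    (hh : ∀ m, prolA hμ (h m) = h m) (heq : h + wickA n κ a (JS n μ) = 0) :
    h = 0 ∧ a = 0 := by
  have key : ∀ m, h m = 0 ∧ a m = 0 := by
    intro m
    induction m with
    | zero =>
      have h0 := congrFun heq 0
      rw [Pi.add_apply, wickA_JS_zero] at h0
      exact eq_zero_of_add_mul_JA_eq_zero hμ (hh 0) h0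
    | succ m ih =>
      have h0 := congrFun heq (m + 1)
      rw [Pi.add_apply, wickA_JS_succ, ih.2, map_zero, smul_zero, sub_zero] at h0
      exact eq_zero_of_add_mul_JA_eq_zero hμ (hh _) h0
  exact ⟨funext fun m => (key m).1, funext fun m => (key m).2⟩

/-- Any decomposition with a prolongation as remainder is the division. This drives associativity,
the unit laws and uniqueness in the Marsden-Weinstein reduction. -/
theorem eq_remS_of_eq_add {f h a : ℕ → SmoothAlg n} (hh : ∀ m, prolA hμ (h m) = h m)
    (heq : f = h + wickA n κ a (JS n μ)) : h = remS hμ κ f := by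
  have h1 : ∀ m, prolA hμ ((h - remS hμ κ f) m) = (h - remS hμ κ f) m := fun m => by
    rw [Pi.sub_apply, map_sub, hh, remS, prolA_prolA]
  refine sub_eq_zero.1 (eq_zero_of_add_wickA_JS_eq_zero (κ := κ) hμ
    (a := a - quotS hμ κ f) h1 ?_).1
  rw [wickA_sub_left]
  linear_combination (eq_remS_add hμ (κ := κ) f) - heq

/-! ### Homogeneous and invariant functions -/

/-- Homogeneous elements of the algebra of smooth functions. -/
def IsHomog (a : SmoothAlg n) : Prop := ∀ c : ℂ, ∀ hc : c ≠ 0, scaleA hc a = a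

/-- `U(1)`-invariant elements of the algebra of smooth functions. -/
def IsInv (a : SmoothAlg n) : Prop := ∀ c : ℂ, ∀ hc : c ≠ 0, ‖c‖ = 1 → scaleA hc a = a

theorem fderiv_smul_eq_zero {f : Fn n} (hf : SmoothFn f) {z : Coord n} (hz : z ∈ phase n) {w : ℂ}
    (h : ∀ t : ℝ, f (Complex.exp (t * w) • z) = f z) :
    w * euler f z + (starRingEnd ℂ) w * eulerBar f z = 0 := by
  have hp : HasDerivAt (fun t : ℝ => Complex.exp (t * w)) w 0 := by
    have h1 : HasDerivAt (fun t : ℝ => (t : ℂ) * w) (1 * w) 0 :=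
      (Complex.ofRealCLM.hasDerivAt).mul_const w
    simpa using h1.cexp
  have h0 : Complex.exp ((0 : ℝ) * w) • z = z := by simp
  have hd := hasDerivAt_comp_path (f := f) (a := fun t : ℝ => Complex.exp (t * w)) (z := z)
    (by rw [h0]; exact hf.differentiableAt hz) hp
  simp only [h] at hd
  have := hd.unique (hasDerivAt_const 0 (f z))
  rwa [h0, fderiv_apply_smul] at this

theorem isHomog_toAlg {f : Fn n} (hf : SmoothFn f) :
    IsHomog (toAlg f hf) ↔ ∀ c : ℂ, c ≠ 0 → ∀ z ∈ phase n, f (c • z) = f z :=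
  forall₂_congr fun c hc => by rw [scaleA_toAlg, toAlg_eq_iff]; rfl

/-- Differentiating the invariance along `exp(t) z` gives `E + Ē = 0`, and along `exp(It) z` gives
`E - Ē = 0`. -/
theorem IsHomog.eulerDer_eq_zero {a : SmoothAlg n} (ha : IsHomog a) :
    eulerDer n a = 0 ∧ eulerBarDer n a = 0 := by
  obtain ⟨f, hf, rfl⟩ := exists_toAlg_eq a
  rw [isHomog_toAlg] at ha
  rw [eulerDer_toAlg, eulerBarDer_toAlg, ← toAlg_zero, toAlg_eq_iff, toAlg_eq_iff]
  have key : ∀ z ∈ phase n, euler f z = 0 ∧ eulerBar f z = 0 := fun z hz => by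
    have h1 := fderiv_smul_eq_zero (w := 1) hf hz fun t => ha _ (Complex.exp_ne_zero _) z hz
    have h2 := fderiv_smul_eq_zero (w := Complex.I) hf hz
      fun t => ha _ (Complex.exp_ne_zero _) z hz
    rw [map_one] at h1
    rw [Complex.conj_I] at h2
    constructor
    · linear_combination h1 / 2 - Complex.I / 2 * h2 +
        (euler f z / 2 - eulerBar f z / 2) * Complex.I_sq
    · linear_combination h1 / 2 + Complex.I / 2 * h2 +
        (-euler f z / 2 + eulerBar f z / 2) * Complex.I_sq
  exact ⟨fun z hz => (key z hz).1, fun z hz => (key z hz).2⟩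

/-- The projection forgets positive factors and is itself, at each point, a scaling by a positive
number. -/
theorem prolA_eq_self_iff {a : SmoothAlg n} :
    prolA hμ a = a ↔ ∀ c : ℝ, ∀ hc : (c : ℂ) ≠ 0, 0 < c → scaleA hc a = a := by
  obtain ⟨f, hf, rfl⟩ := exists_toAlg_eq a
  rw [prolA_toAlg, toAlg_eq_iff]
  constructor
  · intro h c hc hc0
    rw [scaleA_toAlg, toAlg_eq_iff]
    intro z hz
    beta_reduce
    rw [← h (smul_mem_phase hc hz), ← h hz, prol, prol, proj_smul μ hc, Complex.norm_real,
      Real.norm_of_nonneg hc0.le, div_self hc, one_smul]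
  · intro h z hz
    have hs := sqrt_ratio_pos hμ hz
    have := h _ (Complex.ofReal_ne_zero.2 hs.ne') hs
    rw [scaleA_toAlg, toAlg_eq_iff] at this
    exact this hz

theorem IsHomog.prolA_eq {a : SmoothAlg n} (ha : IsHomog a) : prolA hμ a = a :=
  (prolA_eq_self_iff hμ).2 fun _ hc _ => ha _ hc

theorem scaleA_scaleA {c d : ℂ} (hc : c ≠ 0) (hd : d ≠ 0) (a : SmoothAlg n) :
    scaleA hc (scaleA hd a) = scaleA (mul_ne_zero hd hc) a := by
  obtain ⟨f, hf, rfl⟩ := exists_toAlg_eq a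
  rw [scaleA_toAlg, scaleA_toAlg, scaleA_toAlg, toAlg_eq_iff]
  exact fun z _ => congrArg f (smul_smul d c z)

theorem scaleA_congr {c d : ℂ} (hc : c ≠ 0) (hd : d ≠ 0) (h : c = d) (a : SmoothAlg n) :
    scaleA hc a = scaleA hd a := by subst h; rfl

/-- Polar decomposition: `c` is a phase times its modulus. -/
theorem IsInv.isHomog {a : SmoothAlg n} (ha : IsInv a) (hp : prolA hμ a = a) : IsHomog a := by
  intro c hc
  have hn : (0 : ℝ) < ‖c‖ := norm_pos_iff.2 hc
  have hn' : ((‖c‖ : ℝ) : ℂ) ≠ 0 := Complex.ofReal_ne_zero.2 hn.ne'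
  have h1 : scaleA (div_ne_zero hc hn') a = a := ha _ _ (by simp [hn.ne'])
  have h2 := (prolA_eq_self_iff hμ).1 hp ‖c‖ hn' hn
  rw [← scaleA_congr (mul_ne_zero (div_ne_zero hc hn') hn') hc (div_mul_cancel₀ c hn'),
    ← scaleA_scaleA hn' (div_ne_zero hc hn'), h1, h2]

/-- A radially invariant function that Poisson commutes with `J` is homogeneous. -/
theorem isHomog_of_prolA_eq {a : SmoothAlg n} (hp : prolA hμ a = a)
    (h : eulerDer n a = eulerBarDer n a) : IsHomog a := by
  refine IsInv.isHomog hμ ?_ hp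
  obtain ⟨f, hf, rfl⟩ := exists_toAlg_eq a
  rw [eulerDer_toAlg, eulerBarDer_toAlg, toAlg_eq_iff] at h
  intro c hc hc1
  rw [scaleA_toAlg, toAlg_eq_iff]
  intro z hz
  -- The values `κ = 1` and `μ = 0` are arbitrary, since only the circle action matters. With `κ =
  -- 1` the flow rotates by `t/2`, hence the time `2 arg c` below.
  have hd : ∀ t : ℝ, HasDerivAt (fun s => f (flow 1 s z)) 0 t := fun t => by
    have := hasDerivAt_comp_flow 1 0 hf hz t
    rwa [poisson_J, h (flow_mem_phase 1 t hz), sub_self, mul_zero] at this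
  have hconst := is_const_of_deriv_eq_zero (fun t => (hd t).differentiableAt)
    (fun t => (hd t).deriv) (2 * Complex.arg c) 0
  rw [flow_zero] at hconst
  have hflow : flow 1 (2 * Complex.arg c) z = c • z := by
    rw [flow]
    congr 1
    conv_rhs => rw [← Complex.norm_mul_exp_arg_mul_I c, hc1]
    push_cast
    rw [one_mul]
    congr 1
    ring
  rwa [hflow] at hconst

/-- The Euler operators commute with scalings. So `E a - Ē a` is determined by its values on the
surface, and it can serve as a remainder. -/
theorem prolA_eulerDer_sub {a : SmoothAlg n} (hp : prolA hμ a = a) :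
    prolA hμ (eulerDer n a - eulerBarDer n a) = eulerDer n a - eulerBarDer n a := by
  rw [prolA_eq_self_iff] at hp ⊢
  intro c hc hc0
  rw [map_sub, ← eulerDer_scaleA, ← eulerBarDer_scaleA, hp c hc hc0]

theorem scaleA_JA {c : ℂ} (hc : c ≠ 0) (h1 : ‖c‖ = 1) : scaleA hc (JA n μ) = JA n μ := by
  rw [JA, scaleA_toAlg, toAlg_eq_iff]
  intro z _
  simp only [J, zz_smul, Complex.normSq_eq_norm_sq, h1, one_pow, one_mul]

theorem prolA_scaleA {c : ℂ} (hc : c ≠ 0) (h1 : ‖c‖ = 1) (a : SmoothAlg n) :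
    prolA hμ (scaleA hc a) = scaleA hc (prolA hμ a) := by
  obtain ⟨f, hf, rfl⟩ := exists_toAlg_eq a
  rw [scaleA_toAlg, prolA_toAlg, prolA_toAlg, scaleA_toAlg, toAlg_eq_iff]
  intro z _
  simp only [prol, proj_smul μ hc, h1, Complex.ofReal_one, div_one]

theorem compJA_scaleA {c : ℂ} (hc : c ≠ 0) (h1 : ‖c‖ = 1) (a : SmoothAlg n) :
    compJA hμ (scaleA hc a) = scaleA hc (compJA hμ a) := by
  refine (prolA_compJA_unique hμ (p := scaleA hc (prolA hμ a)) ?_ ?_).2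
  · rw [prolA_scaleA hμ hc h1, prolA_prolA]
  · conv_lhs => rw [eq_prolA_add_compJA_mul hμ a, map_add, scaleA_mul, scaleA_JA hc h1]

theorem IsInv.compJA {a : SmoothAlg n} (ha : IsInv a) : IsInv (compJA hμ a) := fun c hc h1 => by
  rw [← compJA_scaleA hμ hc h1, ha c hc h1]

theorem IsInv.prolA {a : SmoothAlg n} (ha : IsInv a) : IsInv (prolA hμ a) := fun c hc h1 => by
  rw [← prolA_scaleA hμ hc h1, ha c hc h1]

theorem IsInv.opKA {a : SmoothAlg n} (ha : IsInv a) : IsInv (opKA κ hμ a) := fun c hc h1 => by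
  rw [opKA_apply, map_smul, ← eulerDer_scaleA, ha.compJA hμ c hc h1]

theorem IsInv.add {a b : SmoothAlg n} (ha : IsInv a) (hb : IsInv b) : IsInv (a + b) :=
  fun c hc h1 => by rw [map_add, ha c hc h1, hb c hc h1]

theorem IsInv.opTS {f : ℕ → SmoothAlg n} (hf : ∀ m, IsInv (f m)) (m : ℕ) :
    IsInv (opTS hμ κ f m) := by
  induction m with
  | zero => rw [opTS_zero]; exact hf 0
  | succ m ih => rw [opTS_succ]; exact (hf _).add (ih.opKA hμ)

/-- Each contraction pairs a `∂` of weight `c` with a `∂̄` of weight `c̄`. -/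
theorem iterContr_scaleA {c : ℂ} (hc : c ≠ 0) (r : ℕ) (a b : SmoothAlg n) :
    iterContr dzDer dzbarDer r (scaleA hc a) (scaleA hc b) =
      (c * (starRingEnd ℂ) c) ^ r • scaleA hc (iterContr dzDer dzbarDer r a b) := by
  induction r generalizing a b with
  | zero => rw [iterContr_zero, iterContr_zero, scaleA_mul, pow_zero, one_smul]
  | succ r ih =>
    simp only [iterContr_succ, dzDer_scaleA, dzbarDer_scaleA, map_smul, LinearMap.smul_apply, ih,
      map_sum, smul_sum, smul_smul]
    exact sum_congr rfl fun i _ => by congr 1; ring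

theorem wickMA_scaleA {c : ℂ} (hc : c ≠ 0) (r : ℕ) (a b : SmoothAlg n) :
    wickMA n κ r (scaleA hc a) (scaleA hc b) =
      (c * (starRingEnd ℂ) c) ^ r • scaleA hc (wickMA n κ r a b) := by
  simp only [wickMA, expContr, LinearMap.smul_apply, iterContr_scaleA, map_smul]
  exact smul_comm _ _ _

theorem scaleA_zzA {c : ℂ} (hc : c ≠ 0) :
    scaleA hc (zzA n) = (c * (starRingEnd ℂ) c) • zzA n := by
  rw [zzA, scaleA_toAlg, ← toAlg_const_mul, toAlg_eq_iff]
  intro z _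
  simp [zz_smul, Complex.mul_conj]

theorem scaleA_pow {c : ℂ} (hc : c ≠ 0) (a : SmoothAlg n) (r : ℕ) :
    scaleA hc (a ^ r) = scaleA hc a ^ r := by
  induction r with
  | zero =>
    rw [pow_zero, pow_zero, ← map_one (algebraMap ℂ (SmoothAlg n)), ← toAlg_const, scaleA_toAlg]
  | succ r ih => rw [pow_succ, pow_succ, scaleA_mul, ih]

/-- The homogeneous function `(z z̄)ʳ Mᵣ(a, b)`. -/
theorem isHomog_zzA_pow_mul_wickMA {a b : SmoothAlg n} (ha : IsHomog a) (hb : IsHomog b)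
    (r : ℕ) : IsHomog (zzA n ^ r * wickMA n κ r a b) := fun c hc => by
  have h := wickMA_scaleA (κ := κ) hc r a b
  rw [ha c hc, hb c hc] at h
  rw [scaleA_mul, scaleA_pow, scaleA_zzA, smul_pow, smul_mul_assoc, ← mul_smul_comm, ← h]

theorem isInv_wickMA {a b : SmoothAlg n} (ha : IsHomog a) (hb : IsHomog b) (r : ℕ) :
    IsInv (wickMA n κ r a b) := fun c hc h1 => by
  have h := wickMA_scaleA (κ := κ) hc r a b
  rw [ha c hc, hb c hc, Complex.mul_conj, Complex.normSq_eq_norm_sq, h1] at h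
  simpa using h.symm

theorem IsInv.sum {ι : Type*} {s : Finset ι} {a : ι → SmoothAlg n} (h : ∀ i ∈ s, IsInv (a i)) :
    IsInv (∑ i ∈ s, a i) := fun c hc h1 => by
  rw [map_sum]; exact sum_congr rfl fun i hi => h i hi c hc h1

theorem isInv_wickA {f g : ℕ → SmoothAlg n} (hf : ∀ m, IsHomog (f m))
    (hg : ∀ m, IsHomog (g m)) (m : ℕ) : IsInv (wickA n κ f g m) :=
  IsInv.sum fun _ _ => IsInv.sum fun _ _ => isInv_wickMA (hf _) (hg _) _

/-! ### The reduced product -/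

/-- The two products with `J` differ only by `E` against `Ē`. -/
theorem wickA_JS_comm {f : ℕ → SmoothAlg n} (hf : ∀ m, eulerDer n (f m) = eulerBarDer n (f m)) :
    wickA n κ (JS n μ) f = wickA n κ f (JS n μ) := by
  ext1 m
  cases m with
  | zero => rw [wickA_JS_zero, JS_wickA_zero]
  | succ m => rw [wickA_JS_succ, JS_wickA_succ, hf]

/-- The reduced product of series. -/
noncomputable def redS (κ : ℝ) (f g : ℕ → SmoothAlg n) : ℕ → SmoothAlg n :=
  remS hμ κ (wickA n κ f g)

theorem isHomog_redS {f g : ℕ → SmoothAlg n} (hf : ∀ m, IsHomog (f m))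
    (hg : ∀ m, IsHomog (g m)) (m : ℕ) : IsHomog (redS hμ κ f g m) :=
  IsInv.isHomog hμ ((IsInv.opTS hμ (isInv_wickA hf hg) m).prolA hμ) (prolA_prolA hμ _)

/-- Both sides are remainders of `f * g * h`. Replacing `g * h` by its remainder changes the product
by an element of the left ideal of `J`. Replacing `f * g` does too, since the last factor `h`
commutes with `J`. -/
theorem redS_assoc {f g h : ℕ → SmoothAlg n} (hh : ∀ m, IsHomog (h m)) :
    redS hμ κ (redS hμ κ f g) h = redS hμ κ f (redS hμ κ g h) := by
  have e1 := eq_remS_add hμ (κ := κ) (wickA n κ f g)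
  have e2 := eq_remS_add hμ (κ := κ) (wickA n κ g h)
  have c1 := congrArg (fun x => wickA n κ x h) e1
  have c2 := congrArg (fun x => wickA n κ f x) e2
  simp only [wickA_add_left, wickA_add_right] at c1 c2
  have hcomm := wickA_JS_comm (κ := κ) (μ := μ) (f := h) fun m => by
    rw [(hh m).eulerDer_eq_zero.1, (hh m).eulerDer_eq_zero.2]
  -- With `q` the quotient of `f * g`: `(q * J) * h = q * (h * J) = (q * h) * J`.
  rw [wickA_assoc κ (quotS hμ κ _), hcomm, ← wickA_assoc] at c1
  rw [← wickA_assoc κ f (quotS hμ κ _)] at c2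
  have d1 := eq_remS_add hμ (κ := κ) (wickA n κ (redS hμ κ f g) h)
  have d2 := eq_remS_add hμ (κ := κ) (wickA n κ f (redS hμ κ g h))
  have f1 : wickA n κ (wickA n κ f g) h = redS hμ κ (redS hμ κ f g) h +
      wickA n κ (quotS hμ κ (wickA n κ (redS hμ κ f g) h) +
        wickA n κ (quotS hμ κ (wickA n κ f g)) h) (JS n μ) := by
    rw [wickA_add_left, c1]
    conv_lhs => rw [← redS, d1]
    rw [add_assoc]
    rfl
  have f2 : wickA n κ (wickA n κ f g) h = redS hμ κ f (redS hμ κ g h) +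
      wickA n κ (quotS hμ κ (wickA n κ f (redS hμ κ g h)) +
        wickA n κ f (quotS hμ κ (wickA n κ g h))) (JS n μ) := by
    rw [wickA_add_left, wickA_assoc, c2]
    conv_lhs => rw [← redS, d2]
    rw [add_assoc]
    rfl
  exact (eq_remS_of_eq_add hμ (fun m => prolA_prolA hμ _) f1).trans
    (eq_remS_of_eq_add hμ (fun m => prolA_prolA hμ _) f2).symm

end Reduction

/-! ### The coefficients `A^{(k)}_l` and the explicit reduced product. -/

section ExplicitFormula

open Finset

/-! ### The coefficients -/

theorem nestedSum_succ_eq_range (l k : ℕ) :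
    nestedSum (l + 1) k = ∑ i ∈ range k, ((i : ℤ) + 1) * nestedSum l (i + 1) := by
  rw [nestedSum, range_eq_Ico, ← Ico_add_one_right_eq_Icc, ← zero_add 1, ← sum_Ico_add']
  simp

theorem nestedSum_succ_succ (l k : ℕ) :
    nestedSum (l + 1) (k + 1) = nestedSum (l + 1) k + ((k : ℤ) + 1) * nestedSum l (k + 1) := by
  rw [nestedSum_succ_eq_range, nestedSum_succ_eq_range, sum_range_succ]

theorem coeffA_succ (k l : ℕ) :
    coeffA k (l + 1) = -∑ i ∈ range k, ((i : ℤ) + 1) * coeffA (i + 1) l := by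
  simp only [coeffA, nestedSum_succ_eq_range, mul_sum, ← sum_neg_distrib]
  exact sum_congr rfl fun i _ => by ring

theorem coeffA_zero_right (k : ℕ) : coeffA k 0 = 1 := by simp [coeffA, nestedSum]

theorem coeffA_zero_left (l : ℕ) : coeffA 0 (l + 1) = 0 := by simp [coeffA_succ]

/-- The alternating sum `∑ⱼ (-1)ᵏ⁻ʲ C(k, j) jᵏ⁺ˡ`. -/
def altSum (k l : ℕ) : ℚ :=
  ∑ j ∈ range (k + 1), (-1) ^ (k - j) * (k.choose j : ℚ) * (j : ℚ) ^ (k + l)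

/-- The sum is the `k`-th forward difference of `xᵏ` at `0`. -/
theorem altSum_zero_right (k : ℕ) : altSum k 0 = k.factorial := by
  have h := congrFun (fwdDiff_iter_eq_factorial (R := ℚ) (n := k)) 0
  rw [fwdDiff_iter_eq_sum_shift] at h
  simp only [altSum, add_zero]
  refine Eq.trans (sum_congr rfl fun j _ => ?_) h
  simp

/-- Use `C(k+1, j)(k+1-j) = (k+1) C(k, j)` for `j ≤ k`; the top term `j = k+1` occurs only in the
two sums with upper index `k+1`. -/
theorem altSum_succ_succ (k l : ℕ) :
    altSum (k + 1) (l + 1) = (k + 1) * altSum k (l + 1) + (k + 1) * altSum (k + 1) l := by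
  rw [altSum, altSum, altSum, mul_sum, mul_sum, sum_range_succ, sum_range_succ _ (k + 1),
    ← add_assoc (Finset.sum _ _), ← sum_add_distrib]
  congr 1
  · refine sum_congr rfl fun j hj => ?_
    have hjk : j ≤ k := Nat.lt_succ_iff.1 (mem_range.1 hj)
    have h1 : ((k + 1).choose j : ℚ) * ((k : ℚ) + 1 - j) = (k.choose j : ℚ) * (k + 1) := by
      have := Nat.choose_mul_succ_eq k j
      rw [← Nat.cast_succ, ← Nat.cast_sub (by omega)]
      exact_mod_cast this.symm
    rw [Nat.sub_add_comm hjk, pow_succ (-1 : ℚ), show k + 1 + (l + 1) = k + l + 1 + 1 by ring,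
      show k + 1 + l = k + l + 1 by ring, show k + (l + 1) = k + l + 1 by ring,
      pow_succ (j : ℚ) (k + l + 1)]
    linear_combination ((-1 : ℚ) ^ (k - j) * (j : ℚ) ^ (k + l + 1)) * h1
  · simp
    ring

/-- Both sides obey the same recursion in `k` and `l` with the same boundary values. The nested sum
is the complete homogeneous symmetric polynomial of degree `l` in `1, …, k`, that is, the Stirling
number `S(k+l, k)`. -/
theorem factorial_mul_nestedSum (k l : ℕ) :
    (k.factorial : ℚ) * nestedSum l k = altSum k l := by
  induction k generalizing l with
  | zero =>
    cases l with
    | zero => simp [altSum, nestedSum]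
    | succ l => simp [altSum, nestedSum]
  | succ k ihk =>
    induction l with
    | zero => rw [altSum_zero_right]; simp [nestedSum]
    | succ l ihl =>
      rw [altSum_succ_succ, ← ihl, ← ihk, nestedSum_succ_succ, Nat.factorial_succ]
      push_cast
      ring

theorem coeffA_eq (k l : ℕ) (hk : 1 ≤ k) :
    (coeffA k l : ℚ) = 1 / ((k - 1).factorial : ℚ) * ∑ j ∈ Icc 1 k,
      ((k - 1).choose (j - 1) : ℚ) * (-1) ^ (k + l - j) * (j : ℚ) ^ (k + l - 1) := by
  obtain ⟨k, rfl⟩ := Nat.exists_eq_add_of_le' hk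
  have hf : ((k + 1).factorial : ℚ) ≠ 0 := Nat.cast_ne_zero.2 (Nat.factorial_ne_zero _)
  have hf' : (k.factorial : ℚ) ≠ 0 := Nat.cast_ne_zero.2 (Nat.factorial_ne_zero _)
  have h := factorial_mul_nestedSum (k + 1) l
  rw [altSum, sum_range_succ'] at h
  simp only [CharP.cast_eq_zero] at h
  rw [zero_pow (by omega), mul_zero, add_zero] at h
  have h1 : ∑ j ∈ Icc 1 (k + 1), ((k + 1 - 1).choose (j - 1) : ℚ) *
      (-1) ^ (k + 1 + l - j) * (j : ℚ) ^ (k + 1 + l - 1) =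
      ∑ j ∈ range (k + 1),
        (k.choose j : ℚ) * (-1) ^ (k + l - j) * ((j + 1 : ℕ) : ℚ) ^ (k + l) := by
    rw [range_eq_Ico, ← Ico_add_one_right_eq_Icc, ← zero_add 1, ← sum_Ico_add']
    refine sum_congr (by simp) fun j hj => ?_
    rw [show k + (0 + 1) + l - (j + (0 + 1)) = k + l - j by omega,
      show k + (0 + 1) + l - (0 + 1) = k + l by omega]
    simp
  have h2 : ((k + 1).factorial : ℚ) * (coeffA (k + 1) l : ℚ) = (k + 1) * ∑ j ∈ range (k + 1),
      (k.choose j : ℚ) * (-1) ^ (k + l - j) * ((j + 1 : ℕ) : ℚ) ^ (k + l) := by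
    rw [coeffA, Int.cast_mul, mul_left_comm, h, mul_sum, mul_sum]
    refine sum_congr rfl fun j hj => ?_
    have hjk : j ≤ k := Nat.lt_succ_iff.1 (mem_range.1 hj)
    -- Absorption moves one power of the summation index into the binomial coefficient, which lowers
    -- the exponent and the factorial by one.
    have h3 : ((k + 1).choose (j + 1) : ℚ) * ((j : ℚ) + 1) = ((k : ℚ) + 1) * k.choose j := by
      exact_mod_cast (Nat.add_one_mul_choose_eq k j).symm
    rw [show k + l - j = k - j + l by omega, show k + 1 - (j + 1) = k - j by omega,
      show k + 1 + l = k + l + 1 by ring, pow_succ _ (k + l), pow_add (-1 : ℚ)]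
    push_cast
    linear_combination (-1 : ℚ) ^ l * (-1 : ℚ) ^ (k - j) * ((j : ℚ) + 1) ^ (k + l) * h3
  rw [h1, Nat.add_sub_cancel]
  rw [Nat.factorial_succ] at h2
  push_cast at h2 ⊢
  have hk1 : (k : ℚ) + 1 ≠ 0 := by positivity
  field_simp
  refine mul_left_cancel₀ hk1 ?_
  linear_combination h2

/-! ### Prolongations of iterates of `K` -/

variable {n : ℕ} {κ μ : ℝ} (hμ : μ < 0)

theorem smoothFn_zz_inv : SmoothFn (fun z : Coord n => ((zz z : ℂ))⁻¹) :=
  ContDiffOn.inv smoothFn_zz fun _ hz => Complex.ofReal_ne_zero.2 (zz_pos hz).ne'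

/-- `1 / z z̄` as an element of the algebra of smooth functions. -/
noncomputable def zzInvA (n : ℕ) : SmoothAlg n := toAlg _ smoothFn_zz_inv

theorem zzInvA_mul_zzA : zzInvA n * zzA n = 1 := by
  rw [zzInvA, zzA, ← toAlg_mul, ← map_one (algebraMap ℂ (SmoothAlg n)), ← toAlg_const,
    toAlg_eq_iff]
  exact fun z hz => inv_mul_cancel₀ (Complex.ofReal_ne_zero.2 (zz_pos hz).ne')

theorem eulerDer_zzA : eulerDer n (zzA n) = zzA n := by
  rw [zzA, eulerDer_toAlg, toAlg_eq_iff]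
  intro z _
  simp only [euler, dz_zz]
  exact (zz_eq z).symm

theorem eulerDer_zzInvA : eulerDer n (zzInvA n) = -zzInvA n := by
  have h := congrArg (eulerDer n) (zzInvA_mul_zzA (n := n))
  rw [Derivation.leibniz, Derivation.map_one_eq_zero, eulerDer_zzA, smul_eq_mul, smul_eq_mul] at h
  have h1 := zzInvA_mul_zzA (n := n)
  linear_combination zzInvA n * h - (eulerDer n (zzInvA n) + zzInvA n) * h1

theorem eulerDer_zzInvA_pow_mul {a : SmoothAlg n} (ha : IsHomog a) (k : ℕ) :
    eulerDer n (zzInvA n ^ k * a) = (-(k : ℂ)) • (zzInvA n ^ k * a) := by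
  induction k with
  | zero => simp [ha.eulerDer_eq_zero.1]
  | succ k ih =>
    rw [pow_succ', mul_assoc, Derivation.leibniz, ih, eulerDer_zzInvA, smul_eq_mul, smul_eq_mul,
      mul_smul_comm]
    push_cast
    rw [neg_add, add_smul]
    simp only [neg_smul, one_smul]
    ring

theorem prolA_zzInvA : prolA hμ (zzInvA n) = algebraMap ℂ _ (1 / (-2 * (μ : ℂ))) := by
  rw [zzInvA, prolA_toAlg, ← toAlg_const, toAlg_eq_iff]
  intro z hz
  simp only [prol, zz_proj hμ hz]
  push_cast
  rw [one_div]

theorem prolA_zzInvA_pow_mul {a : SmoothAlg n} (ha : IsHomog a) (k : ℕ) :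
    prolA hμ (zzInvA n ^ k * a) = (1 / (-2 * (μ : ℂ))) ^ k • a := by
  induction k with
  | zero => rw [pow_zero, one_mul, pow_zero, one_smul, ha.prolA_eq]
  | succ k ih =>
    rw [pow_succ', mul_assoc, prolA_mul, ih, prolA_zzInvA, ← Algebra.smul_def, smul_smul,
      ← pow_succ']

theorem JA_eq : JA n μ = -(algebraMap ℂ _ (1 / 2 : ℂ)) * zzA n - algebraMap ℂ _ (μ : ℂ) := by
  have h : JA n μ = toAlg (fun z => (fun z : Coord n => -(1 / 2 : ℂ)) z * (zz z : ℂ) - μ)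
      (((smoothFn_const _).mul smoothFn_zz).sub (smoothFn_const _)) := by
    rw [JA, toAlg_eq_iff]
    exact fun z _ => J_eq μ z
  rw [h, toAlg_sub ((smoothFn_const _).mul smoothFn_zz) (smoothFn_const _),
    toAlg_mul (smoothFn_const _) smoothFn_zz, toAlg_const, toAlg_const, map_neg]
  rfl

/-- With `X = 1/(z z̄)` and `y = 1/(-2μ)`, one has `X - y = 2 y X J`, and `Xᵏ - yᵏ` is `X - y` times
a geometric sum. Since `yᵏ a` is a prolongation, the cofactor of `J` is the quotient. -/
theorem compJA_zzInvA_pow_mul {a : SmoothAlg n} (ha : IsHomog a) (k : ℕ) :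
    compJA hμ (zzInvA n ^ k * a) =
      ∑ i ∈ range k, (2 * (1 / (-2 * (μ : ℂ))) ^ (k - i)) • (zzInvA n ^ (i + 1) * a) := by
  refine (prolA_compJA_unique hμ (p := (1 / (-2 * (μ : ℂ))) ^ k • a)
    (by rw [map_smul, ha.prolA_eq]) ?_).2
  have hμ' : (μ : ℂ) ≠ 0 := Complex.ofReal_ne_zero.2 hμ.ne
  set y : SmoothAlg n := algebraMap ℂ _ (1 / (-2 * (μ : ℂ))) with hy
  set X := zzInvA n
  have hXx : X * zzA n = 1 := zzInvA_mul_zzA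
  have hyμ : y * algebraMap ℂ _ (-2 * (μ : ℂ)) = 1 := by
    rw [hy, ← map_mul, one_div, inv_mul_cancel₀ (by simpa using hμ'), map_one]
  have hsum : ∑ i ∈ range k, (2 * (1 / (-2 * (μ : ℂ))) ^ (k - i)) • (X ^ (i + 1) * a) =
      2 * (y * X) * (∑ i ∈ range k, X ^ i * y ^ (k - 1 - i)) * a := by
    rw [mul_sum, sum_mul]
    refine sum_congr rfl fun i hi => ?_
    have hik : k - i = k - 1 - i + 1 := by have := mem_range.1 hi; omega
    rw [Algebra.smul_def, map_mul, map_pow, ← hy, map_ofNat, hik]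
    ring
  have hgeom := geom_sum₂_mul X y k
  have h2 : 2 * (y * X) * JA n μ = X - y := by
    have h3 : (2 : SmoothAlg n) * algebraMap ℂ _ (1 / 2 : ℂ) = 1 := by
      rw [← map_ofNat (algebraMap ℂ (SmoothAlg n)) 2, ← map_mul]; norm_num
    have h4 : algebraMap ℂ (SmoothAlg n) (-2 * (μ : ℂ)) = -2 * algebraMap ℂ _ (μ : ℂ) := by
      rw [map_mul, map_neg, map_ofNat]
    rw [h4] at hyμ
    rw [JA_eq]
    linear_combination (-y * 2 * algebraMap ℂ _ (1 / 2 : ℂ)) * hXx - y * h3 + X * hyμ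
  rw [hsum, Algebra.smul_def, map_pow, ← hy]
  linear_combination (-a) * hgeom - (∑ i ∈ range k, X ^ i * y ^ (k - 1 - i)) * a * h2

/-- `E` has eigenvalue `-(i+1)` on `(z z̄)^{-(i+1)} a`, so `K` is triangular on these powers. -/
theorem opKA_zzInvA_pow_mul {a : SmoothAlg n} (ha : IsHomog a) (k : ℕ) :
    opKA κ hμ (zzInvA n ^ k * a) = ∑ i ∈ range k,
      (-((κ : ℂ) * (i + 1) * (1 / (-2 * (μ : ℂ))) ^ (k - i))) • (zzInvA n ^ (i + 1) * a) := by
  rw [opKA_apply, compJA_zzInvA_pow_mul hμ ha, map_sum, smul_sum]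
  refine sum_congr rfl fun i _ => ?_
  rw [Derivation.map_smul, eulerDer_zzInvA_pow_mul ha, smul_smul, smul_smul]
  congr 1
  push_cast
  ring

/-- One application of `K` runs through the exponents `i + 1 ≤ k` with weight `-(i+1)`, which is the
recursion of `coeffA`. The powers of `1/(-2μ)` always add up to `k + l`, whatever the intermediate
exponents. -/
theorem prolA_opKA_pow {a : SmoothAlg n} (ha : IsHomog a) (k l : ℕ) :
    prolA hμ ((opKA κ hμ ^ l) (zzInvA n ^ k * a)) =
      ((1 / (-2 * (μ : ℂ))) ^ (k + l) * (κ : ℂ) ^ l * (coeffA k l : ℂ)) • a := by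
  induction l generalizing k with
  | zero =>
    rw [pow_zero, Module.End.one_apply, prolA_zzInvA_pow_mul hμ ha, coeffA_zero_right]
    simp
  | succ l ih =>
    rw [pow_succ, Module.End.mul_apply, opKA_zzInvA_pow_mul hμ ha, map_sum, map_sum]
    simp only [map_smul, ih, smul_smul]
    rw [← sum_smul, coeffA_succ]
    congr 1
    push_cast
    rw [mul_neg, mul_sum, ← sum_neg_distrib]
    refine sum_congr rfl fun i hi => ?_
    have hik : k + (l + 1) = (k - i) + (i + 1 + l) := by have := mem_range.1 hi; omega
    rw [hik, pow_add]
    ring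

/-- The bidifferential operators of the explicit product. -/
noncomputable def starMA (n : ℕ) (κ μ : ℝ) (r : ℕ) :
    SmoothAlg n →ₗ[ℂ] SmoothAlg n →ₗ[ℂ] SmoothAlg n :=
  ∑ p ∈ antidiagonal r, ((1 / (-2 * (μ : ℂ))) ^ r * (κ : ℂ) ^ p.2 * (coeffA p.1 p.2 : ℂ)) •
    (wickMA n κ p.1).compr₂ (LinearMap.mulLeft ℂ (zzA n ^ p.1))

theorem starMA_apply (r : ℕ) (a b : SmoothAlg n) :
    starMA n κ μ r a b = ∑ p ∈ antidiagonal r,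
      ((1 / (-2 * (μ : ℂ))) ^ r * (κ : ℂ) ^ p.2 * (coeffA p.1 p.2 : ℂ)) •
        (zzA n ^ p.1 * wickMA n κ p.1 a b) := by
  simp [starMA, LinearMap.sum_apply]

theorem sum_antidiagonal_assoc {B : Type*} [AddCommMonoid B] (G : ℕ → ℕ → ℕ → B) (m : ℕ) :
    ∑ p ∈ antidiagonal m, ∑ r ∈ antidiagonal p.2, G p.1 r.1 r.2 =
      ∑ s ∈ antidiagonal m, ∑ t ∈ antidiagonal s.1, G t.2 t.1 s.2 := by
  simp only [sum_sigma']
  refine sum_nbij' (fun x => ⟨(x.1.1 + x.2.1, x.2.2), (x.2.1, x.1.1)⟩)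
    (fun y => ⟨(y.2.2, y.2.1 + y.1.2), (y.2.1, y.1.2)⟩) ?_ ?_ ?_ ?_ ?_
  all_goals
    rintro ⟨⟨a, b⟩, ⟨c, d⟩⟩ hx
    simp only [mem_sigma, HasAntidiagonal.mem_antidiagonal, and_true] at hx ⊢
  · omega
  · omega
  · obtain ⟨h1, h2⟩ := hx
    subst h2 h1
    rfl
  · obtain ⟨h1, h2⟩ := hx
    subst h2 h1
    simp [add_comm]

/-- The explicit formula for the reduced product. -/
theorem redS_eq_seriesMul {f g : ℕ → SmoothAlg n} (hf : ∀ m, IsHomog (f m))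
    (hg : ∀ m, IsHomog (g m)) : redS hμ κ f g = seriesMul (starMA n κ μ) f g := by
  ext1 m
  -- `M_r` is rewritten as `(z z̄)^{-r}` times the homogeneous function `(z z̄)^r M_r`.
  have key : ∀ l r i j, prolA hμ ((opKA κ hμ ^ l) (wickMA n κ r (f i) (g j))) =
      ((1 / (-2 * (μ : ℂ))) ^ (r + l) * (κ : ℂ) ^ l * (coeffA r l : ℂ)) •
        (zzA n ^ r * wickMA n κ r (f i) (g j)) := fun l r i j => by
    rw [← prolA_opKA_pow hμ (isHomog_zzA_pow_mul_wickMA (hf i) (hg j) r), ← mul_assoc, ← mul_pow,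
      zzInvA_mul_zzA, one_pow, one_mul]
  simp only [redS, remS, opTS, seriesMap, wickA, seriesMul, map_sum, key, starMA_apply]
  rw [sum_antidiagonal_assoc (fun l r s => ∑ q ∈ antidiagonal s,
    ((1 / (-2 * (μ : ℂ))) ^ (r + l) * (κ : ℂ) ^ l * (coeffA r l : ℂ)) •
        (zzA n ^ r * wickMA n κ r (f q.1) (g q.2)))]
  refine sum_congr rfl fun s _ => ?_
  rw [sum_comm]
  refine sum_congr rfl fun q _ => sum_congr rfl fun p hp => ?_
  rw [HasAntidiagonal.mem_antidiagonal.1 hp]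

end ExplicitFormula

/-! ### Local sections of the flow and triviality of `S`. -/

section OperatorS

variable {n : ℕ} {κ μ : ℝ}

theorem wickAnti_J_eq_zero {k : ℕ} (hk : 2 ≤ k) (f : Fn n) : wickAnti κ k (J μ) f = 0 := by
  ext z
  rw [wickAnti, wickM_J_left_eq_zero κ μ hk, wickM_J_right_eq_zero κ μ hk]
  simp

theorem wickAnti_one_J (f : Fn n) (z : Coord n) :
    wickAnti κ 1 (J μ) f z = (κ : ℂ) / 2 * (euler f z - eulerBar f z) := by
  rw [wickAnti, wickM_one_J_left, wickM_one_J_right]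
  ring

theorem wickAnti_J_eqOn_zero {k : ℕ} (hk : 1 ≤ k) {f : Fn n}
    (hf : Set.EqOn (euler f) (eulerBar f) (phase n)) :
    Set.EqOn (wickAnti κ k (J μ) f) 0 (phase n) := fun z hz => by
  rcases hk.eq_or_lt with rfl | hk
  · rw [wickAnti_one_J, hf hz, sub_self, mul_zero]; rfl
  · rw [wickAnti_J_eq_zero hk]

theorem opT_eqOn_zero (hμ : μ < 0) (i : ℕ) {f : Fn n} (hf : Set.EqOn f 0 (phase n)) :
    Set.EqOn (opT κ μ i f) 0 (phase n) := by
  rw [opT_eq_iterate, ← opK_iterate_zero κ μ i]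
  induction i with
  | zero => exact hf
  | succ i ih =>
    rw [Function.iterate_succ_apply', Function.iterate_succ_apply']
    exact (isSmoothOp_opK κ hμ).eqOn ih

/-- Brackets with `J` of order at least two vanish identically, and the first order one is a
multiple of `E - Ē`. In the double sum both indices are at least one, so only `s j` with `j ≤ m - 2`
occurs. -/
theorem exprF_eqOn_zero (hμ : μ < 0) (m : ℕ) {s : ℕ → Fn n}
    (hs : ∀ j, j + 2 ≤ m → Set.EqOn (euler (s j)) (eulerBar (s j)) (phase n)) :
    Set.EqOn (exprF κ μ m s) 0 (phase n) := fun z hz => by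
  rw [exprF, Finset.sum_eq_zero, Finset.sum_eq_zero, add_zero]
  · rfl
  · refine fun i hi => Finset.sum_eq_zero fun k hk => ?_
    rw [Finset.mem_Icc] at hi hk
    exact opT_eqOn_zero hμ i (wickAnti_J_eqOn_zero hk.1 (hs _ (by omega))) hz
  · intro k hk
    rw [wickAnti_J_eq_zero (Finset.mem_Icc.1 hk).1]
    rfl

theorem mem_slitPlane_real_mul_iff {r : ℝ} (hr : 0 < r) (w : ℂ) :
    (r : ℂ) * w ∈ Complex.slitPlane ↔ w ∈ Complex.slitPlane := by
  simp only [Complex.mem_slitPlane_iff, Complex.re_ofReal_mul, Complex.im_ofReal_mul,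
    mul_pos_iff_of_pos_left hr, ne_eq, mul_eq_zero, hr.ne', false_or]

theorem mul_exp_mem_slitPlane {r θ : ℝ} (hr : 0 < r) (h1 : -Real.pi < θ) (h2 : θ < Real.pi) :
    (r : ℂ) * Complex.exp (Complex.I * θ) ∈ Complex.slitPlane := by
  rw [Complex.mem_slitPlane_iff_arg, mul_comm Complex.I, Complex.exp_mul_I,
    Complex.arg_mul_cos_add_sin_mul_I hr ⟨h1, h2.le⟩, ← Complex.exp_mul_I]
  exact ⟨h2.ne, mul_ne_zero (Complex.ofReal_ne_zero.2 hr.ne') (Complex.exp_ne_zero _)⟩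

/-- The section of the flow on which `zʲ` is a positive multiple of a given number. -/
noncomputable def coordSection (hκ : 0 < κ) (hμ : μ < 0) (j : Fin (n + 1)) (a : ℂ) :
    FlowSection n κ μ where
  dom := {z | z j * a ∈ Complex.slitPlane}
  -- Rotates `z` until `z j * a` is a positive real; the flow turns by `κt/2`, so returning takes
  -- the time `2/κ` times the argument.
  base z := ((‖z j * a‖ : ℂ) / (z j * a)) • z
  time z := 2 / κ * Complex.arg (z j * a)
  isOpen_dom := Complex.isOpen_slitPlane.preimage ((continuous_apply j).mul continuous_const)
  dom_subset z hz h0 := Complex.slitPlane_ne_zero hz (by simp [h0])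
  radial z hz := by
    change ((Real.sqrt (-2 * μ / zz z) : ℂ) * z j) * a ∈ Complex.slitPlane ↔ _
    rw [mul_assoc, mem_slitPlane_real_mul_iff (sqrt_ratio_pos hμ hz)]
    rfl
  smooth_base z hz := by
    have h1 : ContDiffAt ℝ ∞ (fun z : Coord n => z j * a) z :=
      ((ContinuousLinearMap.proj (R := ℝ) (φ := fun _ : Fin (n + 1) => ℂ)
        j).contDiff.mul contDiff_const).contDiffAt
    have hne := Complex.slitPlane_ne_zero hz
    simp only [div_eq_mul_inv]
    exact (((Complex.ofRealCLM.contDiff.contDiffAt.comp z (h1.norm ℝ hne)).mul (h1.inv hne)).smul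
      contDiffAt_id).contDiffWithinAt
  smooth_time z hz := by
    have h1 : ContDiffAt ℝ ∞ (fun z : Coord n => z j * a) z :=
      ((ContinuousLinearMap.proj (R := ℝ) (φ := fun _ : Fin (n + 1) => ℂ)
        j).contDiff.mul contDiff_const).contDiffAt
    have h2 : ContDiffAt ℝ ∞ Complex.log (z j * a) :=
      (Complex.contDiffAt_log hz).restrict_scalars ℝ
    have h3 := Complex.imCLM.contDiff.contDiffAt.comp z (h2.comp z h1)
    refine ContDiffAt.contDiffWithinAt (contDiffAt_const.mul (h3.congr_of_eventuallyEq ?_))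
    exact .of_forall fun w => (Complex.log_im _).symm
  base_mem z hz := by
    have hne := Complex.slitPlane_ne_zero hz.1
    constructor
    · change ((‖z j * a‖ : ℂ) / (z j * a)) * z j * a ∈ Complex.slitPlane
      rw [mul_assoc, div_mul_cancel₀ _ hne]
      exact Complex.ofReal_mem_slitPlane.2 (norm_pos_iff.2 hne)
    · refine (J_eq_zero_iff _ _).2 ?_
      rw [zz_smul, (J_eq_zero_iff _ _).1 hz.2, Complex.normSq_eq_norm_sq, norm_div,
        Complex.norm_real, norm_norm, div_self (norm_ne_zero_iff.2 hne), one_pow, one_mul]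
  time_base z hz := by
    have hne := Complex.slitPlane_ne_zero hz.1
    change 2 / κ * Complex.arg (((‖z j * a‖ : ℂ) / (z j * a)) * z j * a) = 0
    rw [mul_assoc _ (z j), div_mul_cancel₀ _ hne, Complex.arg_ofReal_of_nonneg (norm_nonneg _),
      mul_zero]
  flow_time z hz := by
    have hne := Complex.slitPlane_ne_zero hz.1
    have hn : (‖z j * a‖ : ℂ) ≠ 0 := Complex.ofReal_ne_zero.2 (norm_ne_zero_iff.2 hne)
    have h1 : κ / 2 * (2 / κ * Complex.arg (z j * a)) = Complex.arg (z j * a) := by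
      field_simp
    rw [flow, h1, smul_smul]
    have h2 := Complex.norm_mul_exp_arg_mul_I (z j * a)
    rw [mul_comm _ Complex.I] at h2
    rw [← mul_div_assoc, mul_comm (Complex.exp _), h2, div_self hne, one_smul]
  -- Along the path the argument of `z j * a` runs between `0` and its final value in `(-π, π)`, so
  -- the cut is never met.
  path_mem z hz s hs := by
    have hne := Complex.slitPlane_ne_zero hz.1
    change Complex.exp (Complex.I * ((κ / 2 * s : ℝ) : ℂ)) *
      (((‖z j * a‖ : ℂ) / (z j * a)) * z j) * a ∈ Complex.slitPlane
    rw [mul_assoc, mul_assoc _ (z j), div_mul_cancel₀ _ hne, mul_comm]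
    have h1 : κ / 2 * (2 / κ * Complex.arg (z j * a)) = Complex.arg (z j * a) := by
      field_simp
    have hlt : Complex.arg (z j * a) < Real.pi :=
      lt_of_le_of_ne (Complex.arg_le_pi _) (Complex.mem_slitPlane_iff_arg.1 hz.1).1
    have hκ2 : 0 ≤ κ / 2 := by positivity
    refine mul_exp_mem_slitPlane (norm_pos_iff.2 hne) ?_ ?_
    · rcases Set.mem_uIcc.1 hs with h | h
      · have := mul_nonneg hκ2 h.1
        linarith [Real.pi_pos]
      · have := mul_le_mul_of_nonneg_left h.1 hκ2
        linarith [Complex.neg_pi_lt_arg (z j * a)]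
    · rcases Set.mem_uIcc.1 hs with h | h
      · have := mul_le_mul_of_nonneg_left h.2 hκ2
        linarith
      · have := mul_le_mul_of_nonneg_left h.2 hκ2
        linarith [Real.pi_pos]
  base_flow z hz s hs := by
    have hne := Complex.slitPlane_ne_zero hz.1
    change ((‖Complex.exp (Complex.I * ((κ / 2 * s : ℝ) : ℂ)) * z j * a‖ : ℂ) /
      (Complex.exp (Complex.I * ((κ / 2 * s : ℝ) : ℂ)) * z j * a)) •
      (Complex.exp (Complex.I * ((κ / 2 * s : ℝ) : ℂ)) • z) = _
    have he := Complex.exp_ne_zero (Complex.I * ((κ / 2 * s : ℝ) : ℂ))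
    rw [mul_assoc, norm_mul, mul_comm Complex.I, Complex.norm_exp_ofReal_mul_I, one_mul, smul_smul,
      mul_comm (_ : ℂ) Complex.I, div_mul_eq_mul_div, mul_comm _ (Complex.exp _),
      mul_div_mul_left _ _ he]

theorem exists_section (hκ : 0 < κ) (hμ : μ < 0) {z : Coord n} (hz : z ∈ phase n) :
    ∃ σ : FlowSection n κ μ, z ∈ σ.dom := by
  obtain ⟨j, hj⟩ := Function.ne_iff.1 hz
  -- With `a` the conjugate of `z j`, the product is `|z j|² > 0`, so the given point lies in the
  -- domain.
  refine ⟨coordSection hκ hμ j ((starRingEnd ℂ) (z j)), ?_⟩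
  change z j * (starRingEnd ℂ) (z j) ∈ Complex.slitPlane
  rw [Complex.mul_conj]
  exact Complex.ofReal_mem_slitPlane.2 (Complex.normSq_pos.2 hj)

theorem eulerBar_zero : eulerBar (0 : Fn n) = 0 := by
  ext z
  have h : ∀ i, dzbar i (0 : Fn n) = 0 := dzbar_const 0
  simp [eulerBar, h]

theorem euler_zero : euler (0 : Fn n) = 0 := by
  ext z
  have h : ∀ i, dz i (0 : Fn n) = 0 := dz_const 0
  simp [euler, h]

theorem eqOn_euler_eulerBar_of_eqOn {f g : Fn n} (h : Set.EqOn f g (phase n))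
    (hg : Set.EqOn (euler g) (eulerBar g) (phase n)) :
    Set.EqOn (euler f) (eulerBar f) (phase n) := fun z hz => by
  rw [euler_eqOn h hz, eulerBar_eqOn h hz, hg hz]

/-- The identity operator is obtained from the construction of `S`. -/
theorem isOpS_id (hκ : 0 < κ) (hμ : μ < 0)
    (h : ∀ f : Fn n, constS f ∈ algB n κ μ ∩ spaceF n μ →
      Set.EqOn (euler f) (eulerBar f) (phase n)) :
    IsOpS κ μ (fun m (f : Fn n) => if m = 0 then f else 0) := by
  intro f hf z hz
  obtain ⟨σ, hσ⟩ := exists_section hκ hμ hz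
  refine ⟨σ, hσ, fun z _ => by simp, fun m hm z hz => ?_⟩
  have hz' := σ.dom_subset hz
  have hp : proj μ z ∈ σ.dom ∩ surface n μ := ⟨(σ.radial z hz').2 hz, proj_mem_surface hμ hz'⟩
  rw [intervalIntegral.integral_congr (g := fun _ => 0)]
  · simp [show m ≠ 0 by omega]
  · intro t ht
    refine exprF_eqOn_zero hμ (m + 1) (fun j _ => ?_) (σ.dom_subset (σ.path_mem _ hp t ht))
    by_cases hj : j = 0
    · simpa [hj] using h f hf
    · simp [hj, euler_zero, eulerBar_zero, Set.eqOn_refl]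

/-- The integrand for `S_m` involves only `S_j f` with `j < m`. By induction these are `f` or `0`,
on which `E` and `Ē` agree, so the integral vanishes for every choice of section. -/
theorem IsOpS.eqOn {S : ℕ → Fn n → Fn n} (hS : IsOpS κ μ S) (hμ : μ < 0) {f : Fn n}
    (hf : constS f ∈ algB n κ μ ∩ spaceF n μ)
    (h : Set.EqOn (euler f) (eulerBar f) (phase n)) (m : ℕ) :
    Set.EqOn (S m f) (if m = 0 then f else 0) (phase n) := by
  induction m using Nat.strong_induction_on with
  | _ m ih =>
    intro z hz
    obtain ⟨σ, hσ, h0, h1⟩ := hS f hf z hz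
    rcases Nat.eq_zero_or_pos m with rfl | hm
    · simpa using h0 z hσ
    · have hp : proj μ z ∈ σ.dom ∩ surface n μ :=
        ⟨(σ.radial z hz).2 hσ, proj_mem_surface hμ hz⟩
      have h2 := h1 m hm z hσ
      rw [intervalIntegral.integral_congr (g := fun _ => 0)] at h2
      · simpa [hm.ne'] using h2
      · intro t ht
        refine exprF_eqOn_zero hμ (m + 1) (fun j hj => ?_)
          (σ.dom_subset (σ.path_mem _ hp t ht))
        refine eqOn_euler_eulerBar_of_eqOn (ih j (by omega)) ?_
        split_ifs
        · exact h
        · simp [euler_zero, eulerBar_zero, Set.eqOn_refl]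

end OperatorS

/-! ### From the algebra back to series of functions: classical and deformed algebras, star product,
reduction. -/

section Translation

open Finset

variable {n : ℕ} {κ μ : ℝ}

/-! ### Series of functions and series in the algebra -/

theorem constS_mem {f : Fn n} (hf : SmoothFn f) : constS f ∈ smoothSeries n
  | 0 => hf
  | _ + 1 => smoothFn_const 0

theorem toSer_constS {f : Fn n} (hf : SmoothFn f) :
    toSer (constS f) (constS_mem hf) =
      (Pi.single (0 : ℕ) (toAlg f hf) : ℕ → SmoothAlg n) := by
  ext1 m
  cases m with
  | zero => rw [Pi.single_eq_same]; rfl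
  | succ m => rw [Pi.single_eq_of_ne (by omega)]; rfl

theorem toSer_constS_J :
    toSer (constS (J μ)) (constS_mem (smoothFn_J μ)) = JS n μ := toSer_constS _

theorem SEq.mem {f g : Series n} (h : SEq f g) (hg : g ∈ smoothSeries n) :
    f ∈ smoothSeries n := fun m => (hg m).congr (h m)

theorem SEq.symm {f g : Series n} (h : SEq f g) : SEq g f := fun m => (h m).symm

theorem SEq.trans {f g h : Series n} (h1 : SEq f g) (h2 : SEq g h) : SEq f h :=
  fun m => (h1 m).trans (h2 m)

theorem wick_congr {f f' g g' : Series n} (hf : SEq f f') (hg : SEq g g') :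
    SEq (wick κ f g) (wick κ f' g') := fun m z hz => by
  simp only [wick, ext₂]
  exact sum_congr rfl fun p _ => sum_congr rfl fun q _ =>
    wickM_eqOn κ (isOpen_phase n) (hf _) (hg _) _ hz

theorem sub_mem_smoothSeries {f g : Series n} (hf : f ∈ smoothSeries n)
    (hg : g ∈ smoothSeries n) : f - g ∈ smoothSeries n := fun m => (hf m).sub (hg m)

theorem toSer_sub {f g : Series n} (hf : f ∈ smoothSeries n) (hg : g ∈ smoothSeries n) :
    toSer (f - g) (sub_mem_smoothSeries hf hg) = toSer f hf - toSer g hg := rfl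

theorem prolS_mem (hμ : μ < 0) {f : Series n} (hf : f ∈ smoothSeries n) :
    prolS μ f ∈ smoothSeries n := fun m => (hf m).smooth_prol hμ

theorem toSer_prolS (hμ : μ < 0) {f : Series n} (hf : f ∈ smoothSeries n) (m : ℕ) :
    toSer (prolS μ f) (prolS_mem hμ hf) m = prolA hμ (toSer f hf m) :=
  (prolA_toAlg hμ (hf m)).symm

theorem isSmoothOp_opT (κ : ℝ) (hμ : μ < 0) (r : ℕ) : IsSmoothOp (opT (n := n) κ μ r) := by
  have h : opT (n := n) κ μ r = (opK κ μ)^[r] := funext (opT_eq_iterate κ μ r)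
  rw [h]
  induction r with
  | zero => exact ⟨id, id, fun _ _ _ _ => rfl, fun _ _ _ _ _ => rfl⟩
  | succ r ih =>
    have ih' := ih (funext (opT_eq_iterate κ μ r))
    have hK := isSmoothOp_opK (n := n) κ hμ
    rw [Function.iterate_succ']
    exact ⟨fun hf => hK.smooth (ih'.smooth hf), fun h => hK.eqOn (ih'.eqOn h),
      fun hf hg z hz => (hK.eqOn (ih'.add hf hg) hz).trans
        (hK.add (ih'.smooth hf) (ih'.smooth hg) z hz),
      fun c f hf z hz => (hK.eqOn (ih'.const_mul c hf) hz).trans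
        (hK.const_mul c (ih'.smooth hf) z hz)⟩

theorem toAlg_opT (hμ : μ < 0) (r : ℕ) {f : Fn n} (hf : SmoothFn f) :
    toAlg (opT κ μ r f) ((isSmoothOp_opT κ hμ r).smooth hf) = (opKA κ hμ ^ r) (toAlg f hf) := by
  induction r with
  | zero => rw [pow_zero, Module.End.one_apply, toAlg_eq_iff, opT_eq_iterate]; exact fun _ _ => rfl
  | succ r ih =>
    rw [pow_succ', Module.End.mul_apply, ← ih, opKA_toAlg, toAlg_eq_iff, opT_eq_iterate,
      opT_eq_iterate, Function.iterate_succ_apply']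
    exact fun _ _ => rfl

theorem ext_opT_mem (κ : ℝ) (hμ : μ < 0) {f : Series n} (hf : f ∈ smoothSeries n) :
    ext (opT κ μ) f ∈ smoothSeries n :=
  fun _ => SmoothFn.sum fun _ _ => (isSmoothOp_opT κ hμ _).smooth (hf _)

theorem toSer_ext_opT (κ : ℝ) (hμ : μ < 0) {f : Series n} (hf : f ∈ smoothSeries n) :
    toSer (ext (opT κ μ) f) (ext_opT_mem κ hμ hf) = opTS hμ κ (toSer f hf) := by
  ext1 m
  simp only [opTS, seriesMap, toSer, ← toAlg_opT]
  exact toAlg_sum _ fun p => (isSmoothOp_opT κ hμ _).smooth (hf _)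

theorem toSer_prolS_ext_opT (hμ : μ < 0) {f : Series n} (hf : f ∈ smoothSeries n) :
    toSer (prolS μ (ext (opT κ μ) f)) (prolS_mem hμ (ext_opT_mem κ hμ hf)) =
      remS hμ κ (toSer f hf) := by
  ext1 m
  rw [toSer_prolS hμ (ext_opT_mem κ hμ hf), toSer_ext_opT κ hμ hf]
  rfl

theorem oneSubLambdaK_mem (κ : ℝ) (hμ : μ < 0) {f : Series n} (hf : f ∈ smoothSeries n) :
    oneSubLambdaK κ μ f ∈ smoothSeries n
  | 0 => hf 0
  | m + 1 => (hf (m + 1)).sub ((isSmoothOp_opK κ hμ).smooth (hf m))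

theorem toSer_oneSubLambdaK_succ (κ : ℝ) (hμ : μ < 0) {f : Series n} (hf : f ∈ smoothSeries n)
    (m : ℕ) : toSer (oneSubLambdaK κ μ f) (oneSubLambdaK_mem κ hμ hf) (m + 1) =
      toSer f hf (m + 1) - opKA κ hμ (toSer f hf m) := by
  simp only [toSer, opKA_toAlg, ← toAlg_sub]
  rfl

theorem oneSubLambdaK_ext_opT (κ : ℝ) (hμ : μ < 0) {f : Series n} (hf : f ∈ smoothSeries n) :
    SEq (oneSubLambdaK κ μ (ext (opT κ μ) f)) f := by
  rw [← toSer_eq_iff (oneSubLambdaK_mem κ hμ (ext_opT_mem κ hμ hf)) hf]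
  ext1 m
  cases m with
  | zero =>
    change toSer (ext (opT κ μ) f) (ext_opT_mem κ hμ hf) 0 = _
    rw [toSer_ext_opT κ hμ hf, opTS_zero]
  | succ m =>
    rw [toSer_oneSubLambdaK_succ κ hμ (ext_opT_mem κ hμ hf), toSer_ext_opT κ hμ hf, opTS_succ,
      add_sub_cancel_right]

theorem ext_opT_oneSubLambdaK (κ : ℝ) (hμ : μ < 0) {f : Series n} (hf : f ∈ smoothSeries n) :
    SEq (ext (opT κ μ) (oneSubLambdaK κ μ f)) f := by
  rw [← toSer_eq_iff (ext_opT_mem κ hμ (oneSubLambdaK_mem κ hμ hf)) hf,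
    toSer_ext_opT κ hμ (oneSubLambdaK_mem κ hμ hf)]
  ext1 m
  induction m with
  | zero => rw [opTS_zero]; rfl
  | succ m ih => rw [opTS_succ, ih, toSer_oneSubLambdaK_succ κ hμ hf, sub_add_cancel]

theorem mem_homog_iff {f : Series n} (hf : f ∈ smoothSeries n) :
    f ∈ homog n ↔ ∀ m, IsHomog (toSer f hf m) := by
  simp only [toSer, isHomog_toAlg]
  exact ⟨fun h => h.2, fun h => ⟨hf, h⟩⟩

theorem mem_spaceF_iff (hμ : μ < 0) {f : Series n} (hf : f ∈ smoothSeries n) :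
    f ∈ spaceF n μ ↔ ∀ m, prolA hμ (toSer f hf m) = toSer f hf m := by
  simp only [← toSer_prolS]
  rw [← funext_iff, eq_comm, toSer_eq_iff]
  exact ⟨fun h => h.2, fun h => ⟨hf, h⟩⟩

theorem homog_subset_spaceF (hμ : μ < 0) {f : Series n} (hf : f ∈ homog n) : f ∈ spaceF n μ :=
  (mem_spaceF_iff hμ hf.1).2 fun m => ((mem_homog_iff hf.1).1 hf m).prolA_eq hμ

theorem euler_eqOn_eulerBar_of_mem_homog {f : Series n} (hf : f ∈ homog n) (m : ℕ) :
    Set.EqOn (euler (f m)) (eulerBar (f m)) (phase n) := by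
  have h := ((mem_homog_iff hf.1).1 hf m).eulerDer_eq_zero
  rw [← toAlg_eq_iff (hf.1 m).smooth_euler (hf.1 m).smooth_eulerBar, ← eulerDer_toAlg (hf.1 m),
    ← eulerBarDer_toAlg (hf.1 m)]
  exact h.1.trans h.2.symm

theorem constS_mem_homog {f : Series n} (hf : f ∈ homog n) (m : ℕ) : constS (f m) ∈ homog n := by
  refine ⟨constS_mem (hf.1 m), fun k c hc z hz => ?_⟩
  cases k with
  | zero => exact hf.2 m c hc z hz
  | succ k => rfl

/-! ### The classical reduced algebra -/

theorem poisson_zero_right (f : Fn n) : poisson κ f (0 : Fn n) = 0 := by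
  ext z
  have h : ∀ i, dz i (0 : Fn n) = 0 := dz_const 0
  have h' : ∀ i, dzbar i (0 : Fn n) = 0 := dzbar_const 0
  simp [poisson, h, h']

theorem poissonS_constS_right (f : Series n) (g : Fn n) (m : ℕ) :
    poissonS κ f (constS g) m = poisson κ (f m) g := by
  ext z
  rw [poissonS, sum_eq_single (m, 0)]
  · rfl
  · rintro ⟨i, j⟩ hp hne
    have hj : j ≠ 0 := by
      rintro rfl
      exact hne (by rw [HasAntidiagonal.mem_antidiagonal] at hp; simpa using hp)
    obtain ⟨j, rfl⟩ := Nat.exists_eq_succ_of_ne_zero hj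
    exact congrFun (poisson_zero_right _) z
  · simp [HasAntidiagonal.mem_antidiagonal]

theorem SmoothFn.smooth_poisson {f g : Fn n} (hf : SmoothFn f) (hg : SmoothFn g) :
    SmoothFn (poisson κ f g) :=
  (smoothFn_const _).mul (SmoothFn.sum fun i _ =>
    ((hf.smooth_dz i).mul (hg.smooth_dzbar i)).sub ((hf.smooth_dzbar i).mul (hg.smooth_dz i)))

/-- A function vanishing on the surface is `h J` with smooth `h`, and `{f, h J} = h {f, J}` where `J
= 0`. -/
theorem poisson_eq_zero_of_vanishing (hμ : μ < 0) {f g : Fn n} (hg : SmoothFn g)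
    (h0 : ∀ z ∈ surface n μ, g z = 0) (h : Set.EqOn (euler f) (eulerBar f) (phase n))
    {z : Coord n} (hz : z ∈ surface n μ) : poisson κ f g z = 0 := by
  have hzp := surface_subset_phase hμ hz
  have hJ : J μ z = 0 := hz
  have e : Set.EqOn g (fun w => compJ μ g w * J μ w) (phase n) := fun w hw => by
    have := eq_prol_add_compJ_mul_J hμ g w
    rwa [prol, h0 _ (proj_mem_surface hμ hw), zero_add] at this
  have hc := (hg.smooth_compJ hμ).differentiableAt hzp
  have hJd := (smoothFn_J (n := n) μ).differentiableAt hzp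
  have h1 : poisson κ f g z = compJ μ g z * poisson κ f (J μ) z := by
    simp only [poisson, dz_eqOn (isOpen_phase n) e _ hzp, dzbar_eqOn (isOpen_phase n) e _ hzp,
      dz_mul hc hJd, dzbar_mul hc hJd, hJ, mul_zero, zero_add, mul_sum]
    exact sum_congr rfl fun i _ => by ring
  rw [h1, poisson_J, h hzp, sub_self, mul_zero, mul_zero]

/-- Testing against `J ∈ I` gives `E f = Ē f` on the surface only; radial invariance of the
difference extends it to the whole phase space. -/
theorem algB_inter_spaceF (hκ : 0 < κ) (hμ : μ < 0) : algB n κ μ ∩ spaceF n μ = homog n := by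
  ext f
  constructor
  · rintro ⟨⟨hf, hB⟩, hF⟩
    rw [mem_homog_iff hf]
    intro m
    have hp := (mem_spaceF_iff hμ hf).1 hF m
    refine isHomog_of_prolA_eq hμ hp (sub_eq_zero.1 ?_)
    rw [← prolA_eulerDer_sub hμ hp]
    have hJI : constS (J μ) ∈ idealI n μ := by
      refine ⟨constS_mem (smoothFn_J μ), fun k z hz => ?_⟩
      cases k with
      | zero => exact hz
      | succ k => rfl
    have h0 := (hB _ hJI).2 m
    rw [toSer, eulerDer_toAlg, eulerBarDer_toAlg, ← toAlg_sub, prolA_toAlg, ← toAlg_zero,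
      toAlg_eq_iff]
    intro z hz
    have h1 := h0 _ (proj_mem_surface hμ hz)
    rw [poissonS_constS_right, poisson_J] at h1
    have hκ' : Complex.I * ((κ : ℂ) / 2) ≠ 0 :=
      mul_ne_zero Complex.I_ne_zero (div_ne_zero (Complex.ofReal_ne_zero.2 hκ.ne') two_ne_zero)
    exact (mul_eq_zero.1 h1).resolve_left hκ'
  · intro hf
    refine ⟨⟨hf.1, fun g hg => ⟨fun m => ?_, fun m z hz => ?_⟩⟩, homog_subset_spaceF hμ hf⟩
    · exact SmoothFn.sum fun p _ => (hf.1 _).smooth_poisson (hg.1 _)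
    · exact sum_eq_zero fun p _ => poisson_eq_zero_of_vanishing hμ (hg.1 _) (hg.2 _)
        (euler_eqOn_eulerBar_of_mem_homog hf _) hz

/-! ### The deformed algebra -/

theorem wickA_one_right (f : ℕ → SmoothAlg n) : wickA n κ f (Pi.single 0 1) = f := by
  ext1 m
  rw [wickA, seriesMul_single_right, sum_eq_single (0, m), wickMA_zero, mul_one]
  · rintro ⟨i, j⟩ hp hne
    have hi : i ≠ 0 := by
      rintro rfl
      exact hne (by rw [HasAntidiagonal.mem_antidiagonal] at hp; simpa using hp)
    obtain ⟨i, rfl⟩ := Nat.exists_eq_succ_of_ne_zero hi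
    simp [wickMA, expContr, iterContr_succ]
  · simp [HasAntidiagonal.mem_antidiagonal]

theorem wickA_one_left (f : ℕ → SmoothAlg n) : wickA n κ (Pi.single 0 1) f = f := by
  ext1 m
  rw [wickA, seriesMul_single_left, sum_eq_single (0, m), wickMA_zero, one_mul]
  · rintro ⟨i, j⟩ hp hne
    have hi : i ≠ 0 := by
      rintro rfl
      exact hne (by rw [HasAntidiagonal.mem_antidiagonal] at hp; simpa using hp)
    obtain ⟨i, rfl⟩ := Nat.exists_eq_succ_of_ne_zero hi
    simp [wickMA, expContr, iterContr_succ]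
  · simp [HasAntidiagonal.mem_antidiagonal]

theorem mem_starI_iff {f : Series n} (hf : f ∈ smoothSeries n) :
    f ∈ starI n κ μ ↔ ∃ a, toSer f hf = wickA n κ a (JS n μ) := by
  constructor
  · rintro ⟨_, a, ha, h⟩
    refine ⟨toSer a ha, ?_⟩
    rw [← toSer_constS_J, ← toSer_wick κ ha (constS_mem (smoothFn_J μ)), toSer_eq_iff]
    exact h
  · rintro ⟨a, h⟩
    obtain ⟨a, ha, rfl⟩ := exists_toSer_eq a
    refine ⟨hf, a, ha, ?_⟩
    rwa [← toSer_constS_J, ← toSer_wick κ ha (constS_mem (smoothFn_J μ)), toSer_eq_iff] at h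

/-- The commutator of `f` with `J = 1 * J` is a prolongation and lies in the left ideal, so
uniqueness of division forces it to vanish. Conversely, if `f` commutes with `J`, then `f * (a * J)
- (a * J) * f = (f * a - a * f) * J`. -/
theorem starB_inter_spaceF (hκ : 0 < κ) (hμ : μ < 0) :
    starB n κ μ ∩ spaceF n μ = homog n := by
  ext f
  constructor
  · rintro ⟨⟨hf, hB⟩, hF⟩
    have hp := (mem_spaceF_iff hμ hf).1 hF
    have hJ := constS_mem (n := n) (smoothFn_J μ)
    have hJI : constS (J μ) ∈ starI n κ μ :=
      (mem_starI_iff hJ).2 ⟨Pi.single 0 1, by rw [wickA_one_left, toSer_constS_J]⟩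
    have h := (mem_starI_iff (sub_mem_smoothSeries (wick_mem κ hf hJ) (wick_mem κ hJ hf))).1
      (hB _ hJI)
    obtain ⟨a, ha⟩ := h
    rw [toSer_sub (wick_mem κ hf hJ) (wick_mem κ hJ hf), toSer_wick κ hf hJ,
      toSer_wick κ hJ hf, toSer_constS_J] at ha
    set F := toSer f hf with hFdef
    set h := wickA n κ (JS n μ) F - wickA n κ F (JS n μ) with hdef
    have h0 : h 0 = 0 := by
      rw [hdef, Pi.sub_apply, wickA_JS_zero, JS_wickA_zero, sub_self]
    have hs : ∀ m, h (m + 1) = ((κ : ℂ) / 2) • (eulerDer n (F m) - eulerBarDer n (F m)) :=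
      fun m => by
        rw [hdef, Pi.sub_apply, wickA_JS_succ, JS_wickA_succ, smul_sub]
        ring
    have hprol : ∀ m, prolA hμ (h m) = h m := fun m => by
      cases m with
      | zero => rw [h0, map_zero]
      | succ m => rw [hs, map_smul, prolA_eulerDer_sub hμ (hp m)]
    have hz := (eq_zero_of_add_wickA_JS_eq_zero (κ := κ) hμ hprol (by
      rw [← ha, hdef]; ring)).1
    rw [mem_homog_iff hf]
    intro m
    refine isHomog_of_prolA_eq hμ (hp m) (sub_eq_zero.1 ?_)
    have h1 := congrFun hz (m + 1)
    rw [hs, Pi.zero_apply, smul_eq_zero] at h1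
    exact h1.resolve_left (div_ne_zero (Complex.ofReal_ne_zero.2 hκ.ne') two_ne_zero)
  · intro hf
    refine ⟨⟨hf.1, fun g hg => ?_⟩, homog_subset_spaceF hμ hf⟩
    obtain ⟨a, ha⟩ := (mem_starI_iff hg.1).1 hg
    have hcomm := wickA_JS_comm (κ := κ) (μ := μ) (f := toSer f hf.1) fun m => by
      have := ((mem_homog_iff hf.1).1 hf m).eulerDer_eq_zero
      rw [this.1, this.2]
    refine (mem_starI_iff (sub_mem_smoothSeries (wick_mem κ hf.1 hg.1)
      (wick_mem κ hg.1 hf.1))).2 ⟨wickA n κ (toSer f hf.1) a - wickA n κ a (toSer f hf.1), ?_⟩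
    rw [toSer_sub (wick_mem κ hf.1 hg.1) (wick_mem κ hg.1 hf.1),
      toSer_wick κ hf.1 hg.1, toSer_wick κ hg.1 hf.1, ha,
      wickA_sub_left, wickA_assoc, wickA_assoc, wickA_assoc, hcomm]

/-! ### The operator `S` -/

theorem exists_isOpS (hκ : 0 < κ) (hμ : μ < 0) : ∃ S : ℕ → Fn n → Fn n, IsOpS κ μ S := by
  refine ⟨_, isOpS_id hκ hμ fun f hf => ?_⟩
  rw [algB_inter_spaceF hκ hμ] at hf
  exact euler_eqOn_eulerBar_of_mem_homog hf 0

theorem ext_S_eq (hκ : 0 < κ) (hμ : μ < 0) {S : ℕ → Fn n → Fn n} (hS : IsOpS κ μ S)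
    {f : Series n} (hf : f ∈ homog n) : SEq (ext S f) f := by
  intro m z hz
  have key : ∀ k j, S k (f j) z = if k = 0 then f j z else 0 := fun k j => by
    have h := hS.eqOn hμ (f := f j)
      (by rw [algB_inter_spaceF hκ hμ]; exact constS_mem_homog hf j)
      (euler_eqOn_eulerBar_of_mem_homog hf j) k hz
    rw [h]
    split_ifs <;> rfl
  simp only [ext, key]
  rw [sum_eq_single (0, m)]
  · simp
  · rintro ⟨i, j⟩ hp hne
    refine if_neg ?_
    rintro rfl
    exact hne (by rw [HasAntidiagonal.mem_antidiagonal] at hp; simpa using hp)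
  · simp [HasAntidiagonal.mem_antidiagonal]

/-! ### The explicit product -/

theorem SmoothFn.pow {f : Fn n} (hf : SmoothFn f) (k : ℕ) : SmoothFn (fun z => f z ^ k) :=
  ContDiffOn.pow hf k

theorem smoothFn_starD (κ μ : ℝ) (r : ℕ) {f g : Fn n} (hf : SmoothFn f) (hg : SmoothFn g) :
    SmoothFn (fun z => ∑ p ∈ antidiagonal r,
      (1 / (-2 * (μ : ℂ))) ^ r * (κ : ℂ) ^ p.2 * (coeffA p.1 p.2 : ℂ) * (zz z : ℂ) ^ p.1 *
        wickM κ p.1 f g z) :=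
  SmoothFn.sum fun p _ => ((smoothFn_const _).mul (smoothFn_zz.pow p.1)).mul
    (hf.smooth_wickM κ hg _)

theorem toAlg_pow {f : Fn n} (hf : SmoothFn f) (k : ℕ) :
    toAlg (fun z => f z ^ k) (hf.pow k) = toAlg f hf ^ k := rfl

theorem toAlg_starD (r : ℕ) {f g : Fn n} (hf : SmoothFn f) (hg : SmoothFn g) :
    toAlg _ (smoothFn_starD κ μ r hf hg) = starMA n κ μ r (toAlg f hf) (toAlg g hg) := by
  rw [starMA_apply]
  refine (toAlg_sum _ fun p : ℕ × ℕ => ((smoothFn_const ((1 / (-2 * (μ : ℂ))) ^ r *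
    (κ : ℂ) ^ p.2 * (coeffA p.1 p.2 : ℂ))).mul (smoothFn_zz.pow p.1)).mul
    (hf.smooth_wickM κ hg p.1)).trans (sum_congr rfl fun p _ => ?_)
  rw [← toAlg_wickM, zzA, ← toAlg_pow smoothFn_zz,
    ← toAlg_mul (smoothFn_zz.pow p.1) (hf.smooth_wickM κ hg p.1), ← toAlg_const_mul, toAlg_eq_iff]
  exact fun z _ => mul_assoc _ _ _

theorem starCP_mem_smoothSeries (κ μ : ℝ) {f g : Series n} (hf : f ∈ smoothSeries n)
    (hg : g ∈ smoothSeries n) : starCP κ μ f g ∈ smoothSeries n :=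
  ext₂_mem (fun r _ _ hf hg => smoothFn_starD κ μ r hf hg) hf hg

theorem toSer_starCP (hμ : μ < 0) {f g : Series n} (hf : f ∈ homog n) (hg : g ∈ homog n) :
    toSer (starCP κ μ f g) (starCP_mem_smoothSeries κ μ hf.1 hg.1) =
      redS hμ κ (toSer f hf.1) (toSer g hg.1) := by
  rw [redS_eq_seriesMul hμ ((mem_homog_iff hf.1).1 hf) ((mem_homog_iff hg.1).1 hg)]
  exact toSer_ext₂ (fun r _ _ hf hg => smoothFn_starD κ μ r hf hg) hf.1 hg.1
    fun r i j => toAlg_starD r (hf.1 i) (hg.1 j)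

theorem starCP_mem_homog (hμ : μ < 0) {f g : Series n} (hf : f ∈ homog n) (hg : g ∈ homog n) :
    starCP κ μ f g ∈ homog n := by
  rw [mem_homog_iff (starCP_mem_smoothSeries κ μ hf.1 hg.1), toSer_starCP hμ hf hg]
  exact isHomog_redS hμ ((mem_homog_iff hf.1).1 hf) ((mem_homog_iff hg.1).1 hg)

theorem starCP_eq_prolS (hμ : μ < 0) {f g : Series n} (hf : f ∈ homog n) (hg : g ∈ homog n) :
    SEq (starCP κ μ f g) (prolS μ (ext (opT κ μ) (wick κ f g))) := by
  rw [← toSer_eq_iff (starCP_mem_smoothSeries κ μ hf.1 hg.1)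
    (prolS_mem hμ (ext_opT_mem κ hμ (wick_mem κ hf.1 hg.1))), toSer_starCP hμ hf hg,
    toSer_prolS_ext_opT hμ (wick_mem κ hf.1 hg.1), toSer_wick κ hf.1 hg.1]
  rfl

theorem prolS_ext_opT_congr (hμ : μ < 0) {f g : Series n} (h : SEq f g) :
    SEq (prolS μ (ext (opT κ μ) f)) (prolS μ (ext (opT κ μ) g)) := fun m z hz => by
  simp only [prolS, prol, ext]
  exact sum_congr rfl fun _ _ => (isSmoothOp_opT κ hμ _).eqOn (h _) (proj_mem_phase hμ hz)

/-- `S` acts as the identity on all three homogeneous series, leaving the remainder of `f * g`. -/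
theorem isReducedProduct_iff (hκ : 0 < κ) (hμ : μ < 0) {S : ℕ → Fn n → Fn n}
    (hS : IsOpS κ μ S) {f g : Series n} (hf : f ∈ homog n) (hg : g ∈ homog n) (h : Series n) :
    IsReducedProduct κ μ S f g h ↔ h ∈ homog n ∧ SEq h (starCP κ μ f g) := by
  rw [IsReducedProduct, algB_inter_spaceF hκ hμ]
  refine and_congr_right fun hh => ?_
  have h1 : SEq (prolS μ (ext (opT κ μ) (wick κ (ext S f) (ext S g)))) (starCP κ μ f g) :=
    (prolS_ext_opT_congr hμ (wick_congr (ext_S_eq hκ hμ hS hf) (ext_S_eq hκ hμ hS hg))).trans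
      (starCP_eq_prolS hμ hf hg).symm
  have h2 := ext_S_eq hκ hμ hS hh
  exact ⟨fun h3 => h2.symm.trans (h3.trans h1), fun h3 => h2.trans (h3.trans h1.symm)⟩

/-! ### The star product axioms -/

theorem starCP_assoc (hμ : μ < 0) {f g h : Series n} (hf : f ∈ homog n) (hg : g ∈ homog n)
    (hh : h ∈ homog n) :
    SEq (starCP κ μ (starCP κ μ f g) h) (starCP κ μ f (starCP κ μ g h)) := by
  have hfg := starCP_mem_homog (κ := κ) hμ hf hg
  have hgh := starCP_mem_homog (κ := κ) hμ hg hh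
  rw [← toSer_eq_iff (starCP_mem_smoothSeries κ μ hfg.1 hh.1)
    (starCP_mem_smoothSeries κ μ hf.1 hgh.1), toSer_starCP hμ hfg hh, toSer_starCP hμ hf hgh,
    toSer_starCP hμ hf hg, toSer_starCP hμ hg hh]
  exact redS_assoc hμ ((mem_homog_iff hh.1).1 hh)

theorem constS_one_mem_homog : constS (1 : Fn n) ∈ homog n := by
  refine ⟨constS_mem (smoothFn_const 1), fun m c _ z _ => ?_⟩
  cases m <;> rfl

theorem toSer_constS_one :
    toSer (constS (1 : Fn n)) constS_one_mem_homog.1 = Pi.single 0 1 :=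
  toSer_constS (smoothFn_const 1)

theorem remS_eq_self (hμ : μ < 0) {f : ℕ → SmoothAlg n} (hf : ∀ m, prolA hμ (f m) = f m) :
    remS hμ κ f = f := by
  refine (eq_remS_of_eq_add hμ (a := 0) hf ?_).symm
  rw [show wickA n κ 0 (JS n μ) = 0 from ?_, add_zero]
  ext1 m
  simp [wickA, seriesMul]

theorem starCP_one (hμ : μ < 0) {f : Series n} (hf : f ∈ homog n) :
    SEq (starCP κ μ f (constS 1)) f := by
  rw [← toSer_eq_iff (starCP_mem_smoothSeries κ μ hf.1 constS_one_mem_homog.1) hf.1,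
    toSer_starCP hμ hf constS_one_mem_homog, toSer_constS_one, redS, wickA_one_right]
  exact remS_eq_self hμ fun m => ((mem_homog_iff hf.1).1 hf m).prolA_eq hμ

theorem one_starCP (hμ : μ < 0) {f : Series n} (hf : f ∈ homog n) :
    SEq (starCP κ μ (constS 1) f) f := by
  rw [← toSer_eq_iff (starCP_mem_smoothSeries κ μ constS_one_mem_homog.1 hf.1) hf.1,
    toSer_starCP hμ constS_one_mem_homog hf, toSer_constS_one, redS, wickA_one_left]
  exact remS_eq_self hμ fun m => ((mem_homog_iff hf.1).1 hf m).prolA_eq hμ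

theorem starCP_zero_apply (f g : Series n) (z : Coord n) :
    starCP κ μ f g 0 z = f 0 z * g 0 z := by
  simp [starCP, ext₂, coeffA_zero_right, wickM_zero]

theorem starCP_one_apply (f g : Series n) (z : Coord n) :
    starCP κ μ f g 1 z = f 0 z * g 1 z + f 1 z * g 0 z +
      1 / (-2 * (μ : ℂ)) * zz z * wickM κ 1 (f 0) (g 0) z := by
  simp [starCP, ext₂, Nat.antidiagonal_succ, coeffA_zero_right, coeffA_zero_left, wickM_zero]

theorem wickM_one_sub (f g : Fn n) (z : Coord n) :
    wickM κ 1 f g z - wickM κ 1 g f z = Complex.I * poisson κ f g z := by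
  rw [wickM_one, wickM_one, poisson, ← mul_assoc, mul_div_cancel₀ _ Complex.I_ne_zero, ← mul_sub,
    ← sum_sub_distrib]
  congr 1
  exact sum_congr rfl fun i _ => by ring

/-- First derivatives of homogeneous functions scale with degree `-1` under positive reals, so the
bracket has degree `-2`, like `1/(z z̄)`. -/
theorem prol_poisson_of_homog (hμ : μ < 0) {f g : Fn n} (hf : SmoothFn f) (hg : SmoothFn g)
    (hf' : ∀ c : ℂ, c ≠ 0 → ∀ z ∈ phase n, f (c • z) = f z)
    (hg' : ∀ c : ℂ, c ≠ 0 → ∀ z ∈ phase n, g (c • z) = g z) {z : Coord n} (hz : z ∈ phase n) :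
    prol μ (poisson κ f g) z = 1 / (-2 * (μ : ℂ)) * zz z * poisson κ f g z := by
  have hs := sqrt_ratio_pos hμ hz
  have hsx := sq_sqrt_ratio_mul hμ hz
  rw [prol, proj]
  generalize Real.sqrt (-2 * μ / zz z) = s at hs hsx
  have hs0 : (s : ℂ) ≠ 0 := Complex.ofReal_ne_zero.2 hs.ne'
  have hsz := smul_mem_phase hs0 hz
  have d : ∀ {h : Fn n}, SmoothFn h → (∀ c : ℂ, c ≠ 0 → ∀ z ∈ phase n, h (c • z) = h z) → ∀ i,
      dz i h z = s * dz i h ((s : ℂ) • z) ∧ dzbar i h z = s * dzbar i h ((s : ℂ) • z) :=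
    fun {h} hh hh' i => by
      have e : Set.EqOn h (fun w => h ((s : ℂ) • w)) (phase n) :=
        fun w hw => (hh' s hs0 w hw).symm
      rw [dz_eqOn (isOpen_phase n) e i hz, dzbar_eqOn (isOpen_phase n) e i hz,
        dz_comp_smul (hh.differentiableAt hsz), dzbar_comp_smul (hh.differentiableAt hsz),
        Complex.conj_ofReal]
      exact ⟨rfl, rfl⟩
  have h1 : poisson κ f g z = (s : ℂ) ^ 2 * poisson κ f g ((s : ℂ) • z) := by
    simp only [poisson, (d hf hf' _).1, (d hf hf' _).2, (d hg hg' _).1, (d hg hg' _).2, mul_sum]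
    exact sum_congr rfl fun i _ => by ring
  have h2 : (s : ℂ) ^ 2 * zz z = -2 * μ := by exact_mod_cast hsx
  have hμ' : (μ : ℂ) ≠ 0 := Complex.ofReal_ne_zero.2 hμ.ne
  rw [h1]
  field_simp
  linear_combination poisson κ f g ((s : ℂ) • z) * h2

theorem wickM_zero_left (r : ℕ) (g : Fn n) : wickM κ r 0 g = 0 := by
  have h : ∀ i : Fin r → Fin (n + 1), dzIter r i (0 : Fn n) = 0 := by
    induction r with
    | zero => exact fun _ => rfl
    | succ r ih => intro i; rw [dzIter, ih]; exact dz_const 0 _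
  ext z
  simp [wickM, contraction, h]

theorem wickM_zero_right (r : ℕ) (f : Fn n) : wickM κ r f 0 = 0 := by
  have h : ∀ i : Fin r → Fin (n + 1), dzbarIter r i (0 : Fn n) = 0 := by
    induction r with
    | zero => exact fun _ => rfl
    | succ r ih => intro i; rw [dzbarIter, ih]; exact dzbar_const 0 _
  ext z
  simp [wickM, contraction, h]

theorem isStarProductCP_starCP (κ : ℝ) (hμ : μ < 0) :
    IsStarProductCP κ μ (starCP (n := n) κ μ) where
  mem _ hf _ hg := starCP_mem_homog hμ hf hg
  assoc _ hf _ hg _ hh := starCP_assoc hμ hf hg hh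
  mul_one _ hf := starCP_one hμ hf
  one_mul _ hf := one_starCP hμ hf
  order_zero f _ g _ z _ := starCP_zero_apply f g z
  order_one f hf g hg z hz := by
    rw [prol_poisson_of_homog hμ (hf.1 0) (hg.1 0) (hf.2 0) (hg.2 0) hz, starCP_one_apply,
      starCP_one_apply]
    linear_combination (1 / (-2 * (μ : ℂ)) * zz z) * wickM_one_sub (κ := κ) (f 0) (g 0) z
  localL f _ g _ U hU _ h0 m z hz := by
    simp only [starCP, ext₂]
    refine sum_eq_zero fun p _ => sum_eq_zero fun q _ => sum_eq_zero fun t _ => ?_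
    have e : Set.EqOn (f q.1) 0 U := h0 q.1
    rw [wickM_eqOn κ hU e (Set.eqOn_refl _ _) t.1 hz, wickM_zero_left, Pi.zero_apply, mul_zero]
  localR f _ g _ U hU _ h0 m z hz := by
    simp only [starCP, ext₂]
    refine sum_eq_zero fun p _ => sum_eq_zero fun q _ => sum_eq_zero fun t _ => ?_
    have e : Set.EqOn (g q.2) 0 U := h0 q.2
    rw [wickM_eqOn κ hU (Set.eqOn_refl _ _) e t.1 hz, wickM_zero_right, Pi.zero_apply, mul_zero]

/-! ### The closed formula -/

theorem coeffA_eq_complex {s l : ℕ} (hs : 1 ≤ s) :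
    (coeffA s l : ℂ) = ∑ k ∈ Icc 1 s, (-1 : ℂ) ^ (s + l - k) * (k : ℂ) ^ (s + l - 1) /
      (((s - k).factorial : ℂ) * ((k - 1).factorial : ℂ)) := by
  have h := congrArg (fun q : ℚ => (q : ℂ)) (coeffA_eq s l hs)
  simp only [Rat.cast_intCast] at h
  rw [h]
  push_cast
  rw [mul_sum]
  refine sum_congr rfl fun k hk => ?_
  rw [mem_Icc] at hk
  have h1 : ((s - 1).choose (k - 1) : ℂ) * ((k - 1).factorial : ℂ) * ((s - k).factorial : ℂ) =
      ((s - 1).factorial : ℂ) := by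
    have := Nat.choose_mul_factorial_mul_factorial (n := s - 1) (k := k - 1) (by omega)
    rw [show s - 1 - (k - 1) = s - k by omega] at this
    exact_mod_cast this
  have h2 : ((k - 1).factorial : ℂ) ≠ 0 := Nat.cast_ne_zero.2 (Nat.factorial_ne_zero _)
  have h3 : ((s - k).factorial : ℂ) ≠ 0 := Nat.cast_ne_zero.2 (Nat.factorial_ne_zero _)
  have h4 : ((s - 1).factorial : ℂ) ≠ 0 := Nat.cast_ne_zero.2 (Nat.factorial_ne_zero _)
  rw [← h1] at h4 ⊢
  have h5 : ((s - 1).choose (k - 1) : ℂ) ≠ 0 := fun h => h4 (by rw [h]; ring)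
  field_simp

/-- Equality holds operator by operator: at order `r` put `s = k` and `l = r - s` and insert the
closed form of `A^{(s)}_{r-s}`. The term `s = 0` drops out for `r > 0`, and `κ^s` from `M_s`
completes `κ^{r-s}` to `κ^r`. -/
theorem starCP_eq_starBBEW (f g : Series n) : starCP κ μ f g = starBBEW κ μ f g := by
  have key : ∀ (r : ℕ) (f g : Fn n) (z : Coord n), (∑ p ∈ antidiagonal r,
      (1 / (-2 * (μ : ℂ))) ^ r * (κ : ℂ) ^ p.2 * (coeffA p.1 p.2 : ℂ) * (zz z : ℂ) ^ p.1 *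
        wickM κ p.1 f g z) = if r = 0 then f z * g z else
    ((κ : ℂ) / (-2 * (μ : ℂ))) ^ r * ∑ s ∈ Icc 1 r, ∑ k ∈ Icc 1 s,
      ((-1 : ℂ) ^ (r - k) * (k : ℂ) ^ (r - 1) /
          ((s.factorial : ℂ) * ((s - k).factorial : ℂ) * ((k - 1).factorial : ℂ))) *
        (zz z : ℂ) ^ s * contraction s f g z := by
    intro r f g z
    rcases Nat.eq_zero_or_pos r with rfl | hr
    · simp [coeffA_zero_right, wickM_zero]
    · rw [if_neg hr.ne', Nat.sum_antidiagonal_eq_sum_range_succ_mk, range_eq_Ico,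
        sum_eq_sum_Ico_succ_bot (by omega)]
      have h0 : coeffA 0 (r - 0) = 0 := by
        obtain ⟨r, rfl⟩ := Nat.exists_eq_succ_of_ne_zero hr.ne'
        exact coeffA_zero_left r
      simp only [h0, Int.cast_zero, mul_zero, zero_mul, zero_add]
      rw [mul_sum, ← Ico_add_one_right_eq_Icc]
      refine sum_congr rfl fun s hs => ?_
      rw [mem_Ico] at hs
      have hsr : s + (r - s) = r := by omega
      rw [coeffA_eq_complex hs.1, hsr, wickM, mul_sum, sum_mul, sum_mul, mul_sum]
      refine sum_congr rfl fun k _ => ?_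
      have hκr : (κ : ℂ) ^ r = (κ : ℂ) ^ s * (κ : ℂ) ^ (r - s) := by rw [← pow_add, hsr]
      rw [div_pow, div_pow, one_pow, hκr]
      ring
  ext m z
  simp only [starCP, starBBEW, ext₂]
  exact sum_congr rfl fun p _ => sum_congr rfl fun q _ => key p.1 (f q.1) (g q.2) z

/-! ### Marsden-Weinstein reduction -/

theorem mem_invU1 {f : Series n} (hf : f ∈ smoothSeries n) (h : ∀ m, IsInv (toSer f hf m)) :
    f ∈ invU1 n := by
  refine ⟨hf, fun m φ z hz => ?_⟩
  have hn : ‖Complex.exp (Complex.I * (φ : ℂ))‖ = 1 := by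
    rw [mul_comm, Complex.norm_exp_ofReal_mul_I]
  have := h m _ (Complex.exp_ne_zero _) hn
  rw [toSer, scaleA_toAlg, toAlg_eq_iff] at this
  exact this hz

/-- The witness is the quotient in the division of `f * g` by `J`; it is invariant because `M_r`,
`K` and `π_J` all respect the circle action. -/
theorem isMarsdenWeinsteinProduct_starCP (hμ : μ < 0) {f g : Series n} (hf : f ∈ homog n)
    (hg : g ∈ homog n) : IsMarsdenWeinsteinProduct κ μ f g (starCP κ μ f g) := by
  have hfg := wick_mem κ hf.1 hg.1
  have hst := starCP_mem_smoothSeries κ μ hf.1 hg.1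
  have hJ := constS_mem (n := n) (smoothFn_J μ)
  refine ⟨starCP_mem_homog hμ hf hg, ?_⟩
  obtain ⟨a, ha, hq⟩ := exists_toSer_eq (quotS hμ κ (toSer (wick κ f g) hfg))
  refine ⟨a, mem_invU1 ha fun m => ?_, ?_⟩
  · rw [hq, quotS, toSer_wick κ hf.1 hg.1]
    exact (IsInv.opTS hμ (isInv_wickA ((mem_homog_iff hf.1).1 hf)
      ((mem_homog_iff hg.1).1 hg)) m).compJA hμ
  · rw [← toSer_eq_iff (sub_mem_smoothSeries hfg hst) (wick_mem κ ha hJ), toSer_sub hfg hst,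
      toSer_starCP hμ hf hg, toSer_wick κ ha hJ, hq, toSer_constS_J, sub_eq_iff_eq_add', redS,
      ← toSer_wick κ hf.1 hg.1]
    exact eq_remS_add hμ _

theorem IsMarsdenWeinsteinProduct.eq_starCP (hμ : μ < 0) {f g h : Series n} (hf : f ∈ homog n)
    (hg : g ∈ homog n) (hh : IsMarsdenWeinsteinProduct κ μ f g h) : SEq h (starCP κ μ f g) := by
  obtain ⟨hhom, a, ha, heq⟩ := hh
  have hfg := wick_mem κ hf.1 hg.1
  have hJ := constS_mem (n := n) (smoothFn_J μ)
  rw [← toSer_eq_iff (sub_mem_smoothSeries hfg hhom.1) (wick_mem κ ha.1 hJ),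
    toSer_sub hfg hhom.1, toSer_wick κ ha.1 hJ, toSer_constS_J, sub_eq_iff_eq_add',
    toSer_wick κ hf.1 hg.1] at heq
  rw [← toSer_eq_iff hhom.1 (starCP_mem_smoothSeries κ μ hf.1 hg.1), toSer_starCP hμ hf hg]
  exact eq_remS_of_eq_add hμ (fun m => ((mem_homog_iff hhom.1).1 hhom m).prolA_eq hμ) heq

end Translation

end WickCPn

theorem mainTheorem4 (n : ℕ) (κ μ : ℝ) (hκ : 0 < κ) (hμ : μ < 0) :
    -- `compJ` is the unique smooth solution of `f = prol f + h J`
    (∀ f : Fn n, SmoothFn f →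
      SmoothFn (compJ μ f) ∧
      (∀ z ∈ phase n, f z = prol μ f z + compJ μ f z * J μ z) ∧
      ∀ h : Fn n, SmoothFn h → (∀ z ∈ phase n, f z = prol μ f z + h z * J μ z) →
        Set.EqOn h (compJ μ f) (phase n)) ∧
    -- `flow` is the Hamiltonian flow of `J`
    (∀ f : Fn n, SmoothFn f → ∀ z ∈ phase n, flow κ 0 z = z ∧ ∀ t : ℝ,
      HasDerivAt (fun s => f (flow κ s z)) (poisson κ f (J μ) (flow κ t z)) t) ∧
    -- `T = ∑ λʳ Kʳ = 1 / (1 - λ K)`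
    (∀ f : Fn n, SmoothFn f → ∀ r : ℕ,
      Set.EqOn (opT κ μ r f) ((opK κ μ)^[r] f) (phase n)) ∧
    (∀ f ∈ smoothSeries n, SEq (oneSubLambdaK κ μ (ext (opT κ μ) f)) f ∧
      SEq (ext (opT κ μ) (oneSubLambdaK κ μ f)) f) ∧
    -- `B ∩ F` and `B* ∩ F` are both the space of homogeneous series
    algB n κ μ ∩ spaceF n μ = homog n ∧
    starB n κ μ ∩ spaceF n μ = homog n ∧
    -- the operator `S` exists, and is the identity on `B ∩ F`
    (∃ S : ℕ → Fn n → Fn n, IsOpS κ μ S) ∧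
    (∀ S : ℕ → Fn n → Fn n, IsOpS κ μ S → ∀ f ∈ algB n κ μ ∩ spaceF n μ, SEq (ext S f) f) ∧
    -- the reduced product is given by the explicit formula
    (∀ S : ℕ → Fn n → Fn n, IsOpS κ μ S →
      ∀ f ∈ algB n κ μ ∩ spaceF n μ, ∀ g ∈ algB n κ μ ∩ spaceF n μ,
        IsReducedProduct κ μ S f g (starCP κ μ f g) ∧
        ∀ h : Series n, IsReducedProduct κ μ S f g h → SEq h (starCP κ μ f g)) ∧
    (∀ f ∈ homog n, ∀ g ∈ homog n,
      SEq (starCP κ μ f g) (prolS μ (ext (fun r => (opK κ μ)^[r]) (wick κ f g)))) ∧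
    -- it is a star product on the complex projective space
    IsStarProductCP κ μ (starCP (n := n) κ μ) ∧
    -- the explicit coefficients
    (∀ k l : ℕ, 1 ≤ k → (coeffA k l : ℚ) = 1 / ((k - 1).factorial : ℚ) *
      ∑ j ∈ Finset.Icc 1 k,
        ((k - 1).choose (j - 1) : ℚ) * (-1) ^ (k + l - j) * (j : ℚ) ^ (k + l - 1)) ∧
    -- coincidence with the star product of Bordemann, Brischle, Emmrich and Waldmann
    (∀ f ∈ homog n, ∀ g ∈ homog n, SEq (starCP κ μ f g) (starBBEW κ μ f g)) ∧
    (∀ f ∈ homog n, ∀ g ∈ homog n,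
      IsMarsdenWeinsteinProduct κ μ f g (starCP κ μ f g) ∧
      ∀ h : Series n, IsMarsdenWeinsteinProduct κ μ f g h → SEq h (starCP κ μ f g)) := by
  have hK : opT (n := n) κ μ = fun r => (opK κ μ)^[r] :=
    funext fun r => funext (opT_eq_iterate κ μ r)
  have hBF := algB_inter_spaceF (n := n) hκ hμ
  refine ⟨fun f hf => ⟨hf.smooth_compJ hμ, fun z _ => eq_prol_add_compJ_mul_J hμ f z,
      fun h hh heq => eqOn_compJ_of_eq_prol_add hμ hf hh heq⟩,
    fun f hf z hz => ⟨flow_zero κ z, hasDerivAt_comp_flow κ μ hf hz⟩,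
    fun f _ r z _ => congrFun (opT_eq_iterate κ μ r f) z,
    fun f hf => ⟨oneSubLambdaK_ext_opT κ hμ hf, ext_opT_oneSubLambdaK κ hμ hf⟩,
    hBF, starB_inter_spaceF hκ hμ, exists_isOpS hκ hμ,
    fun S hS f hf => ext_S_eq hκ hμ hS (hBF ▸ hf),
    fun S hS f hf g hg => ?_,
    fun f hf g hg => hK ▸ starCP_eq_prolS hμ hf hg,
    isStarProductCP_starCP κ hμ, fun k l hk => coeffA_eq k l hk,
    fun f _ g _ => starCP_eq_starBBEW f g ▸ fun _ _ _ => rfl,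
    fun f hf g hg => ⟨isMarsdenWeinsteinProduct_starCP hμ hf hg,
      fun h hh => hh.eq_starCP hμ hf hg⟩⟩
  rw [hBF] at hf hg
  exact ⟨(isReducedProduct_iff hκ hμ hS hf hg _).2
      ⟨starCP_mem_homog hμ hf hg, fun _ _ _ => rfl⟩,
    fun h hh => ((isReducedProduct_iff hκ hμ hS hf hg h).1 hh).2⟩
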